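/- Let $n\ge 1$ and identify $\mathbb{R}^{2n}=\mathbb{C}^n$, $z_j=x_j+iy_j$. Let $H=(-i\nabla-\mathbf{A})^2$ with $\mathbf{A}=\frac12\sum_{j}(x_j\,dy_j-y_j\,dx_j)$, so that $d\mathbf{A}=\frac{i}{2}\sum_j dz_j\wedge d\bar z_j$, be the Landau Hamiltonian, regarded as the closure in $L^2(\mathbb{C}^n)$ of its restriction to $C_c^\infty(\mathbb{C}^n)$. For $\ell\in\mathbb{N}=\{0,1,2,\dots\}$ let $\mathcal{L}^\ell\subseteq L^2(\mathbb{C}^n)$ (the $\ell$-th Landau level) be the eigenspace of $H$ for the eigenvalue $2\ell+n$, and let $P_\ell$ be the orthogonal projection of $L^2(\mathbb{C}^n)$ onto $\mathcal{L}^\ell$. For a bounded continuous function $a$ on $\mathbb{C}^n$ let $T_\ell(a)=P_\ell\, a|_{\mathcal{L}^\ell}$ be the Toeplitz operator on $\mathcal{L}^\ell$ with symbol $a$. Let $A\subseteq C_b(\mathbb{C}^n)$ be the $C^*$-algebra of bounded continuous functions $a$ for which $a(rv)$ converges, as $r\to\infty$, uniformly in $v\in S^{2n-1}$ to a continuous function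 on $S^{2n-1}$, and let $\pi_\partial:A\to C(S^{2n-1})$, $\pi_\partial(a)(v)=\lim_{r\to\infty}a(rv)$. For $N\in\mathbb{N}$ and $u=(u_{ij})\in A\otimes M_N(\mathbb{C})=M_N(A)$ let $T_\ell(u)=(T_\ell(u_{ij}))_{i,j}$, acting on $\mathcal{L}^\ell\otimes\mathbb{C}^N$, and $\pi_\partial(u)=(\pi_\partial(u_{ij}))_{i,j}\in M_N(C(S^{2n-1}))$. Then for all $N$ and all $u\in A\otimes M_N(\mathbb{C})$, the operator $T_\ell(u)$ is Fredholm if and only if $\pi_\partial(u)$ is invertible in $M_N(C(S^{2n-1}))$. Moreover, the kernel of the map $a\mapsto T_\ell(a)+\mathcal{K}(\mathcal{L}^\ell)$ from $A$ to the Calkin algebra $\mathcal{B}(\mathcal{L}^\ell)/\mathcal{K}(\mathcal{L}^\ell)$ is $C_0(\mathbb{C}^n)$; that is, for $a\in A$, $T_\ell(a)$ is compact if and only if $a$ vanishes at infinity. -/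

import Mathlib

open MeasureTheory Filter Topology
open scoped BoundedContinuousFunction ContDiff

namespace Landau

noncomputable section

/-- `ℂⁿ = ℝ²ⁿ` with its Euclidean norm; `volume` on it is Lebesgue measure on `ℝ²ⁿ`. -/
abbrev Cn (n : ℕ) : Type := EuclideanSpace ℂ (Fin n)

/-- The Hilbert space `L²(ℂⁿ)`. -/
abbrev L2 (n : ℕ) : Type := Lp ℂ 2 (volume : Measure (Cn n))

/-! ### The Landau Hamiltonian -/

/-- The linear vector potential in the symmetric gauge, `A = ½ ∑ⱼ (xⱼ dyⱼ - yⱼ dxⱼ)`, evaluated at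
the point `z` on the real tangent vector `v`.  One has
`dA = ∑ⱼ dxⱼ ∧ dyⱼ = (i/2) ∑ⱼ dzⱼ ∧ dz̄ⱼ`. -/
def vectorPotential {n : ℕ} (z v : Cn n) : ℝ :=
  (1 / 2) * ∑ j, ((z j).re * (v j).im - (z j).im * (v j).re)

/-- The component of the magnetic momentum `-i∇ - A` in the real direction `v`. -/
def momentum {n : ℕ} (v : Cn n) (f : Cn n → ℂ) (z : Cn n) : ℂ :=
  -Complex.I * fderiv ℝ f z v - (vectorPotential z v : ℂ) * f z

/-- The Landau Hamiltonian `H_A = (-i∇ - A)²` as a differential expression: the sum of the squares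
of the momenta in the `2n` directions `∂/∂xⱼ`, `∂/∂yⱼ`. -/
def hamiltonian {n : ℕ} (f : Cn n → ℂ) (z : Cn n) : ℂ :=
  ∑ j, (momentum (EuclideanSpace.single j 1) (momentum (EuclideanSpace.single j 1) f) z
    + momentum (EuclideanSpace.single j Complex.I)
        (momentum (EuclideanSpace.single j Complex.I) f) z)

lemma contDiff_vectorPotential {n : ℕ} (v : Cn n) :
    ContDiff ℝ ∞ (fun z : Cn n => ((vectorPotential z v : ℝ) : ℂ)) := by
  unfold vectorPotential
  apply Complex.ofRealCLM.contDiff.comp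
  refine contDiff_const.mul (ContDiff.sum fun j _ => ?_)
  have hj : ContDiff ℝ ∞ (fun z : Cn n => z j) := by fun_prop
  exact ((Complex.reCLM.contDiff.comp hj).mul contDiff_const).sub
    ((Complex.imCLM.contDiff.comp hj).mul contDiff_const)

lemma contDiff_momentum {n : ℕ} (v : Cn n) {f : Cn n → ℂ} (hf : ContDiff ℝ ∞ f) :
    ContDiff ℝ ∞ (momentum v f) := by
  unfold momentum
  have h1 : ContDiff ℝ ∞ (fun z => fderiv ℝ f z v) :=
    (hf.fderiv_right (m := ∞) (by simp)).clm_apply contDiff_const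
  exact (contDiff_const.mul h1).sub ((contDiff_vectorPotential v).mul hf)

lemma momentum_add {n : ℕ} (v : Cn n) {f g : Cn n → ℂ} (hf : ContDiff ℝ ∞ f)
    (hg : ContDiff ℝ ∞ g) : momentum v (f + g) = momentum v f + momentum v g := by
  funext z
  have h1 := (hf.differentiable (by simp)) z
  have h2 := (hg.differentiable (by simp)) z
  simp only [momentum, Pi.add_apply, fderiv_add h1 h2, add_apply]
  ring

lemma momentum_smul {n : ℕ} (v : Cn n) (c : ℂ) {f : Cn n → ℂ} (hf : ContDiff ℝ ∞ f) :
    momentum v (c • f) = c • momentum v f := by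
  funext z
  have h1 := (hf.differentiable (by simp)) z
  simp only [momentum, Pi.smul_apply, fderiv_const_smul h1, smul_apply,
    smul_eq_mul]
  ring

lemma hamiltonian_add {n : ℕ} {f g : Cn n → ℂ} (hf : ContDiff ℝ ∞ f) (hg : ContDiff ℝ ∞ g) :
    hamiltonian (f + g) = hamiltonian f + hamiltonian g := by
  funext z
  simp only [hamiltonian, Pi.add_apply, ← Finset.sum_add_distrib]
  refine Finset.sum_congr rfl fun j _ => ?_
  rw [momentum_add _ hf hg, momentum_add _ hf hg,
    momentum_add _ (contDiff_momentum _ hf) (contDiff_momentum _ hg),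
    momentum_add _ (contDiff_momentum _ hf) (contDiff_momentum _ hg)]
  simp only [Pi.add_apply]
  ring

lemma hamiltonian_smul {n : ℕ} (c : ℂ) {f : Cn n → ℂ} (hf : ContDiff ℝ ∞ f) :
    hamiltonian (c • f) = c • hamiltonian f := by
  funext z
  simp only [hamiltonian, Pi.smul_apply, Finset.smul_sum]
  refine Finset.sum_congr rfl fun j _ => ?_
  rw [momentum_smul _ c hf, momentum_smul _ c hf, momentum_smul _ c (contDiff_momentum _ hf),
    momentum_smul _ c (contDiff_momentum _ hf)]
  simp only [Pi.smul_apply, smul_add]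

/-- The graph in `L²(ℂⁿ) × L²(ℂⁿ)` of the Landau Hamiltonian with domain `C_c^∞(ℂⁿ)`. -/
def hamiltonianGraph (n : ℕ) : Submodule ℂ (L2 n × L2 n) where
  carrier := {p | ∃ f : Cn n → ℂ, ContDiff ℝ ∞ f ∧ HasCompactSupport f ∧
    p.1 =ᵐ[volume] f ∧ p.2 =ᵐ[volume] hamiltonian f}
  zero_mem' := by
    refine ⟨0, contDiff_const, HasCompactSupport.zero, Lp.coeFn_zero _ _ _, ?_⟩
    have h : hamiltonian (0 : Cn n → ℂ) = 0 := by
      have := hamiltonian_smul (n := n) 0 (f := 0) contDiff_const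
      simpa using this
    rw [h]
    exact Lp.coeFn_zero _ _ _
  add_mem' := by
    rintro p q ⟨f, hf, hfc, hp1, hp2⟩ ⟨g, hg, hgc, hq1, hq2⟩
    refine ⟨f + g, hf.add hg, hfc.add hgc, ?_, ?_⟩
    · exact (Lp.coeFn_add _ _).trans (hp1.add hq1)
    · rw [hamiltonian_add hf hg]
      exact (Lp.coeFn_add _ _).trans (hp2.add hq2)
  smul_mem' := by
    rintro c p ⟨f, hf, hfc, hp1, hp2⟩
    refine ⟨c • f, hf.const_smul c, hfc.smul_left (f := fun _ => c), ?_, ?_⟩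
    · exact (Lp.coeFn_smul _ _).trans (hp1.const_smul c)
    · rw [hamiltonian_smul c hf]
      exact (Lp.coeFn_smul _ _).trans (hp2.const_smul c)

/-- The `ℓ`-th Landau level: the eigenspace, for the eigenvalue `2ℓ + n`, of the self-adjoint
operator `H_A`, that is, of the closure of the Landau Hamiltonian on `C_c^∞(ℂⁿ)`. -/
def level (n ℓ : ℕ) : Submodule ℂ (L2 n) :=
  (hamiltonianGraph n).topologicalClosure.comap
    ((LinearMap.id : L2 n →ₗ[ℂ] L2 n).prod ((2 * ℓ + n : ℂ) • LinearMap.id))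

lemma mem_level {n ℓ : ℕ} {f : L2 n} :
    f ∈ level n ℓ ↔ (f, (2 * ℓ + n : ℂ) • f) ∈ closure (hamiltonianGraph n : Set (L2 n × L2 n)) :=
  Iff.rfl

lemma isClosed_level (n ℓ : ℕ) : IsClosed (level n ℓ : Set (L2 n)) := by
  have h : Continuous fun f : L2 n => (f, (2 * ℓ + n : ℂ) • f) := by fun_prop
  exact isClosed_closure.preimage h

instance (n ℓ : ℕ) : CompleteSpace (level n ℓ) := (isClosed_level n ℓ).completeSpace_coe

/-! ### Toeplitz operators -/

lemma memLp_mul {n : ℕ} (a : Cn n →ᵇ ℂ) (f : L2 n) :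
    MemLp (fun z => a z * f z) 2 (volume : Measure (Cn n)) :=
  MemLp.of_le_mul (c := ‖a‖) (Lp.memLp f)
    (a.continuous.aestronglyMeasurable.mul (Lp.memLp f).1)
    (Eventually.of_forall fun z => by
      rw [norm_mul]
      exact mul_le_mul_of_nonneg_right (a.norm_coe_le_norm z) (norm_nonneg _))

/-- Multiplication by a bounded continuous function, as a bounded operator on `L²(ℂⁿ)`. -/
def mulOp {n : ℕ} (a : Cn n →ᵇ ℂ) : L2 n →L[ℂ] L2 n :=
  LinearMap.mkContinuous
    { toFun := fun f => (memLp_mul a f).toLp _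
      map_add' := fun f g => by
        rw [← MemLp.toLp_add (memLp_mul a f) (memLp_mul a g), MemLp.toLp_eq_toLp_iff]
        filter_upwards [Lp.coeFn_add f g] with z hz
        simp only [hz, Pi.add_apply, mul_add]
      map_smul' := fun c f => by
        rw [RingHom.id_apply, ← MemLp.toLp_const_smul, MemLp.toLp_eq_toLp_iff]
        filter_upwards [Lp.coeFn_smul c f] with z hz
        simp only [hz, Pi.smul_apply, smul_eq_mul]
        ring }
    ‖a‖ (fun f => by
      refine Lp.norm_le_mul_norm_of_ae_le_mul ?_
      filter_upwards [(memLp_mul a f).coeFn_toLp] with z hz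
      simp only [LinearMap.coe_mk, AddHom.coe_mk, hz, norm_mul]
      exact mul_le_mul_of_nonneg_right (a.norm_coe_le_norm z) (norm_nonneg _))

lemma coeFn_mulOp {n : ℕ} (a : Cn n →ᵇ ℂ) (f : L2 n) :
    mulOp a f =ᵐ[volume] fun z => a z * f z :=
  (memLp_mul a f).coeFn_toLp

/-- The Toeplitz operator `T_ℓ(a) = P_ℓ a|` on the `ℓ`-th Landau level. -/
def toeplitz {n : ℕ} (ℓ : ℕ) (a : Cn n →ᵇ ℂ) : level n ℓ →L[ℂ] level n ℓ :=
  (level n ℓ).orthogonalProjectionOnto ∘L mulOp a ∘L (level n ℓ).subtypeL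

/-- The Hilbert space `𝓛^ℓ ⊗ ℂᴺ`, as the Hilbert direct sum of `N` copies of the Landau level. -/
abbrev levelTensor (n ℓ N : ℕ) : Type := PiLp 2 fun _ : Fin N => level n ℓ

/-- The Toeplitz operator on `𝓛^ℓ ⊗ ℂᴺ` of a matrix symbol: the operator matrix `(T_ℓ(uᵢⱼ))`. -/
def matrixToeplitz {n N : ℕ} (ℓ : ℕ) (u : Matrix (Fin N) (Fin N) (Cn n →ᵇ ℂ)) :
    levelTensor n ℓ N →L[ℂ] levelTensor n ℓ N :=
  (PiLp.continuousLinearEquiv 2 ℂ (fun _ : Fin N => level n ℓ)).symm.toContinuousLinearMap ∘L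
    ContinuousLinearMap.pi fun i => ∑ j, toeplitz ℓ (u i j) ∘L PiLp.proj 2 _ j

lemma matrixToeplitz_apply {n N : ℕ} (ℓ : ℕ) (u : Matrix (Fin N) (Fin N) (Cn n →ᵇ ℂ))
    (f : levelTensor n ℓ N) (i : Fin N) :
    matrixToeplitz ℓ u f i = ∑ j, toeplitz ℓ (u i j) (f j) := by
  simp [matrixToeplitz]

/-! ### The symbol algebra and the boundary value map -/

/-- The unit sphere `S²ⁿ⁻¹ ⊆ ℂⁿ`. -/
abbrev Sphere (n : ℕ) : Type := Metric.sphere (0 : Cn n) 1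

/-- `g` is the boundary value of `a`: `a(rv) → g(v)` uniformly in `v ∈ S²ⁿ⁻¹` as `r → ∞`. -/
def HasBoundaryValue {n : ℕ} (a : Cn n →ᵇ ℂ) (g : C(Sphere n, ℂ)) : Prop :=
  TendstoUniformly (fun (r : ℝ) (v : Sphere n) => a (r • (v : Cn n))) g atTop

lemma hasBoundaryValue_iff {n : ℕ} {a : Cn n →ᵇ ℂ} {g : C(Sphere n, ℂ)} :
    HasBoundaryValue a g ↔ Tendsto (fun r : ℝ =>
      (⟨fun v : Sphere n => a (r • (v : Cn n)), by fun_prop⟩ : C(Sphere n, ℂ))) atTop (𝓝 g) := by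
  rw [ContinuousMap.tendsto_iff_tendstoUniformly]
  rfl

lemma HasBoundaryValue.unique {n : ℕ} {a : Cn n →ᵇ ℂ} {g h : C(Sphere n, ℂ)}
    (hg : HasBoundaryValue a g) (hh : HasBoundaryValue a h) : g = h :=
  tendsto_nhds_unique (hasBoundaryValue_iff.1 hg) (hasBoundaryValue_iff.1 hh)

lemma HasBoundaryValue.add {n : ℕ} {a b : Cn n →ᵇ ℂ} {g h : C(Sphere n, ℂ)}
    (hg : HasBoundaryValue a g) (hh : HasBoundaryValue b h) : HasBoundaryValue (a + b) (g + h) :=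
  hasBoundaryValue_iff.2 ((hasBoundaryValue_iff.1 hg).add (hasBoundaryValue_iff.1 hh))

lemma HasBoundaryValue.mul {n : ℕ} {a b : Cn n →ᵇ ℂ} {g h : C(Sphere n, ℂ)}
    (hg : HasBoundaryValue a g) (hh : HasBoundaryValue b h) : HasBoundaryValue (a * b) (g * h) :=
  hasBoundaryValue_iff.2 ((hasBoundaryValue_iff.1 hg).mul (hasBoundaryValue_iff.1 hh))

lemma HasBoundaryValue.star {n : ℕ} {a : Cn n →ᵇ ℂ} {g : C(Sphere n, ℂ)}
    (hg : HasBoundaryValue a g) : HasBoundaryValue (star a) (star g) :=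
  hasBoundaryValue_iff.2 ((hasBoundaryValue_iff.1 hg).star)

lemma hasBoundaryValue_algebraMap {n : ℕ} (c : ℂ) :
    HasBoundaryValue (algebraMap ℂ (Cn n →ᵇ ℂ) c) (algebraMap ℂ C(Sphere n, ℂ) c) :=
  hasBoundaryValue_iff.2 tendsto_const_nhds

/-- The C⋆-algebra `A ⊆ C_b(ℂⁿ)` of functions with a (uniform, continuous) boundary value. -/
def symbolAlgebra (n : ℕ) : StarSubalgebra ℂ (Cn n →ᵇ ℂ) where
  carrier := {a | ∃ g, HasBoundaryValue a g}
  mul_mem' := by rintro a b ⟨g, hg⟩ ⟨h, hh⟩; exact ⟨_, hg.mul hh⟩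
  add_mem' := by rintro a b ⟨g, hg⟩ ⟨h, hh⟩; exact ⟨_, hg.add hh⟩
  algebraMap_mem' c := ⟨_, hasBoundaryValue_algebraMap c⟩
  star_mem' := by rintro a ⟨g, hg⟩; exact ⟨_, hg.star⟩

lemma hasBoundaryValue_choose {n : ℕ} (a : symbolAlgebra n) :
    HasBoundaryValue (a : Cn n →ᵇ ℂ) (Classical.choose a.2) :=
  Classical.choose_spec a.2

/-- The boundary value map `π_∂ : A → C(S²ⁿ⁻¹)`, `π_∂(a)(v) = lim_{r → ∞} a(rv)`. -/
def boundaryMap (n : ℕ) : symbolAlgebra n →⋆ₐ[ℂ] C(Sphere n, ℂ) where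
  toFun a := Classical.choose a.2
  map_one' := (hasBoundaryValue_choose 1).unique
    (by simpa using hasBoundaryValue_algebraMap (n := n) 1)
  map_mul' a b := (hasBoundaryValue_choose (a * b)).unique
    ((hasBoundaryValue_choose a).mul (hasBoundaryValue_choose b))
  map_zero' := (hasBoundaryValue_choose 0).unique
    (by simpa using hasBoundaryValue_algebraMap (n := n) 0)
  map_add' a b := (hasBoundaryValue_choose (a + b)).unique
    ((hasBoundaryValue_choose a).add (hasBoundaryValue_choose b))
  commutes' c := (hasBoundaryValue_choose (algebraMap ℂ _ c)).unique
    (hasBoundaryValue_algebraMap c)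
  map_star' a := (hasBoundaryValue_choose (star a)).unique (hasBoundaryValue_choose a).star

lemma hasBoundaryValue_boundaryMap {n : ℕ} (a : symbolAlgebra n) :
    HasBoundaryValue (a : Cn n →ᵇ ℂ) (boundaryMap n a) :=
  hasBoundaryValue_choose a

end

end Landau

open MeasureTheory Filter Topology
open scoped BoundedContinuousFunction ContDiff ENNReal

namespace Landau

noncomputable section

/-! ### Weakly null sequences and compact operators -/

section WeakConvergence

variable {H K : Type*} [NormedAddCommGroup H] [InnerProductSpace ℂ H]
  [NormedAddCommGroup K] [InnerProductSpace ℂ K]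

/-! Everything rests on an integrable reproducing kernel for each level. The Gaussians `genFun n s`,
|s| < 1, satisfy H G = 2s ∂ₛG + nG, so their Taylor coefficients `radial n k` at s = 0 are
eigenfunctions of the closure of H with eigenvalue 2k + n. As s → 1 along the reals, G_s/(2π)ⁿ is an
approximate identity up to a factor tending to 1. Magnetic translations commute with H, and
different levels are orthogonal because H is symmetric. Hence pairing the translate of G_s to w with
f in level ℓ leaves only the term s^ℓ⟨τ_w `radial n ℓ`, f⟩, and s → 1 shows that `kernel n ℓ`
reproduces f (`ae_eq_inner_kernel`). No completeness of the levels, self-adjointness of H or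
explicit Laguerre polynomials are needed.

The projection P onto a level is therefore an integral operator dominated by convolution with an L¹
function (`starProjection_ae_eq`, `eLpNorm_le_of_convolution_bound`). A symbol vanishing at infinity
then acts compactly on the level, and (1 - P)bP is compact when b oscillates little over bounded
distances near infinity (`WeaklyNull.tendsto_mulOp`, `WeaklyNull.tendsto_hankel`). Symbols with a
boundary value have this property, so T(a)T(b) - T(ab) is compact for them. If the boundary matrix
is invertible, lifting the entries of its inverse to symbols gives a parametrix, and Atkinson's
theorem applies.

For the converses, the translates of `kernel n ℓ` along a ray in direction v have constant positive
norm, tend weakly to 0, and are approximate eigenvectors of T(a) with eigenvalue π_∂(a)(v)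
(`exists_coherent_sequence`). A null vector of π_∂(u)(v) thus yields a singular sequence that a
Fredholm operator cannot have, and compactness of T(a) forces π_∂(a) = 0. -/

/-- A bounded sequence in an inner product space that converges weakly to `0`. -/
def WeaklyNull (x : ℕ → H) : Prop :=
  (∃ C, ∀ j, ‖x j‖ ≤ C) ∧ ∀ y, Tendsto (fun j => inner ℂ y (x j)) atTop (𝓝 0)

lemma WeaklyNull.map [CompleteSpace H] [CompleteSpace K] {x : ℕ → H} (hx : WeaklyNull x)
    (T : H →L[ℂ] K) : WeaklyNull fun j => T (x j) := by
  obtain ⟨⟨C, hC⟩, h⟩ := hx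
  refine ⟨⟨‖T‖ * C, fun j => T.le_opNorm_of_le (hC j)⟩, fun y => ?_⟩
  simpa only [ContinuousLinearMap.adjoint_inner_left] using h (ContinuousLinearMap.adjoint T y)

/-- Along any subsequence the images have a norm-convergent further subsequence; its limit y is also
a weak limit, so ⟨y, y⟩ = 0. -/
lemma WeaklyNull.tendsto_of_isCompactOperator [CompleteSpace H] [CompleteSpace K] {x : ℕ → H}
    (hx : WeaklyNull x) {T : H →L[ℂ] K} (hT : IsCompactOperator T) :
    Tendsto (fun j => T (x j)) atTop (𝓝 0) := by
  obtain ⟨⟨C, hC⟩, -⟩ := id hx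
  obtain ⟨S, hS, hTS⟩ := hT.image_closedBall_subset_compact C
  refine tendsto_of_subseq_tendsto fun ns hns => ?_
  obtain ⟨y, -, φ, hφ, hy⟩ := hS.isSeqCompact (x := fun j => T (x (ns j)))
    fun j => hTS ⟨x (ns j), by simpa using hC _, rfl⟩
  refine ⟨φ, ?_⟩
  have h0 : Tendsto (fun j => inner ℂ y (T (x (ns (φ j))))) atTop (𝓝 0) :=
    ((hx.map T).2 y).comp (hns.comp hφ.tendsto_atTop)
  have h1 : Tendsto (fun j => inner ℂ y (T (x (ns (φ j))))) atTop (𝓝 (inner ℂ y y)) :=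
    tendsto_const_nhds.inner hy
  have h2 : y = 0 := inner_self_eq_zero.1 (tendsto_nhds_unique h1 h0)
  rwa [h2] at hy

/-- Sequential weak compactness of balls in a separable Hilbert space. -/
lemma exists_subseq_weaklyNull_sub [CompleteSpace H] [TopologicalSpace.SeparableSpace H]
    {x : ℕ → H} {C : ℝ} (hx : ∀ j, ‖x j‖ ≤ C) :
    ∃ (y : H) (φ : ℕ → ℕ), StrictMono φ ∧ WeaklyNull fun j => x (φ j) - y := by
  obtain ⟨f, -, φ, hφ, hf⟩ := WeakDual.isSeqCompact_closedBall ℂ H 0 C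
    (x := fun j => StrongDual.toWeakDual (InnerProductSpace.toDual ℂ H (x j)))
    (fun j => by
      change InnerProductSpace.toDual ℂ H (x j) ∈ Metric.closedBall 0 C
      simpa using hx j)
  refine ⟨(InnerProductSpace.toDual ℂ H).symm (WeakDual.toStrongDual f), φ, hφ,
    ⟨C + ‖(InnerProductSpace.toDual ℂ H).symm (WeakDual.toStrongDual f)‖,
      fun j => (norm_sub_le _ _).trans (by gcongr; exact hx _)⟩, fun z => ?_⟩
  have h1 : Tendsto (fun j => inner ℂ (x (φ j)) z) atTop (𝓝 (f z)) := by
    have := ((WeakDual.eval_continuous (𝕜 := ℂ) (E := H) z).tendsto f).comp hf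
    simpa [Function.comp_def] using this
  -- The Riesz map puts the sequence in the first slot of the inner product, while `WeaklyNull`
  -- tests it in the second; conjugation exchanges them.
  have h2 := (Complex.continuous_conj.tendsto _).comp (h1.sub_const (f z))
  rw [sub_self, map_zero] at h2
  refine h2.congr fun j => ?_
  have h3 : f z = inner ℂ ((InnerProductSpace.toDual ℂ H).symm (WeakDual.toStrongDual f)) z := by
    rw [InnerProductSpace.toDual_symm_apply]; rfl
  rw [Function.comp_apply, h3, ← inner_sub_left, inner_conj_symm]

/-- A bounded sequence is, along a subsequence, a fixed vector plus a weakly null sequence, so only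
weakly null sequences matter. All later compactness claims pass through this criterion. -/
lemma isCompactOperator_of_weaklyNull [CompleteSpace H] [TopologicalSpace.SeparableSpace H]
    {T : H →L[ℂ] K} (hT : ∀ x, WeaklyNull x → Tendsto (fun j => T (x j)) atTop (𝓝 0)) :
    IsCompactOperator T := by
  change IsCompactOperator (T : H →ₗ[ℂ] K)
  rw [isCompactOperator_iff_isCompact_closure_image_closedBall (𝕜₁ := ℂ) (T : H →ₗ[ℂ] K)
    one_pos]
  refine IsSeqCompact.isCompact ?_
  intro u hu
  have hε : ∀ j : ℕ, ∃ x : H, ‖x‖ ≤ 1 ∧ dist (u j) (T x) < 1 / ((j : ℝ) + 1) := fun j => by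
    obtain ⟨_, ⟨x, hx, rfl⟩, h⟩ := Metric.mem_closure_iff.1 (hu j) (1 / ((j : ℝ) + 1))
      (by positivity)
    exact ⟨x, by simpa using hx, h⟩
  choose x hx hux using hε
  obtain ⟨y, φ, hφ, hy⟩ := exists_subseq_weaklyNull_sub hx
  have h1 : Tendsto (fun j => T (x (φ j))) atTop (𝓝 (T y)) := by
    have := (hT _ hy).add_const (T y)
    simpa using this
  have h2 : Tendsto (fun j => u (φ j)) atTop (𝓝 (T y)) := by
    refine (tendsto_iff_of_dist ?_).2 h1
    refine squeeze_zero (fun _ => dist_nonneg) (fun j => (hux (φ j)).le) ?_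
    exact (tendsto_one_div_add_atTop_nhds_zero_nat (𝕜 := ℝ)).comp hφ.tendsto_atTop
  exact ⟨T y, isClosed_closure.mem_of_tendsto h2 (Eventually.of_forall fun j => hu _), φ, hφ, h2⟩

end WeakConvergence

/-! ### Fredholm operators and Atkinson's theorem -/

section Fredholm

open scoped LinearMap.FiniteRangeSetoid

variable {H : Type*} [NormedAddCommGroup H] [InnerProductSpace ℂ H] [CompleteSpace H]

omit [CompleteSpace H] in
/-- A compact operator on a Hilbert space is the sum of a strict contraction and an operator of
finite rank. -/
lemma exists_finiteRange_norm_sub_lt {T : H →L[ℂ] H} (hT : IsCompactOperator T) :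
    ∃ F : H →L[ℂ] H, (F : H →ₗ[ℂ] H).HasFiniteRange ∧ ‖T - F‖ < 1 := by
  obtain ⟨S, hS, hTS⟩ := hT.image_closedBall_subset_compact 1
  obtain ⟨t, htf, ht⟩ := Metric.totallyBounded_iff.1 hS.totallyBounded (1 / 2) (by norm_num)
  -- Projecting onto the span of a finite 1/2-net of a compact set containing the image of the unit
  -- ball moves each image point by at most 1/2, since the orthogonal projection minimises distance.
  let V : Submodule ℂ H := Submodule.span ℂ t
  have hV : V.FG := Submodule.fg_span htf
  have : FiniteDimensional ℂ V := Module.Finite.of_fg hV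
  let P : H →L[ℂ] H := V.starProjection
  refine ⟨P ∘L T, ?_, ?_⟩
  · rw [LinearMap.hasFiniteRange_iff_range]
    have hle : ((P ∘L T : H →L[ℂ] H) : H →ₗ[ℂ] H).range ≤ V := by
      rintro _ ⟨x, rfl⟩
      exact V.starProjection_apply_mem _
    have := Submodule.finiteDimensional_of_le hle
    exact Submodule.fg_iff_finiteDimensional _ |>.2 this
  · refine lt_of_le_of_lt (ContinuousLinearMap.opNorm_le_of_unit_norm (C := 1 / 2)
      (by norm_num) fun x hx => ?_) (by norm_num)
    obtain ⟨y, hy, hxy⟩ := Set.mem_iUnion₂.1 (ht (hTS ⟨x, by simp [hx], rfl⟩))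
    have h := V.starProjection_minimal (T x)
    change ‖T x - V.starProjection (T x)‖ ≤ _
    rw [h]
    refine (ciInf_le ⟨0, ?_⟩ (⟨y, Submodule.subset_span hy⟩ : V)).trans ?_
    · rintro _ ⟨z, rfl⟩; exact norm_nonneg _
    · exact (dist_eq_norm (T x) y ▸ (Metric.mem_ball.1 hxy)).le

/-- Write ST - 1 = F + E with F of finite rank and ‖E‖ < 1. Then R = ST - F = 1 + E is invertible,
and R⁻¹ST = 1 + R⁻¹F. -/
lemma exists_isLeftQuasiInverse {T S : H →L[ℂ] H}
    (h : IsCompactOperator (S ∘L T - 1 : H →L[ℂ] H)) :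
    ∃ S' : H →L[ℂ] H, (S' : H →ₗ[ℂ] H).IsLeftQuasiInverse (T : H →ₗ[ℂ] H) := by
  obtain ⟨F, hF, hn⟩ := exists_finiteRange_norm_sub_lt h
  have hu : IsUnit (S ∘L T - F) := by
    have : S ∘L T - F = 1 - -(S ∘L T - 1 - F) := by abel
    rw [this]
    exact isUnit_one_sub_of_norm_lt_one (by rwa [norm_neg])
  obtain ⟨R, hR⟩ := hu
  refine ⟨(↑R⁻¹ : H →L[ℂ] H) ∘L S, ?_⟩
  rw [LinearMap.IsLeftQuasiInverse, LinearMap.FiniteRangeSetoid.equiv_iff_hasFiniteRange]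
  suffices h0 : (((↑R⁻¹ : H →L[ℂ] H) ∘L S : H →L[ℂ] H) : H →ₗ[ℂ] H) ∘ₗ (T : H →ₗ[ℂ] H) - .id
      = ((↑R⁻¹ : H →L[ℂ] H) : H →ₗ[ℂ] H) ∘ₗ (F : H →ₗ[ℂ] H) by
    rw [h0]
    exact hF.comp_left _
  refine LinearMap.ext fun x => ?_
  have h1 : (↑R⁻¹ : H →L[ℂ] H) ((R : H →L[ℂ] H) x) = x := by
    rw [← mul_apply_eq_comp, Units.inv_mul]; rfl
  rw [hR] at h1
  simp only [sub_apply, map_sub, ContinuousLinearMap.comp_apply] at h1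
  simpa [sub_eq_iff_eq_add] using (sub_eq_iff_eq_add'.1 h1)

lemma exists_isRightQuasiInverse {T S : H →L[ℂ] H}
    (h : IsCompactOperator (T ∘L S - 1 : H →L[ℂ] H)) :
    ∃ S' : H →L[ℂ] H, (S' : H →ₗ[ℂ] H).IsRightQuasiInverse (T : H →ₗ[ℂ] H) := by
  obtain ⟨F, hF, hn⟩ := exists_finiteRange_norm_sub_lt h
  have hu : IsUnit (T ∘L S - F) := by
    have : T ∘L S - F = 1 - -(T ∘L S - 1 - F) := by abel
    rw [this]
    exact isUnit_one_sub_of_norm_lt_one (by rwa [norm_neg])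
  obtain ⟨R, hR⟩ := hu
  refine ⟨S ∘L (↑R⁻¹ : H →L[ℂ] H), ?_⟩
  rw [LinearMap.IsRightQuasiInverse, LinearMap.FiniteRangeSetoid.equiv_iff_hasFiniteRange]
  suffices h0 : (T : H →ₗ[ℂ] H) ∘ₗ ((S ∘L (↑R⁻¹ : H →L[ℂ] H) : H →L[ℂ] H) : H →ₗ[ℂ] H) - .id
      = (F : H →ₗ[ℂ] H) ∘ₗ ((↑R⁻¹ : H →L[ℂ] H) : H →ₗ[ℂ] H) by
    rw [h0]
    exact (hF.hasNoetherianRange.comp_right _).hasFiniteRange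
  refine LinearMap.ext fun x => ?_
  have h1 : (R : H →L[ℂ] H) ((↑R⁻¹ : H →L[ℂ] H) x) = x := by
    rw [← mul_apply_eq_comp, Units.mul_inv]; rfl
  rw [hR] at h1
  simp only [sub_apply, ContinuousLinearMap.comp_apply] at h1
  simpa [sub_eq_iff_eq_add] using (sub_eq_iff_eq_add'.1 h1)

/-- Atkinson: an operator that is invertible modulo compact operators is Fredholm. -/
theorem isFredholm_of_isCompactOperator {T S : H →L[ℂ] H}
    (h₁ : IsCompactOperator (S ∘L T - 1 : H →L[ℂ] H))
    (h₂ : IsCompactOperator (T ∘L S - 1 : H →L[ℂ] H)) : T.IsFredholm := by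
  obtain ⟨A, hA⟩ := exists_isLeftQuasiInverse h₁
  obtain ⟨B, hB⟩ := exists_isRightQuasiInverse h₂
  refine ContinuousLinearMap.IsFredholm.of_isQuasiInverse (v := A) ⟨hA, ?_⟩
  -- As in a monoid, left and right inverses agree, here modulo finite rank: A ≈ A(TB) = (AT)B ≈ B.
  have hAB : (A : H →ₗ[ℂ] H) ≈ B := by
    calc (A : H →ₗ[ℂ] H) = (A : H →ₗ[ℂ] H) ∘ₗ .id := by simp
      _ ≈ (A : H →ₗ[ℂ] H) ∘ₗ ((T : H →ₗ[ℂ] H) ∘ₗ (B : H →ₗ[ℂ] H)) := by grw [hB.equiv]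
      _ = ((A : H →ₗ[ℂ] H) ∘ₗ (T : H →ₗ[ℂ] H)) ∘ₗ (B : H →ₗ[ℂ] H) := by
        rw [LinearMap.comp_assoc]
      _ ≈ .id ∘ₗ (B : H →ₗ[ℂ] H) := by grw [hA.equiv]
      _ = B := by simp
  exact hB.congr hAB (Setoid.refl _)

/-- A parametrix S gives x = STx - Fx with F of finite rank; STx tends to 0 by continuity and Fx
because F is compact. This is the obstruction used against Fredholmness. -/
lemma WeaklyNull.tendsto_of_isFredholm {T : H →L[ℂ] H} (hT : T.IsFredholm) {x : ℕ → H}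
    (hx : WeaklyNull x) (h : Tendsto (fun j => T (x j)) atTop (𝓝 0)) :
    Tendsto x atTop (𝓝 0) := by
  obtain ⟨S, hS, -⟩ := hT.exists_isQuasiInverse
  rw [LinearMap.IsLeftQuasiInverse, LinearMap.FiniteRangeSetoid.equiv_iff_hasFiniteRange,
    LinearMap.hasFiniteRange_iff_range] at hS
  let F : H →L[ℂ] H := S ∘L T - ContinuousLinearMap.id ℂ H
  have hFfin : FiniteDimensional ℂ (F : H →ₗ[ℂ] H).range := Module.Finite.of_fg hS
  let F' : H →L[ℂ] (F : H →ₗ[ℂ] H).range :=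
    F.codRestrict _ fun x => ⟨x, rfl⟩
  have hF : IsCompactOperator F := by
    have h1 : IsCompactOperator F' := isCompactOperator_of_locallyCompactSpace_dom F'
    have := h1.clm_comp (F : H →ₗ[ℂ] H).range.subtypeL
    exact this
  have h1 := hx.tendsto_of_isCompactOperator hF
  have h2 := ((S.continuous.tendsto 0).comp h).sub h1
  simpa [F, Function.comp_def] using h2

end Fredholm

/-! ### Magnetic translations commute with the Landau Hamiltonian -/

section MagneticTranslation

variable {n : ℕ}

lemma continuous_vectorPotential : Continuous fun p : Cn n × Cn n => vectorPotential p.1 p.2 := by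
  unfold vectorPotential
  fun_prop

lemma vectorPotential_self (z : Cn n) : vectorPotential z z = 0 := by
  simp [vectorPotential, mul_comm]

lemma vectorPotential_sub_left (z w v : Cn n) :
    vectorPotential (z - w) v = vectorPotential z v - vectorPotential w v := by
  simp only [vectorPotential, ← mul_sub, ← Finset.sum_sub_distrib]
  congr 1
  refine Finset.sum_congr rfl fun j _ => ?_
  simp only [PiLp.sub_apply, Complex.sub_re, Complex.sub_im]
  ring

/-- `vectorPotential w` as a real linear functional. -/
def vectorPotentialCLM (w : Cn n) : Cn n →L[ℝ] ℝ :=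
  LinearMap.toContinuousLinearMap
    { toFun := vectorPotential w
      map_add' := fun x y => by
        simp only [vectorPotential, ← mul_add, ← Finset.sum_add_distrib]
        congr 1
        refine Finset.sum_congr rfl fun j _ => ?_
        simp only [PiLp.add_apply, Complex.add_re, Complex.add_im]
        ring
      map_smul' := fun c x => by
        simp only [vectorPotential, RingHom.id_apply, smul_eq_mul, Finset.mul_sum]
        refine Finset.sum_congr rfl fun j _ => ?_
        simp only [PiLp.smul_apply, Complex.real_smul, Complex.re_ofReal_mul,
          Complex.im_ofReal_mul]
        ring }

@[simp] lemma vectorPotentialCLM_apply (w v : Cn n) :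
    vectorPotentialCLM w v = vectorPotential w v := rfl

/-- The phase `z ↦ exp (i A_w(z))` of the magnetic translation by `w`. -/
def phase (w z : Cn n) : ℂ := Complex.exp (vectorPotential w z * Complex.I)

lemma norm_phase (w z : Cn n) : ‖phase w z‖ = 1 := Complex.norm_exp_ofReal_mul_I _

@[simp] lemma phase_self (w : Cn n) : phase w w = 1 := by simp [phase, vectorPotential_self]

lemma continuous_phase : Continuous fun p : Cn n × Cn n => phase p.1 p.2 := by
  unfold phase
  have := continuous_vectorPotential (n := n)
  fun_prop

lemma contDiff_phase (w : Cn n) : ContDiff ℝ ∞ (phase w) := by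
  unfold phase
  exact ((Complex.ofRealCLM.contDiff.comp (vectorPotentialCLM w).contDiff).mul contDiff_const).cexp

lemma continuous_phase_right (w : Cn n) : Continuous (phase w) := (contDiff_phase w).continuous

lemma hasFDerivAt_phase (w z : Cn n) : HasFDerivAt (phase w)
    (phase w z • (Complex.ofRealCLM.comp (vectorPotentialCLM w)).smulRight Complex.I) z := by
  have h : HasFDerivAt (fun z : Cn n => (vectorPotential w z : ℂ) * Complex.I)
      ((Complex.ofRealCLM.comp (vectorPotentialCLM w)).smulRight Complex.I) z :=
    ((Complex.ofRealCLM.comp (vectorPotentialCLM w)).smulRight Complex.I).hasFDerivAt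
  exact h.cexp

/-- Differentiating the phase produces A_w(v), which turns A_z(v) into A_{z-w}(v) because the
potential is linear in its base point. -/
lemma momentum_magneticTranslate {f : Cn n → ℂ} (hf : ContDiff ℝ ∞ f) (w v : Cn n) :
    momentum v (fun z => phase w z * f (z - w)) = fun z => phase w z * momentum v f (z - w) := by
  funext z
  have h1 : HasFDerivAt (fun z => f (z - w)) (fderiv ℝ f (z - w)) z := by
    have := ((hf.differentiable (by simp)) (z - w)).hasFDerivAt.comp z
      ((hasFDerivAt_id z).sub_const w)
    rwa [ContinuousLinearMap.comp_id] at this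
  have h2 : fderiv ℝ (fun z => phase w z * f (z - w)) z = _ :=
    ((hasFDerivAt_phase w z).mul h1).fderiv
  rw [momentum, h2, momentum, vectorPotential_sub_left]
  simp
  ring_nf
  simp

lemma contDiff_magneticTranslate {f : Cn n → ℂ} (hf : ContDiff ℝ ∞ f) (w : Cn n) :
    ContDiff ℝ ∞ (fun z => phase w z * f (z - w)) :=
  (contDiff_phase w).mul (hf.comp (contDiff_id.sub contDiff_const))

lemma hamiltonian_magneticTranslate {f : Cn n → ℂ} (hf : ContDiff ℝ ∞ f) (w : Cn n) :
    hamiltonian (fun z => phase w z * f (z - w)) = fun z => phase w z * hamiltonian f (z - w) := by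
  funext z
  simp only [hamiltonian, momentum_magneticTranslate hf,
    momentum_magneticTranslate (contDiff_momentum _ hf), Finset.mul_sum, mul_add]

/-- The phase of a magnetic translation as a bounded continuous function. -/
def phaseBCF (w : Cn n) : Cn n →ᵇ ℂ :=
  BoundedContinuousFunction.ofNormedAddCommGroup (phase w) (continuous_phase_right w) 1
    fun z => (norm_phase w z).le

/-- The magnetic translation `f ↦ exp (i A_w(z)) f (z - w)` on `L²(ℂⁿ)`. -/
def magneticTranslation (w : Cn n) : L2 n →L[ℂ] L2 n :=
  mulOp (phaseBCF w) ∘L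
    (Lp.compMeasurePreservingₗᵢ ℂ (fun z => z - w)
      (measurePreserving_sub_right (volume : Measure (Cn n)) w)).toContinuousLinearMap

lemma coeFn_magneticTranslation (w : Cn n) (f : L2 n) :
    magneticTranslation w f =ᵐ[volume] fun z => phase w z * f (z - w) := by
  refine (coeFn_mulOp _ _).trans ?_
  filter_upwards [Lp.coeFn_compMeasurePreserving f
    (measurePreserving_sub_right (volume : Measure (Cn n)) w)] with z hz
  change phase w z * (Lp.compMeasurePreserving (fun z => z - w) _ f) z = _
  rw [hz]; rfl

lemma ae_comp_sub {p : Cn n → Prop} (h : ∀ᵐ z ∂(volume : Measure (Cn n)), p z) (w : Cn n) :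
    ∀ᵐ z ∂(volume : Measure (Cn n)), p (z - w) :=
  (measurePreserving_sub_right (volume : Measure (Cn n)) w).quasiMeasurePreserving.ae h

lemma norm_magneticTranslation (w : Cn n) (f : L2 n) : ‖magneticTranslation w f‖ = ‖f‖ := by
  rw [← Lp.norm_compMeasurePreserving f (measurePreserving_sub_right (volume : Measure (Cn n)) w),
    Lp.norm_def, Lp.norm_def]
  congr 1
  refine eLpNorm_congr_norm_ae ?_
  filter_upwards [coeFn_magneticTranslation w f, Lp.coeFn_compMeasurePreserving f
    (measurePreserving_sub_right (volume : Measure (Cn n)) w)] with z h1 h2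
  rw [h1, h2, norm_mul, norm_phase, one_mul]; rfl

lemma magneticTranslation_mem_graph (w : Cn n) {p : L2 n × L2 n} (hp : p ∈ hamiltonianGraph n) :
    (magneticTranslation w p.1, magneticTranslation w p.2) ∈ hamiltonianGraph n := by
  obtain ⟨f, hf, hfc, h1, h2⟩ := hp
  refine ⟨fun z => phase w z * f (z - w), contDiff_magneticTranslate hf w, ?_, ?_, ?_⟩
  · have : HasCompactSupport fun z => f (z - w) :=
      hfc.comp_homeomorph (Homeomorph.subRight w)
    exact this.mul_left
  · filter_upwards [coeFn_magneticTranslation w p.1, ae_comp_sub h1 w] with z e1 e2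
    rw [e1, e2]
  · rw [hamiltonian_magneticTranslate hf]
    filter_upwards [coeFn_magneticTranslation w p.2, ae_comp_sub h2 w] with z e1 e2
    rw [e1, e2]

lemma magneticTranslation_mem_closure_graph (w : Cn n) {p : L2 n × L2 n}
    (hp : p ∈ closure (hamiltonianGraph n : Set (L2 n × L2 n))) :
    (magneticTranslation w p.1, magneticTranslation w p.2) ∈
      closure (hamiltonianGraph n : Set (L2 n × L2 n)) :=
  map_mem_closure
    (f := fun p : L2 n × L2 n => (magneticTranslation w p.1, magneticTranslation w p.2))
    (by fun_prop) hp fun _ hq => magneticTranslation_mem_graph w hq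

lemma magneticTranslation_mem_level (w : Cn n) {ℓ : ℕ} {f : L2 n} (hf : f ∈ level n ℓ) :
    magneticTranslation w f ∈ level n ℓ := by
  rw [mem_level] at hf ⊢
  simpa using magneticTranslation_mem_closure_graph w hf

end MagneticTranslation

/-! ### Symmetry of the Hamiltonian and orthogonality of the levels -/

section Symmetry

variable {n : ℕ}

lemma hasCompactSupport_momentum (v : Cn n) {f : Cn n → ℂ} (hf : HasCompactSupport f) :
    HasCompactSupport (momentum v f) := by
  unfold momentum
  have h1 : HasCompactSupport fun z => fderiv ℝ f z v :=
    (hf.fderiv (𝕜 := ℝ)).comp_left (g := fun L : Cn n →L[ℝ] ℂ => L v) (by simp)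
  exact h1.mul_left.sub hf.mul_left

/-- Integration by parts changes the sign of the derivative, conjugation changes the sign of i, and
the potential is real. -/
lemma integral_conj_mul_momentum (v : Cn n) {f g : Cn n → ℂ} (hf : ContDiff ℝ ∞ f)
    (hg : ContDiff ℝ ∞ g) (hfc : HasCompactSupport f) (hgc : HasCompactSupport g) :
    ∫ z, momentum v g z * (starRingEnd ℂ) (f z) = ∫ z, g z * (starRingEnd ℂ) (momentum v f z) := by
  let F : Cn n → ℂ := fun z => (starRingEnd ℂ) (f z)
  have hF : ContDiff ℝ ∞ F := Complex.conjCLE.contDiff.comp hf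
  have hFc : HasCompactSupport F := hfc.comp_left (map_zero _)
  have hF' : ∀ z, fderiv ℝ F z v = (starRingEnd ℂ) (fderiv ℝ f z v) := fun z => by
    have := (Complex.conjCLE.toContinuousLinearMap.hasFDerivAt.comp z
      ((hf.differentiable (by simp)) z).hasFDerivAt).fderiv
    change fderiv ℝ F z = _ at this
    rw [this]; rfl
  have hd : ∀ {k : Cn n → ℂ}, ContDiff ℝ ∞ k → Continuous fun z => fderiv ℝ k z v := fun hk =>
    (hk.continuous_fderiv (by simp)).clm_apply continuous_const
  have hdc : HasCompactSupport fun z => fderiv ℝ g z v :=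
    (hgc.fderiv (𝕜 := ℝ)).comp_left (g := fun L : Cn n →L[ℝ] ℂ => L v) (by simp)
  have i1 : Integrable (fun z => fderiv ℝ g z v * F z) :=
    ((hd hg).mul hF.continuous).integrable_of_hasCompactSupport hdc.mul_right
  have i2 : Integrable (fun z => g z * fderiv ℝ F z v) :=
    (hg.continuous.mul (hd hF)).integrable_of_hasCompactSupport hgc.mul_right
  have i3 : Integrable (fun z => g z * F z) :=
    (hg.continuous.mul hF.continuous).integrable_of_hasCompactSupport hgc.mul_right
  have i4 : Integrable (fun z => (vectorPotential z v : ℂ) * (g z * F z)) :=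
    ((contDiff_vectorPotential v).continuous.mul
      (hg.continuous.mul hF.continuous)).integrable_of_hasCompactSupport hgc.mul_right.mul_left
  have key := integral_mul_fderiv_eq_neg_fderiv_mul_of_integrable i1 i2 i3
    (fun z _ => (hg.differentiable (by simp)) z) (fun z _ => (hF.differentiable (by simp)) z)
  have e1 : ∀ z, momentum v g z * (starRingEnd ℂ) (f z)
      = -Complex.I * (fderiv ℝ g z v * F z) - (vectorPotential z v : ℂ) * (g z * F z) := fun z => by
    simp only [momentum, F]; ring
  have e2 : ∀ z, g z * (starRingEnd ℂ) (momentum v f z)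
      = Complex.I * (g z * fderiv ℝ F z v) - (vectorPotential z v : ℂ) * (g z * F z) := fun z => by
    simp only [momentum, F, hF', map_sub, map_mul, map_neg, Complex.conj_I, Complex.conj_ofReal]
    ring
  simp_rw [e1, e2]
  rw [integral_sub (i1.const_mul _) i4, integral_sub (i2.const_mul _) i4, integral_const_mul,
    integral_const_mul, key]
  ring

lemma integral_conj_mul_hamiltonian {f g : Cn n → ℂ} (hf : ContDiff ℝ ∞ f)
    (hg : ContDiff ℝ ∞ g) (hfc : HasCompactSupport f) (hgc : HasCompactSupport g) :
    ∫ z, hamiltonian g z * (starRingEnd ℂ) (f z) =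
      ∫ z, g z * (starRingEnd ℂ) (hamiltonian f z) := by
  have hm : ∀ (v : Cn n) {k : Cn n → ℂ}, ContDiff ℝ ∞ k → HasCompactSupport k →
      ∫ z, momentum v (momentum v g) z * (starRingEnd ℂ) (f z) =
        ∫ z, g z * (starRingEnd ℂ) (momentum v (momentum v f) z) := fun v _ _ _ => by
    rw [integral_conj_mul_momentum v hf (contDiff_momentum v hg) hfc
      (hasCompactSupport_momentum v hgc), integral_conj_mul_momentum v (contDiff_momentum v hf) hg
      (hasCompactSupport_momentum v hfc) hgc]
  have hi1 : ∀ v : Cn n, Integrable fun z =>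
      momentum v (momentum v g) z * (starRingEnd ℂ) (f z) := fun v =>
    ((contDiff_momentum v (contDiff_momentum v hg)).continuous.mul
      (Complex.continuous_conj.comp hf.continuous)).integrable_of_hasCompactSupport
      (hasCompactSupport_momentum v (hasCompactSupport_momentum v hgc)).mul_right
  have hi2 : ∀ v : Cn n, Integrable fun z =>
      g z * (starRingEnd ℂ) (momentum v (momentum v f) z) := fun v =>
    (hg.continuous.mul (Complex.continuous_conj.comp
      (contDiff_momentum v (contDiff_momentum v hf)).continuous)).integrable_of_hasCompactSupport
      hgc.mul_right
  simp only [hamiltonian, Finset.sum_mul, map_sum, Finset.mul_sum, add_mul, map_add, mul_add]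
  have hj1 : ∀ j : Fin n, Integrable fun z =>
      momentum (EuclideanSpace.single j 1) (momentum (EuclideanSpace.single j 1) g) z *
          (starRingEnd ℂ) (f z) +
        momentum (EuclideanSpace.single j Complex.I)
          (momentum (EuclideanSpace.single j Complex.I) g)
          z * (starRingEnd ℂ) (f z) := fun j => (hi1 _).add (hi1 _)
  have hj2 : ∀ j : Fin n, Integrable fun z => g z * (starRingEnd ℂ)
        (momentum (EuclideanSpace.single j 1) (momentum (EuclideanSpace.single j 1) f) z) +
      g z * (starRingEnd ℂ) (momentum (EuclideanSpace.single j Complex.I)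
        (momentum (EuclideanSpace.single j Complex.I) f) z) := fun j => (hi2 _).add (hi2 _)
  rw [integral_finsetSum _ fun j _ => hj1 j, integral_finsetSum _ fun j _ => hj2 j]
  refine Finset.sum_congr rfl fun j _ => ?_
  rw [integral_add (hi1 _) (hi1 _), integral_add (hi2 _) (hi2 _), hm _ hf hfc, hm _ hf hfc]

lemma inner_graph_comm {p q : L2 n × L2 n} (hp : p ∈ hamiltonianGraph n)
    (hq : q ∈ hamiltonianGraph n) : inner ℂ p.1 q.2 = inner ℂ p.2 q.1 := by
  obtain ⟨f, hf, hfc, hp1, hp2⟩ := hp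
  obtain ⟨g, hg, hgc, hq1, hq2⟩ := hq
  rw [L2.inner_def, L2.inner_def]
  convert integral_conj_mul_hamiltonian hf hg hfc hgc using 1
  · refine integral_congr_ae ?_
    filter_upwards [hp1, hq2] with z h1 h2
    rw [h1, h2]; rfl
  · refine integral_congr_ae ?_
    filter_upwards [hp2, hq1] with z h1 h2
    rw [h1, h2]; rfl

/-- The closure of the Landau Hamiltonian is symmetric. -/
lemma inner_closure_graph_comm {p q : L2 n × L2 n}
    (hp : p ∈ closure (hamiltonianGraph n : Set (L2 n × L2 n)))
    (hq : q ∈ closure (hamiltonianGraph n : Set (L2 n × L2 n))) :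
    inner ℂ p.1 q.2 = inner ℂ p.2 q.1 := by
  have hc : IsClosed {x : (L2 n × L2 n) × (L2 n × L2 n) |
      inner ℂ x.1.1 x.2.2 = inner ℂ x.1.2 x.2.1} :=
    isClosed_eq (by fun_prop) (by fun_prop)
  have h : (p, q) ∈ closure ((hamiltonianGraph n : Set (L2 n × L2 n)) ×ˢ
      (hamiltonianGraph n : Set (L2 n × L2 n))) := by
    rw [closure_prod_eq]; exact ⟨hp, hq⟩
  exact closure_minimal (fun x hx => inner_graph_comm hx.1 hx.2) hc h

/-- Different Landau levels are orthogonal. -/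
lemma inner_level_eq_zero {k ℓ : ℕ} (hkl : k ≠ ℓ) {f g : L2 n} (hf : f ∈ level n k)
    (hg : g ∈ level n ℓ) : inner ℂ f g = 0 := by
  have h := inner_closure_graph_comm (mem_level.1 hf) (mem_level.1 hg)
  have hk : (starRingEnd ℂ) (2 * k + n : ℂ) = 2 * k + n := by
    exact_mod_cast Complex.conj_natCast (2 * k + n)
  simp only [inner_smul_left, inner_smul_right, hk] at h
  have h2 : ((ℓ : ℂ) - k) * inner ℂ f g = 0 := by
    linear_combination h / 2
  rcases mul_eq_zero.1 h2 with h3 | h3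
  · exact absurd (by exact_mod_cast (sub_eq_zero.1 h3).symm) hkl
  · exact h3

end Symmetry

/-! ### Dominated convergence and Gaussian bounds in L² -/

section L2Tools

variable {n : ℕ}

lemma finrank_Cn (n : ℕ) : Module.finrank ℝ (Cn n) = 2 * n := by
  rw [← Module.finrank_mul_finrank ℝ ℂ (Cn n)]
  simp

lemma norm_sq_eq_integral (f : L2 n) : ‖f‖ ^ 2 = ∫ z, ‖f z‖ ^ 2 := by
  have h : ((‖f‖ ^ 2 : ℝ) : ℂ) = ((∫ z, ‖f z‖ ^ 2 : ℝ) : ℂ) := by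
    rw [← integral_complex_ofReal]
    have := inner_self_eq_norm_sq_to_K (𝕜 := ℂ) f
    rw [L2.inner_def] at this
    simp only [inner_self_eq_norm_sq_to_K] at this
    push_cast
    exact this.symm
  exact_mod_cast h

/-- Dominated convergence in `L²(ℂⁿ)`. -/
lemma tendsto_zero_of_dominated {u : ℕ → L2 n} {G : Cn n → ℝ} (hG : MemLp G 2 volume)
    (hb : ∀ j, ∀ᵐ z, ‖u j z‖ ≤ G z) (hl : ∀ᵐ z, Tendsto (fun j => u j z) atTop (𝓝 0)) :
    Tendsto u atTop (𝓝 0) := by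
  have h : Tendsto (fun j => ∫ z, ‖u j z‖ ^ 2) atTop (𝓝 (∫ _ : Cn n, (0 : ℝ))) := by
    refine tendsto_integral_of_dominated_convergence (fun z => G z ^ 2)
      (fun j => ((Lp.memLp (u j)).1.norm.pow 2)) hG.integrable_sq (fun j => ?_) ?_
    · filter_upwards [hb j] with z hz
      rw [norm_pow, norm_norm]
      gcongr
    · filter_upwards [hl] with z hz
      simpa using (hz.norm.pow 2)
  rw [integral_zero] at h
  simp_rw [← norm_sq_eq_integral] at h
  rw [tendsto_zero_iff_norm_tendsto_zero]
  have := h.sqrt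
  simpa [Real.sqrt_sq (norm_nonneg _)] using this

lemma integrable_exp_neg_mul_sq {c : ℝ} (hc : 0 < c) :
    Integrable (fun z : Cn n => Real.exp (-c * ‖z‖ ^ 2)) := by
  have h := (GaussianFourier.integrable_cexp_neg_mul_sq_norm_add (V := Cn n) (b := c)
    (by simpa using hc) 0 0).norm
  refine h.congr (Eventually.of_forall fun z => ?_)
  simp only [inner_zero_left, Complex.ofReal_zero, mul_zero, add_zero, Complex.norm_exp]
  norm_cast

lemma memLp_of_gaussian_bound {f : Cn n → ℂ} (hf : Continuous f) {C c : ℝ} (hc : 0 < c)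
    (h : ∀ z, ‖f z‖ ≤ C * Real.exp (-c * ‖z‖ ^ 2)) : MemLp f 2 volume := by
  rw [memLp_two_iff_integrable_sq_norm hf.aestronglyMeasurable]
  refine ((integrable_exp_neg_mul_sq (n := n) (c := 2 * c) (by positivity)).const_mul (C ^ 2)).mono'
    (hf.norm.pow 2).aestronglyMeasurable (Eventually.of_forall fun z => ?_)
  rw [norm_pow, norm_norm]
  calc ‖f z‖ ^ 2 ≤ (C * Real.exp (-c * ‖z‖ ^ 2)) ^ 2 := by gcongr; exact h z
    _ = C ^ 2 * Real.exp (-(2 * c) * ‖z‖ ^ 2) := by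
      rw [mul_pow, ← Real.exp_nat_mul]; congr 2; push_cast; ring

/-- Half of the exponent absorbs the power: (cx/2)ᵏ/k! is at most exp(cx/2). -/
lemma pow_mul_exp_le {c x : ℝ} (hc : 0 < c) (hx : 0 ≤ x) (k : ℕ) :
    x ^ k * Real.exp (-c * x) ≤ (k.factorial * (2 / c) ^ k) * Real.exp (-(c / 2) * x) := by
  have h := Real.pow_div_factorial_le_exp (c / 2 * x) (by positivity) k
  have h1 : x ^ k ≤ (k.factorial * (2 / c) ^ k) * Real.exp (c / 2 * x) := by
    rw [div_le_iff₀ (by positivity), mul_pow] at h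
    calc x ^ k = (2 / c) ^ k * ((c / 2) ^ k * x ^ k) := by
          rw [← mul_assoc, ← mul_pow, show 2 / c * (c / 2) = 1 by field_simp, one_pow, one_mul]
      _ ≤ (2 / c) ^ k * (Real.exp (c / 2 * x) * k.factorial) := by gcongr
      _ = _ := by ring
  calc x ^ k * Real.exp (-c * x)
      ≤ ((k.factorial * (2 / c) ^ k) * Real.exp (c / 2 * x)) * Real.exp (-c * x) := by gcongr
    _ = _ := by
      rw [mul_assoc, ← Real.exp_add]; congr 2; ring

end L2Tools

/-! ### Gaussians as a holomorphic family in L² -/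

section Gaussian

variable {n : ℕ}

/-- The function `|z|²ᵏ exp (-b|z|²)`. -/
def gauss (n k : ℕ) (b : ℂ) (z : Cn n) : ℂ := (‖z‖ ^ 2 : ℝ) ^ k * Complex.exp (-b * (‖z‖ ^ 2 : ℝ))

lemma norm_gauss (k : ℕ) (b : ℂ) (z : Cn n) :
    ‖gauss n k b z‖ = (‖z‖ ^ 2) ^ k * Real.exp (-b.re * ‖z‖ ^ 2) := by
  rw [gauss, norm_mul, norm_pow, Complex.norm_exp, Complex.norm_real, Real.norm_of_nonneg
    (by positivity), Complex.re_mul_ofReal, Complex.neg_re]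

lemma norm_gauss_le (k : ℕ) {b : ℂ} (hb : 0 < b.re) (z : Cn n) :
    ‖gauss n k b z‖ ≤ (k.factorial * (2 / b.re) ^ k) * Real.exp (-(b.re / 2) * ‖z‖ ^ 2) := by
  rw [norm_gauss]
  exact pow_mul_exp_le hb (by positivity) k

lemma contDiff_normSq_pow (k : ℕ) : ContDiff ℝ ∞ fun z : Cn n => ((‖z‖ ^ 2 : ℝ) : ℂ) ^ k :=
  (Complex.ofRealCLM.contDiff.comp (contDiff_norm_sq ℝ)).pow k

lemma contDiff_gauss (k : ℕ) (b : ℂ) : ContDiff ℝ ∞ (gauss n k b) := by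
  unfold gauss
  have h := Complex.ofRealCLM.contDiff.comp (contDiff_norm_sq ℝ (E := Cn n) (n := ∞))
  exact (contDiff_normSq_pow k).mul (contDiff_const.mul h).cexp

lemma memLp_gauss (k : ℕ) {b : ℂ} (hb : 0 < b.re) : MemLp (gauss n k b) 2 volume :=
  memLp_of_gaussian_bound (contDiff_gauss k b).continuous (half_pos hb) (norm_gauss_le k hb)

open Classical in
/-- The class of `|z|²ᵏ exp (-b|z|²)` in `L²(ℂⁿ)`, for `Re b > 0`. -/
def gaussLp (n k : ℕ) (b : ℂ) : L2 n :=
  -- The value 0 for Re b ≤ 0 is a mere default; the properties established below assume Re b > 0.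
  if h : 0 < b.re then (memLp_gauss k h).toLp _ else 0

lemma coeFn_gaussLp (k : ℕ) {b : ℂ} (hb : 0 < b.re) :
    gaussLp n k b =ᵐ[volume] gauss n k b := by
  rw [gaussLp, dif_pos hb]
  exact MemLp.coeFn_toLp _

/-- The pointwise Taylor remainder of exp(-b|z|²) in b is at most |δ|² |z|⁴ exp(-(Re b/2)|z|²) for a
small increment δ. The spatial factor lies in L², so the remainder is O(|δ|²) in norm. -/
lemma hasDerivAt_gaussLp {b : ℂ} (hb : 0 < b.re) :
    HasDerivAt (gaussLp n 0) (-gaussLp n 1 b) b := by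
  have hb2 : 0 < (b / 2 : ℂ).re := by simpa using hb
  rw [hasDerivAt_iff_isLittleO]
  -- The radius Re b/2 keeps Re b' positive and lets exp(|δ||z|²) cost only half of the Gaussian
  -- decay.
  have key : ∀ b' ∈ Metric.ball b (b.re / 2),
      ‖gaussLp n 0 b' - gaussLp n 0 b - (b' - b) • -gaussLp n 1 b‖ ≤
        ‖gaussLp n 2 (b / 2)‖ * ‖(b' - b) ^ 2‖ := by
    intro b' hb'
    rw [Metric.mem_ball, dist_eq_norm] at hb'
    have hb'pos : 0 < b'.re := by
      have := (Complex.abs_re_le_norm (b' - b)).trans hb'.le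
      rw [Complex.sub_re, abs_le] at this
      linarith
    rw [mul_comm]
    refine Lp.norm_le_mul_norm_of_ae_le_mul ?_
    filter_upwards [Lp.coeFn_sub (gaussLp n 0 b' - gaussLp n 0 b) ((b' - b) • -gaussLp n 1 b),
      Lp.coeFn_sub (gaussLp n 0 b') (gaussLp n 0 b), Lp.coeFn_smul (b' - b) (-gaussLp n 1 b),
      Lp.coeFn_neg (gaussLp n 1 b), coeFn_gaussLp (n := n) 0 hb, coeFn_gaussLp (n := n) 0 hb'pos,
      coeFn_gaussLp (n := n) 1 hb, coeFn_gaussLp (n := n) 2 hb2] with z h1 h2 h3 h4 h5 h6 h7 h8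
    rw [h1, Pi.sub_apply, h2, Pi.sub_apply, h3, Pi.smul_apply, h4, Pi.neg_apply, h5, h6, h7, h8,
      norm_gauss]
    set x : ℝ := ‖z‖ ^ 2 with hx
    have hx0 : 0 ≤ x := by positivity
    set δ := b' - b with hδ
    have e1 : gauss n 0 b' z - gauss n 0 b z - δ • -gauss n 1 b z
        = Complex.exp (-b * x) * (Complex.exp (-(δ * x)) - ∑ m ∈ Finset.range 2,
          (-(δ * x)) ^ m / m.factorial) := by
      have : -b' * (x : ℂ) = -b * x + -(δ * x) := by rw [hδ]; ring
      simp only [gauss, ← hx, this, Complex.exp_add, Finset.sum_range_succ, Finset.sum_range_zero,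
        smul_eq_mul]
      simp
      ring
    rw [e1, norm_mul, Complex.norm_exp]
    have e2 := Complex.norm_exp_sub_sum_le_norm_mul_exp (-(δ * x)) 2
    rw [norm_neg, norm_mul, Complex.norm_real, Real.norm_of_nonneg hx0] at e2
    calc Real.exp ((-b * x).re) * ‖Complex.exp (-(δ * x)) - ∑ m ∈ Finset.range 2,
          (-(δ * x)) ^ m / m.factorial‖
        ≤ Real.exp ((-b * x).re) * ((‖δ‖ * x) ^ 2 * Real.exp (‖δ‖ * x)) := by gcongr
      _ = ‖δ ^ 2‖ * (x ^ 2 * (Real.exp ((-b * x).re) * Real.exp (‖δ‖ * x))) := by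
        rw [norm_pow]; ring
      _ ≤ ‖δ ^ 2‖ * (x ^ 2 * Real.exp (-(b / 2).re * x)) := by
        rw [← Real.exp_add]
        gcongr
        simp only [Complex.mul_re, Complex.neg_re, Complex.ofReal_re, Complex.ofReal_im, mul_zero,
          sub_zero]
        have : (b / 2).re = b.re / 2 := by simp
        rw [this]
        nlinarith
  refine (Asymptotics.IsBigO.of_bound (g := fun b' => (b' - b) ^ 2) ‖gaussLp n 2 (b / 2)‖
    ?_).trans_isLittleO ?_
  · filter_upwards [Metric.ball_mem_nhds b (half_pos hb)] with b' hb' using key b' hb'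
  · have : Tendsto (fun b' : ℂ => b' - b) (𝓝 b) (𝓝 0) := by
      have := (continuous_sub_right b).tendsto b
      simpa using this
    have h := (Asymptotics.isLittleO_pow_id (𝕜 := ℂ) (n := 2) (by norm_num)).comp_tendsto this
    simpa [Function.comp_def] using h

end Gaussian

/-! ### Decaying smooth functions in the domain of the closure -/

section Cutoff

variable {n : ℕ}

lemma momentum_mul (v : Cn n) {χ f : Cn n → ℂ} (hχ : ContDiff ℝ ∞ χ) (hf : ContDiff ℝ ∞ f) :
    momentum v (fun z => χ z * f z) =
      fun z => χ z * momentum v f z + -Complex.I * (fderiv ℝ χ z v * f z) := by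
  funext z
  have h : fderiv ℝ (fun z => χ z * f z) z = _ :=
    (((hχ.differentiable (by simp)) z).hasFDerivAt.mul
      ((hf.differentiable (by simp)) z).hasFDerivAt).fderiv
  rw [momentum, h, momentum]
  simp
  ring

lemma momentum_momentum_mul (v : Cn n) {χ f : Cn n → ℂ} (hχ : ContDiff ℝ ∞ χ)
    (hf : ContDiff ℝ ∞ f) (z : Cn n) :
    momentum v (momentum v (fun z => χ z * f z)) z =
      χ z * momentum v (momentum v f) z - 2 * Complex.I * (fderiv ℝ χ z v * momentum v f z)
        - fderiv ℝ (fun z => fderiv ℝ χ z v) z v * f z := by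
  have hD : ContDiff ℝ ∞ fun z => fderiv ℝ χ z v :=
    (hχ.fderiv_right (m := ∞) (by simp)).clm_apply contDiff_const
  have hm := contDiff_momentum v hf
  have hs : ContDiff ℝ ∞ ((-Complex.I) • fun z => fderiv ℝ χ z v * f z) :=
    (hD.mul hf).const_smul (-Complex.I)
  have e : (fun z => χ z * momentum v f z + -Complex.I * (fderiv ℝ χ z v * f z))
      = (fun z => χ z * momentum v f z) + (-Complex.I) • fun z => fderiv ℝ χ z v * f z := rfl
  rw [momentum_mul v hχ hf, e, momentum_add v (hχ.mul hm) hs,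
    momentum_smul v _ (hD.mul hf), momentum_mul v hχ hm, momentum_mul v hD hf]
  simp only [Pi.add_apply, Pi.smul_apply, smul_eq_mul]
  ring_nf
  simp
  ring

lemma fderiv_comp_const_smul (χ : Cn n → ℂ) (hχ : ContDiff ℝ ∞ χ) (c : ℝ) (z v : Cn n) :
    fderiv ℝ (fun z => χ (c • z)) z v = c * fderiv ℝ χ (c • z) v := by
  have h : HasFDerivAt (fun z : Cn n => χ (c • z)) _ z :=
    ((hχ.differentiable (by simp)) (c • z)).hasFDerivAt.comp z
      ((c • ContinuousLinearMap.id ℝ (Cn n)).hasFDerivAt)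
  rw [h.fderiv]
  simp

lemma exists_cutoff (n : ℕ) : ∃ χ : Cn n → ℂ, ContDiff ℝ ∞ χ ∧ HasCompactSupport χ ∧
    ∀ z ∈ Metric.ball (0 : Cn n) 1, χ z = 1 := by
  let χ : ContDiffBump (0 : Cn n) := ⟨1, 2, one_pos, one_lt_two⟩
  refine ⟨fun z => (χ z : ℂ), Complex.ofRealCLM.contDiff.comp χ.contDiff,
    χ.hasCompactSupport.comp_left (g := Complex.ofReal) Complex.ofReal_zero, fun z hz => ?_⟩
  change ((χ z : ℝ) : ℂ) = 1
  rw [χ.one_of_mem_closedBall (Metric.ball_subset_closedBall hz), Complex.ofReal_one]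

lemma exists_bound {χ : Cn n → ℂ} (hχ : Continuous χ) (hc : HasCompactSupport χ) :
    ∃ C, 0 ≤ C ∧ ∀ z, ‖χ z‖ ≤ C := by
  obtain ⟨C, hC⟩ := hc.exists_bound_of_continuous hχ
  exact ⟨C, (norm_nonneg _).trans (hC 0), hC⟩

/-- Smooth functions that decay together with their first two momenta are in the domain of the
closure of the Landau Hamiltonian. -/
lemma mem_closure_graph_of_memLp {f : Cn n → ℂ} (hf : ContDiff ℝ ∞ f) (h0 : MemLp f 2 volume)
    (h1 : ∀ v, MemLp (momentum v f) 2 volume)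
    (h2 : ∀ v, MemLp (momentum v (momentum v f)) 2 volume) {p : L2 n × L2 n}
    (hp1 : p.1 =ᵐ[volume] f) (hp2 : p.2 =ᵐ[volume] hamiltonian f) :
    p ∈ closure (hamiltonianGraph n : Set (L2 n × L2 n)) := by
  obtain ⟨χ, hχ, hχc, hχ1⟩ := exists_cutoff n
  have hD : ∀ v, ContDiff ℝ ∞ fun z => fderiv ℝ χ z v := fun v =>
    (hχ.fderiv_right (m := ∞) (by simp)).clm_apply contDiff_const
  have hDc : ∀ v, HasCompactSupport fun z => fderiv ℝ χ z v := fun v =>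
    (hχc.fderiv (𝕜 := ℝ)).comp_left (g := fun L : Cn n →L[ℝ] ℂ => L v) (by simp)
  have hDD : ∀ v, ContDiff ℝ ∞ fun z => fderiv ℝ (fun z => fderiv ℝ χ z v) z v := fun v =>
    ((hD v).fderiv_right (m := ∞) (by simp)).clm_apply contDiff_const
  have hDDc : ∀ v, HasCompactSupport fun z => fderiv ℝ (fun z => fderiv ℝ χ z v) z v := fun v =>
    ((hDc v).fderiv (𝕜 := ℝ)).comp_left (g := fun L : Cn n →L[ℝ] ℂ => L v) (by simp)
  obtain ⟨C0, hC0, hb0⟩ := exists_bound hχ.continuous hχc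
  choose C1 hC1 hb1 using fun v => exists_bound (hD v).continuous (hDc v)
  choose C2 hC2 hb2 using fun v => exists_bound (hDD v).continuous (hDDc v)
  let c : ℕ → ℝ := fun k => 1 / ((k : ℝ) + 1)
  have hc0 : ∀ k, 0 < c k := fun k => by positivity
  have hc1 : ∀ k, c k ≤ 1 := fun k => by
    simp only [c]; rw [div_le_one (by positivity)]; linarith [(Nat.cast_nonneg k : (0 : ℝ) ≤ k)]
  -- Dilated cutoffs equal 1 on growing balls, and each derivative gains a factor `c k` ≤ 1, so the
  -- commutator terms are bounded uniformly in k.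
  let X : ℕ → Cn n → ℂ := fun k z => χ (c k • z)
  have hX : ∀ k, ContDiff ℝ ∞ (X k) := fun k => hχ.comp (contDiff_const_smul (c k))
  have hXc : ∀ k, HasCompactSupport (X k) := fun k =>
    hχc.comp_homeomorph (Homeomorph.smulOfNeZero (c k) (hc0 k).ne')
  have hXD : ∀ k v z, fderiv ℝ (X k) z v = c k * fderiv ℝ χ (c k • z) v := fun k v z =>
    fderiv_comp_const_smul χ hχ (c k) z v
  have hXDD : ∀ k v z, fderiv ℝ (fun z => fderiv ℝ (X k) z v) z v
      = c k * (c k * fderiv ℝ (fun z => fderiv ℝ χ z v) (c k • z) v) := fun k v z => by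
    simp_rw [hXD]
    have : HasFDerivAt (fun z : Cn n => fderiv ℝ χ (c k • z) v) _ z :=
      (((hD v).comp (contDiff_const_smul (c k))).differentiable (by simp) z).hasFDerivAt
    rw [(this.const_mul (c k : ℂ)).fderiv, smul_apply, smul_eq_mul]
    congr 1
    exact fderiv_comp_const_smul _ (hD v) (c k) z v
  have hg : ∀ k, ContDiff ℝ ∞ fun z => X k z * f z := fun k => (hX k).mul hf
  have hgc : ∀ k, HasCompactSupport fun z => X k z * f z := fun k => (hXc k).mul_right
  have hHg : ∀ k, ContDiff ℝ ∞ (hamiltonian fun z => X k z * f z) := fun k =>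
    ContDiff.sum fun j _ => (contDiff_momentum _ (contDiff_momentum _ (hg k))).add
      (contDiff_momentum _ (contDiff_momentum _ (hg k)))
  have hHgc : ∀ k, HasCompactSupport (hamiltonian fun z => X k z * f z) := fun k => by
    have hs : ∀ s : Finset (Fin n), HasCompactSupport (fun z => ∑ j ∈ s,
        (momentum (EuclideanSpace.single j 1)
            (momentum (EuclideanSpace.single j 1) fun z => X k z * f z) z +
          momentum (EuclideanSpace.single j Complex.I)
            (momentum (EuclideanSpace.single j Complex.I) fun z => X k z * f z) z)) := by
      intro s
      induction s using Finset.cons_induction with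
      | empty => simp only [Finset.sum_empty]; exact HasCompactSupport.zero
      | cons a s ha ih =>
        simp_rw [Finset.sum_cons]
        exact ((hasCompactSupport_momentum _ (hasCompactSupport_momentum _ (hgc k))).add
          (hasCompactSupport_momentum _ (hasCompactSupport_momentum _ (hgc k)))).add ih
    exact hs Finset.univ
  have m1 : ∀ k, MemLp (fun z => X k z * f z) 2 (volume : Measure (Cn n)) := fun k =>
    (hg k).continuous.memLp_of_hasCompactSupport (hgc k)
  have m2 : ∀ k, MemLp (hamiltonian fun z => X k z * f z) 2 (volume : Measure (Cn n)) := fun k =>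
    (hHg k).continuous.memLp_of_hasCompactSupport (hHgc k)
  have hev : ∀ z, ∀ᶠ k in atTop, c k • z ∈ Metric.ball (0 : Cn n) 1 := fun z => by
    have : Tendsto (fun k => c k • z) atTop (𝓝 ((0 : ℝ) • z)) :=
      (tendsto_one_div_add_atTop_nhds_zero_nat (𝕜 := ℝ)).smul_const z
    rw [zero_smul] at this
    exact this.eventually (Metric.ball_mem_nhds 0 one_pos)
  have hDball : ∀ v, ∀ z ∈ Metric.ball (0 : Cn n) 1, fderiv ℝ χ z v = 0 := fun v z hz => by
    have : χ =ᶠ[𝓝 z] fun _ => 1 := by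
      filter_upwards [Metric.isOpen_ball.mem_nhds hz] with y hy using hχ1 y hy
    rw [this.fderiv_eq]; simp
  have hDDball : ∀ v, ∀ z ∈ Metric.ball (0 : Cn n) 1,
      fderiv ℝ (fun z => fderiv ℝ χ z v) z v = 0 := fun v z hz => by
    have : (fun z => fderiv ℝ χ z v) =ᶠ[𝓝 z] fun _ => 0 := by
      filter_upwards [Metric.isOpen_ball.mem_nhds hz] with y hy using hDball v y hy
    rw [this.fderiv_eq]; simp
  have hmm : ∀ k v z, momentum v (momentum v fun z => X k z * f z) z =
      X k z * momentum v (momentum v f) z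
        - 2 * Complex.I * (c k * fderiv ℝ χ (c k • z) v * momentum v f z)
        - c k * (c k * fderiv ℝ (fun z => fderiv ℝ χ z v) (c k • z) v) * f z := fun k v z => by
    rw [momentum_momentum_mul v (hX k) hf z, hXD, hXDD]
  let B : Cn n → Cn n → ℝ := fun v z =>
    (C0 + 1) * ‖momentum v (momentum v f) z‖ + 2 * C1 v * ‖momentum v f z‖ + C2 v * ‖f z‖
  have hB : ∀ v, MemLp (B v) 2 (volume : Measure (Cn n)) := fun v =>
    (((h2 v).norm.const_mul _).add ((h1 v).norm.const_mul _)).add (h0.norm.const_mul _)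
  have hmmB : ∀ k v z, ‖momentum v (momentum v fun z => X k z * f z) z
      - momentum v (momentum v f) z‖ ≤ B v z := fun k v z => by
    rw [hmm]
    have a1 : ‖X k z‖ ≤ C0 := hb0 _
    have a2 : ‖(c k : ℂ)‖ ≤ 1 := by
      rw [Complex.norm_real, Real.norm_of_nonneg (hc0 k).le]; exact hc1 k
    calc ‖X k z * momentum v (momentum v f) z
        - 2 * Complex.I * (c k * fderiv ℝ χ (c k • z) v * momentum v f z)
        - c k * (c k * fderiv ℝ (fun z => fderiv ℝ χ z v) (c k • z) v) * f z
        - momentum v (momentum v f) z‖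
        = ‖(X k z - 1) * momentum v (momentum v f) z
        - 2 * Complex.I * (c k * fderiv ℝ χ (c k • z) v * momentum v f z)
        - c k * (c k * fderiv ℝ (fun z => fderiv ℝ χ z v) (c k • z) v) * f z‖ := by
          congr 1; ring
      _ ≤ ‖(X k z - 1) * momentum v (momentum v f) z‖
        + ‖2 * Complex.I * (c k * fderiv ℝ χ (c k • z) v * momentum v f z)‖
        + ‖c k * (c k * fderiv ℝ (fun z => fderiv ℝ χ z v) (c k • z) v) * f z‖ :=
          (norm_sub_le _ _).trans (by gcongr; exact norm_sub_le _ _)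
      _ = ‖X k z - 1‖ * ‖momentum v (momentum v f) z‖
        + 2 * (‖(c k : ℂ)‖ * ‖fderiv ℝ χ (c k • z) v‖) * ‖momentum v f z‖
        + (‖(c k : ℂ)‖ * (‖(c k : ℂ)‖ * ‖fderiv ℝ (fun z => fderiv ℝ χ z v) (c k • z) v‖))
          * ‖f z‖ := by
          simp only [norm_mul, Complex.norm_I, Complex.norm_ofNat]; ring
      _ ≤ (C0 + 1) * ‖momentum v (momentum v f) z‖
        + 2 * (1 * C1 v) * ‖momentum v f z‖ + (1 * (1 * C2 v)) * ‖f z‖ := by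
          have a3 : ‖X k z - 1‖ ≤ C0 + 1 := (norm_sub_le _ _).trans (by simpa using a1)
          have a4 := hb1 v (c k • z)
          have a5 := hb2 v (c k • z)
          gcongr
      _ = B v z := by simp only [B]; ring
  -- At a fixed point the cutoff is eventually 1 nearby, so pointwise convergence is eventual
  -- equality.
  have hmml : ∀ v z, ∀ᶠ k in atTop, momentum v (momentum v fun z => X k z * f z) z
      = momentum v (momentum v f) z := fun v z => by
    filter_upwards [hev z] with k hk
    rw [hmm, hDball v _ hk, hDDball v _ hk, show X k z = 1 from hχ1 _ hk]
    ring
  let q : ℕ → L2 n × L2 n := fun k => ((m1 k).toLp _, (m2 k).toLp _)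
  have hq : ∀ k, q k ∈ (hamiltonianGraph n : Set (L2 n × L2 n)) := fun k =>
    ⟨_, hg k, hgc k, (m1 k).coeFn_toLp, (m2 k).coeFn_toLp⟩
  have t1 : Tendsto (fun k => (q k).1 - p.1) atTop (𝓝 0) := by
    refine tendsto_zero_of_dominated (G := fun z => (C0 + 1) * ‖f z‖) (h0.norm.const_mul _)
      (fun k => ?_) ?_
    · filter_upwards [Lp.coeFn_sub (q k).1 p.1, (m1 k).coeFn_toLp, hp1] with z e1 e2 e3
      rw [e1, Pi.sub_apply, e3, e2, ← sub_one_mul, norm_mul]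
      have a3 : ‖X k z - 1‖ ≤ C0 + 1 := (norm_sub_le _ _).trans (by simpa using hb0 _)
      gcongr
    · have := ae_all_iff.2 fun k => ((Lp.coeFn_sub (q k).1 p.1).and (m1 k).coeFn_toLp)
      filter_upwards [this, hp1] with z e1 e3
      refine tendsto_const_nhds.congr' ?_
      filter_upwards [hev z] with k hk
      rw [(e1 k).1, Pi.sub_apply, e3, (e1 k).2, show X k z = 1 from hχ1 _ hk]
      ring
  have t2 : Tendsto (fun k => (q k).2 - p.2) atTop (𝓝 0) := by
    refine tendsto_zero_of_dominated (G := fun z => ∑ j, (B (EuclideanSpace.single j 1) z +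
        B (EuclideanSpace.single j Complex.I) z))
      (memLp_finsetSum _ fun j _ => (hB _).add (hB _)) (fun k => ?_) ?_
    · filter_upwards [Lp.coeFn_sub (q k).2 p.2, (m2 k).coeFn_toLp, hp2] with z e1 e2 e3
      rw [e1, Pi.sub_apply, e3, e2, hamiltonian, hamiltonian, ← Finset.sum_sub_distrib]
      refine (norm_sum_le _ _).trans (Finset.sum_le_sum fun j _ => ?_)
      rw [add_sub_add_comm]
      exact (norm_add_le _ _).trans (add_le_add (hmmB _ _ _) (hmmB _ _ _))
    · have := ae_all_iff.2 fun k => ((Lp.coeFn_sub (q k).2 p.2).and (m2 k).coeFn_toLp)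
      filter_upwards [this, hp2] with z e1 e3
      refine tendsto_const_nhds.congr' ?_
      have : ∀ᶠ k in atTop, ∀ j : Fin n, _ := eventually_all.2 fun j =>
        (hmml (EuclideanSpace.single j 1) z).and (hmml (EuclideanSpace.single j Complex.I) z)
      filter_upwards [this] with k hk
      rw [(e1 k).1, Pi.sub_apply, e3, (e1 k).2, hamiltonian, hamiltonian, eq_comm, sub_eq_zero]
      exact Finset.sum_congr rfl fun j _ => by rw [(hk j).1, (hk j).2]
  have t : Tendsto q atTop (𝓝 p) := by
    have := (t1.add_const p.1).prodMk_nhds (t2.add_const p.2)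
    simpa using this
  exact mem_closure_of_tendsto t (Eventually.of_forall hq)

end Cutoff

/-! ### The Hamiltonian on Gaussians -/

section GaussianGraph

variable {n : ℕ}

lemma vectorPotential_comm (z v : Cn n) : vectorPotential z v = -vectorPotential v z := by
  simp only [vectorPotential, ← mul_neg, ← Finset.sum_neg_distrib]
  congr 1
  exact Finset.sum_congr rfl fun j _ => by ring

/-- The linear function `z ↦ 2ib⟨z, v⟩ - A_z(v)`: the quotient of `Π_v exp (-b|z|²)` by
`exp (-b|z|²)`. -/
def gaussLin (b : ℂ) (v : Cn n) : Cn n →L[ℝ] ℂ :=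
  (innerSL ℝ v).smulRight (2 * Complex.I * b) + (vectorPotentialCLM v).smulRight (1 : ℂ)

lemma gaussLin_apply (b : ℂ) (v z : Cn n) :
    gaussLin b v z = (inner ℝ v z : ℝ) * (2 * Complex.I * b) - (vectorPotential z v : ℂ) := by
  rw [vectorPotential_comm z v]
  simp [gaussLin]

lemma fderiv_gauss_zero (b : ℂ) (z v : Cn n) :
    fderiv ℝ (gauss n 0 b) z v = -2 * b * (inner ℝ v z : ℝ) * gauss n 0 b z := by
  have h1 : HasFDerivAt (fun z : Cn n => ‖z‖ ^ 2) (2 • innerSL ℝ z) z :=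
    (hasStrictFDerivAt_norm_sq z).hasFDerivAt
  have h2 : HasFDerivAt (fun z : Cn n => -b * ((‖z‖ ^ 2 : ℝ) : ℂ))
      ((-b) • Complex.ofRealCLM.comp (2 • innerSL ℝ z)) z :=
    (Complex.ofRealCLM.hasFDerivAt.comp z h1).const_mul (-b)
  have h3 : gauss n 0 b = fun z => Complex.exp (-b * ((‖z‖ ^ 2 : ℝ) : ℂ)) := by
    funext z; simp [gauss]
  rw [h3, h2.cexp.fderiv]
  simp only [smul_apply, smul_eq_mul, ContinuousLinearMap.comp_apply, innerSL_apply_apply,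
    Complex.ofRealCLM_apply, nsmul_eq_mul, real_inner_comm v z]
  push_cast
  ring

lemma momentum_gauss (b : ℂ) (v : Cn n) :
    momentum v (gauss n 0 b) = fun z => gaussLin b v z * gauss n 0 b z := by
  funext z
  rw [momentum, fderiv_gauss_zero, gaussLin_apply]
  ring

lemma momentum_momentum_gauss (b : ℂ) (v : Cn n) :
    momentum v (momentum v (gauss n 0 b)) =
      fun z => (2 * b * (‖v‖ ^ 2 : ℝ) + gaussLin b v z ^ 2) * gauss n 0 b z := by
  rw [momentum_gauss, momentum_mul v (gaussLin b v).contDiff (contDiff_gauss 0 b), momentum_gauss]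
  funext z
  rw [ContinuousLinearMap.fderiv, gaussLin_apply b v v, vectorPotential_self,
    real_inner_self_eq_norm_sq, Complex.ofReal_zero]
  have := Complex.I_sq
  linear_combination (-2 * b * (‖v‖ ^ 2 : ℝ) * gauss n 0 b z) * this

/-- In each complex coordinate z_j = x + iy the two linear factors are 2ibx + y/2 and 2iby - x/2.
The cross terms of their squares cancel, leaving (1/4 - 4b²)|z_j|², while each of the two directions
also contributes 2b. -/
lemma hamiltonian_gauss (b : ℂ) :
    hamiltonian (gauss n 0 b) =
      fun z => 4 * n * b * gauss n 0 b z + (1 / 4 - 4 * b ^ 2) * gauss n 1 b z := by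
  funext z
  have hj : ∀ j : Fin n,
      (2 * b * (‖(EuclideanSpace.single j 1 : Cn n)‖ ^ 2 : ℝ)
          + gaussLin b (EuclideanSpace.single j 1) z ^ 2) * gauss n 0 b z
      + (2 * b * (‖(EuclideanSpace.single j Complex.I : Cn n)‖ ^ 2 : ℝ)
          + gaussLin b (EuclideanSpace.single j Complex.I) z ^ 2) * gauss n 0 b z
      = (4 * b + (1 / 4 - 4 * b ^ 2) * (‖z j‖ ^ 2 : ℝ)) * gauss n 0 b z := fun j => by
    have i1 : inner ℝ (EuclideanSpace.single j 1 : Cn n) z = (z j).re := by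
      rw [PiLp.inner_apply, Finset.sum_eq_single j]
      · simp [Complex.inner]
      · intro i _ hi; simp [hi]
      · simp
    have i2 : inner ℝ (EuclideanSpace.single j Complex.I : Cn n) z = (z j).im := by
      rw [PiLp.inner_apply, Finset.sum_eq_single j]
      · simp [Complex.inner]
      · intro i _ hi; simp [hi]
      · simp
    have v1 : vectorPotential z (EuclideanSpace.single j 1) = -(1 / 2) * (z j).im := by
      rw [vectorPotential, Finset.sum_eq_single j]
      · simp
      · intro i _ hi; simp [hi]
      · simp
    have v2 : vectorPotential z (EuclideanSpace.single j Complex.I) = (1 / 2) * (z j).re := by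
      rw [vectorPotential, Finset.sum_eq_single j]
      · simp
      · intro i _ hi; simp [hi]
      · simp
    have hn : ‖z j‖ ^ 2 = (z j).re ^ 2 + (z j).im ^ 2 := by
      rw [← Complex.normSq_eq_norm_sq, Complex.normSq_apply]; ring
    rw [gaussLin_apply, gaussLin_apply, i1, i2, v1, v2, hn]
    simp only [PiLp.norm_single, norm_one, Complex.norm_I]
    push_cast
    have := Complex.I_sq
    linear_combination (4 * b ^ 2 * ((z j).re ^ 2 + (z j).im ^ 2) * gauss n 0 b z) * this
  have hz : (‖z‖ ^ 2 : ℝ) = ∑ j, ‖z j‖ ^ 2 := EuclideanSpace.norm_sq_eq z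
  have hg : gauss n 1 b z = (∑ j, ‖z j‖ ^ 2 : ℝ) * gauss n 0 b z := by
    rw [← hz]; simp [gauss]
  simp only [hamiltonian, momentum_momentum_gauss, hj, hg]
  rw [← Finset.sum_mul, Finset.sum_add_distrib, Finset.sum_const, Finset.card_univ,
    Fintype.card_fin, nsmul_eq_mul, ← Finset.mul_sum, ← Complex.ofReal_sum]
  ring

lemma memLp_pow_mul_gauss (L : Cn n →L[ℝ] ℂ) (k : ℕ) {b : ℂ} (hb : 0 < b.re) :
    MemLp (fun z => L z ^ k * gauss n 0 b z) 2 (volume : Measure (Cn n)) := by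
  have h1 := (memLp_gauss (n := n) k hb).norm.const_mul (‖L‖ ^ k)
  have h0 := (memLp_gauss (n := n) 0 hb).norm.const_mul (‖L‖ ^ k)
  refine (h1.add h0).mono ?_ (Eventually.of_forall fun z => ?_)
  · exact ((L.continuous.pow k).mul (contDiff_gauss 0 b).continuous).aestronglyMeasurable
  · simp only [Pi.add_apply]
    rw [norm_mul, norm_pow, Real.norm_of_nonneg (by positivity), norm_gauss, norm_gauss]
    have hL : ‖L z‖ ^ k ≤ ‖L‖ ^ k * ‖z‖ ^ k := by
      rw [← mul_pow]; gcongr; exact L.le_opNorm z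
    -- The functions `gauss` carry only even powers of the norm; t ≤ t² + 1 handles the odd ones.
    have hz : ‖z‖ ^ k ≤ (‖z‖ ^ 2) ^ k + 1 := by
      rw [← pow_mul, mul_comm 2 k, pow_mul]
      nlinarith [sq_nonneg (‖z‖ ^ k - 1), sq_nonneg (‖z‖ ^ k)]
    have he : 0 < Real.exp (-b.re * ‖z‖ ^ 2) := Real.exp_pos _
    calc ‖L z‖ ^ k * ((‖z‖ ^ 2) ^ 0 * Real.exp (-b.re * ‖z‖ ^ 2))
        ≤ (‖L‖ ^ k * ((‖z‖ ^ 2) ^ k + 1)) * ((‖z‖ ^ 2) ^ 0 * Real.exp (-b.re * ‖z‖ ^ 2)) := by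
          gcongr
          exact hL.trans (by gcongr)
      _ = _ := by ring

lemma gaussLp_mem_closure_graph {b : ℂ} (hb : 0 < b.re) :
    (gaussLp n 0 b, (4 * n * b) • gaussLp n 0 b + (1 / 4 - 4 * b ^ 2) • gaussLp n 1 b) ∈
      closure (hamiltonianGraph n : Set (L2 n × L2 n)) := by
  refine mem_closure_graph_of_memLp (contDiff_gauss 0 b) (memLp_gauss 0 hb) (fun v => ?_)
    (fun v => ?_) (coeFn_gaussLp 0 hb) ?_
  · rw [momentum_gauss]
    simpa using memLp_pow_mul_gauss (gaussLin b v) 1 hb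
  · rw [momentum_momentum_gauss]
    have := ((memLp_gauss (n := n) 0 hb).const_mul (2 * b * (‖v‖ ^ 2 : ℝ))).add
      (memLp_pow_mul_gauss (gaussLin b v) 2 hb)
    refine this.congr_norm ?_ ?_
    · exact (((continuous_const.add ((gaussLin b v).continuous.pow 2)).mul
        (contDiff_gauss 0 b).continuous)).aestronglyMeasurable
    · refine Eventually.of_forall fun z => ?_
      simp only [Pi.add_apply, add_mul]
  · rw [hamiltonian_gauss]
    filter_upwards [Lp.coeFn_add ((4 * n * b) • gaussLp n 0 b)
      ((1 / 4 - 4 * b ^ 2) • gaussLp n 1 b), Lp.coeFn_smul (4 * n * b) (gaussLp n 0 b),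
      Lp.coeFn_smul (1 / 4 - 4 * b ^ 2) (gaussLp n 1 b), coeFn_gaussLp (n := n) 0 hb,
      coeFn_gaussLp (n := n) 1 hb] with z h1 h2 h3 h4 h5
    rw [h1, Pi.add_apply, h2, h3, Pi.smul_apply, Pi.smul_apply, h4, h5, smul_eq_mul, smul_eq_mul]

end GaussianGraph

/-! ### Derivatives and power series of vector-valued holomorphic functions -/

section Taylor

variable {E F : Type*} [NormedAddCommGroup E] [NormedSpace ℂ E] [CompleteSpace E]
  [NormedAddCommGroup F] [NormedSpace ℂ F] [CompleteSpace F]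

lemma differentiableOn_iteratedDeriv {f : ℂ → E} {U : Set ℂ} (hU : IsOpen U)
    (hf : DifferentiableOn ℂ f U) (k : ℕ) : DifferentiableOn ℂ (iteratedDeriv k f) U := by
  induction k with
  | zero => simpa using hf
  | succ k ih => rw [iteratedDeriv_succ]; exact ih.deriv hU

lemma hasDerivAt_iteratedDeriv {f : ℂ → E} {U : Set ℂ} (hU : IsOpen U)
    (hf : DifferentiableOn ℂ f U) (k : ℕ) {s : ℂ} (hs : s ∈ U) :
    HasDerivAt (iteratedDeriv k f) (iteratedDeriv (k + 1) f s) s := by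
  rw [iteratedDeriv_succ]
  exact ((differentiableOn_iteratedDeriv hU hf k).differentiableAt (hU.mem_nhds hs)).hasDerivAt

omit [CompleteSpace E] in
-- Difference quotients stay in the subspace. Applied to the closed graph of H, this allows an
-- identity for H to be differentiated in a parameter.
lemma HasDerivAt.mem_of_isClosed {f : ℂ → E} {f' : E} {s : ℂ} (hf : HasDerivAt f f' s)
    {S : Submodule ℂ E} (hS : IsClosed (S : Set E)) {U : Set ℂ} (hU : IsOpen U) (hs : s ∈ U)
    (hfS : ∀ t ∈ U, f t ∈ S) : f' ∈ S := by
  refine hS.mem_of_tendsto (hasDerivAt_iff_tendsto_slope.1 hf) ?_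
  filter_upwards [nhdsWithin_le_nhds (hU.mem_nhds hs)] with t ht
  rw [slope_def_module]
  exact S.smul_mem _ (S.sub_mem (hfS t ht) (hfS s hs))

omit [CompleteSpace F] in
lemma iteratedDeriv_clm_comp {f : ℂ → E} {g : ℂ → F} {U : Set ℂ} (hU : IsOpen U)
    (hf : DifferentiableOn ℂ f U) (L : E →L[ℂ] F) (hg : ∀ s ∈ U, g s = L (f s)) (k : ℕ) :
    ∀ s ∈ U, iteratedDeriv k g s = L (iteratedDeriv k f s) := by
  induction k with
  | zero => simpa using hg
  | succ k ih =>
    intro s hs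
    have h1 : iteratedDeriv k g =ᶠ[𝓝 s] fun s => L (iteratedDeriv k f s) := by
      filter_upwards [hU.mem_nhds hs] with t ht using ih t ht
    rw [iteratedDeriv_succ, h1.deriv_eq]
    exact (L.hasFDerivAt.comp_hasDerivAt s (hasDerivAt_iteratedDeriv hU hf k hs)).deriv

omit [CompleteSpace E] in
/-- Uniqueness of power series coefficients. -/
lemma hasSum_pow_smul_unique {f : ℂ → E} {a b : ℕ → E} {r : ℝ} (hr : 0 < r)
    (ha : ∀ s ∈ Metric.ball (0 : ℂ) r, HasSum (fun k => s ^ k • a k) (f s))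
    (hb : ∀ s ∈ Metric.ball (0 : ℂ) r, HasSum (fun k => s ^ k • b k) (f s)) : a = b := by
  let P : (ℕ → E) → FormalMultilinearSeries ℂ ℂ E :=
    fun c k => ContinuousMultilinearMap.mkPiRing ℂ (Fin k) (c k)
  have hp : ∀ c : ℕ → E, (∀ s ∈ Metric.ball (0 : ℂ) r, HasSum (fun k => s ^ k • c k) (f s)) →
      HasFPowerSeriesAt f (P c) 0 := by
    intro c hc
    rw [hasFPowerSeriesAt_iff]
    filter_upwards [Metric.ball_mem_nhds 0 hr] with s hs
    simpa [P, FormalMultilinearSeries.coeff] using hc s hs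
  have h := (hp a ha).eq_formalMultilinearSeries (hp b hb)
  funext k
  have := congrArg (fun p => FormalMultilinearSeries.coeff p k) h
  simpa [P, FormalMultilinearSeries.coeff] using this

end Taylor

/-! ### The generating function and the radial eigenfunctions -/

section GeneratingFunction

variable {n : ℕ}

/-- The Gaussian parameter of the generating function of the Landau levels. -/
def genParam (s : ℂ) : ℂ := (1 + s) / (4 * (1 - s))

/-- The generating function `(1 - s)⁻ⁿ exp (-(1 + s) / (4 (1 - s)) |z|²)` of the Landau levels. -/
def genFun (n : ℕ) (s : ℂ) : L2 n := ((1 - s) ^ n)⁻¹ • gaussLp n 0 (genParam s)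

lemma one_sub_ne_zero_of_mem_ball {s : ℂ} (hs : s ∈ Metric.ball (0 : ℂ) 1) : 1 - s ≠ 0 := by
  rw [sub_ne_zero]
  rintro rfl
  simp at hs

lemma genParam_re (s : ℂ) : (genParam s).re = (1 - ‖s‖ ^ 2) / (4 * ‖1 - s‖ ^ 2) := by
  have h : genParam s = ((1 + s) * (starRingEnd ℂ) (1 - s)) / (4 * ‖1 - s‖ ^ 2 : ℝ) := by
    by_cases hs : 1 - s = 0
    · simp [genParam, hs]
    · have h2 : (starRingEnd ℂ) (1 - s) ≠ 0 :=
        (map_ne_zero (starRingEnd ℂ)).2 hs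
      have h3 : ((‖1 - s‖ : ℂ)) ^ 2 = (1 - s) * (starRingEnd ℂ) (1 - s) := by
        rw [Complex.mul_conj']
      rw [genParam]
      push_cast
      rw [h3]
      field_simp
  rw [h, Complex.div_ofReal_re]
  congr 1
  rw [← Complex.normSq_eq_norm_sq, Complex.normSq_apply]
  simp
  ring

lemma genParam_re_pos {s : ℂ} (hs : s ∈ Metric.ball (0 : ℂ) 1) : 0 < (genParam s).re := by
  have h1 : ‖1 - s‖ ≠ 0 := norm_ne_zero_iff.2 (one_sub_ne_zero_of_mem_ball hs)
  have h2 : ‖s‖ < 1 := by simpa using hs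
  rw [genParam_re]
  have : ‖s‖ ^ 2 < 1 := by nlinarith [norm_nonneg s]
  have : 0 < 1 - ‖s‖ ^ 2 := by linarith
  positivity

/-- The uniform lower bound leaves room to split off a fixed Gaussian factor in `integrable_radial`.
-/
lemma one_div_sixteen_lt_genParam_re {s : ℂ} (hs : s ∈ Metric.ball (0 : ℂ) (1 / 2)) :
    1 / 16 < (genParam s).re := by
  have h2 : ‖s‖ < 1 / 2 := by simpa using hs
  have h1 : ‖1 - s‖ ≠ 0 := norm_ne_zero_iff.2
    (one_sub_ne_zero_of_mem_ball (Metric.ball_subset_ball (by norm_num) hs))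
  have h3 : ‖1 - s‖ ≤ 1 + ‖s‖ := (norm_sub_le _ _).trans (by simp)
  rw [genParam_re, div_lt_div_iff₀ (by norm_num) (by positivity)]
  have : ‖1 - s‖ ^ 2 ≤ (1 + ‖s‖) ^ 2 := by gcongr
  nlinarith [norm_nonneg s]

lemma hasDerivAt_genParam {s : ℂ} (hs : 1 - s ≠ 0) :
    HasDerivAt genParam (1 / (2 * (1 - s) ^ 2)) s := by
  have h : HasDerivAt genParam _ s := ((hasDerivAt_id s).const_add 1).div
    (((hasDerivAt_id s).const_sub 1).const_mul 4) (mul_ne_zero (by norm_num) hs)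
  refine h.congr_deriv ?_
  simp only [id]
  field_simp
  ring

lemma hasDerivAt_inv_one_sub_pow (n : ℕ) {s : ℂ} (hs : 1 - s ≠ 0) :
    HasDerivAt (fun s : ℂ => ((1 - s) ^ n)⁻¹) (n * (1 / (1 - s)) * ((1 - s) ^ n)⁻¹) s := by
  have h : HasDerivAt (fun s : ℂ => ((1 - s) ^ n)⁻¹) _ s :=
    (((hasDerivAt_id s).const_sub 1).pow n).inv (pow_ne_zero n hs)
  refine h.congr_deriv ?_
  simp only [id, Pi.pow_apply]
  rcases n with _ | n
  · simp
  · field_simp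
    simp [pow_succ]
    ring

lemma hasDerivAt_genFun {s : ℂ} (hs : s ∈ Metric.ball (0 : ℂ) 1) :
    HasDerivAt (genFun n) (((1 - s) ^ n)⁻¹ • ((n * (1 / (1 - s))) • gaussLp n 0 (genParam s)
      - (1 / (2 * (1 - s) ^ 2)) • gaussLp n 1 (genParam s))) s := by
  have h0 := one_sub_ne_zero_of_mem_ball hs
  have h : HasDerivAt (genFun n) _ s := (hasDerivAt_inv_one_sub_pow n h0).smul
    ((hasDerivAt_gaussLp (n := n) (genParam_re_pos hs)).scomp s (hasDerivAt_genParam h0))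
  refine h.congr_deriv ?_
  module

lemma differentiableOn_genFun : DifferentiableOn ℂ (genFun n) (Metric.ball 0 1) :=
  fun _ hs => (hasDerivAt_genFun hs).differentiableAt.differentiableWithinAt

/-- The differential equation `H G = 2 s ∂ₛ G + n G` of the generating function. -/
lemma genFun_mem_closure_graph {s : ℂ} (hs : s ∈ Metric.ball (0 : ℂ) 1) :
    (genFun n s, (2 * s) • deriv (genFun n) s + (n : ℂ) • genFun n s) ∈
      (hamiltonianGraph n).topologicalClosure := by
  have h0 := one_sub_ne_zero_of_mem_ball hs
  have h := (hamiltonianGraph n).topologicalClosure.smul_mem (((1 - s) ^ n)⁻¹)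
    (gaussLp_mem_closure_graph (n := n) (genParam_re_pos hs))
  convert h using 1
  rw [(hasDerivAt_genFun hs).deriv, genFun, Prod.smul_mk]
  congr 1
  -- The parameter b(s) solves 2s b' = 4b² - 1/4, which matches the |z|² terms; the prefactor (1 -
  -- s)⁻ⁿ accounts for 4nb.
  have e1 : (4 * n * genParam s : ℂ) = 2 * s * (n * (1 / (1 - s))) + n := by
    rw [genParam]; field_simp; ring
  have e2 : (1 / 4 - 4 * genParam s ^ 2 : ℂ) = -(2 * s * (1 / (2 * (1 - s) ^ 2))) := by
    rw [genParam]; field_simp; ring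
  rw [e1, e2]
  module

/-- Each differentiation of the term 2s ∂ₛG adds 2 to the coefficient of the lower derivative. At s
= 0 the leading term drops out and the eigenvalue 2k + n remains. -/
lemma iteratedDeriv_genFun_mem_closure_graph (k : ℕ) : ∀ s ∈ Metric.ball (0 : ℂ) 1,
    (iteratedDeriv k (genFun n) s, (2 * s) • iteratedDeriv (k + 1) (genFun n) s
      + (2 * k + n : ℂ) • iteratedDeriv k (genFun n) s) ∈
        (hamiltonianGraph n).topologicalClosure := by
  induction k with
  | zero =>
    intro s hs
    simpa using genFun_mem_closure_graph hs
  | succ k ih =>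
    intro s hs
    have d := fun k => hasDerivAt_iteratedDeriv Metric.isOpen_ball
      (differentiableOn_genFun (n := n)) k hs
    have h2 : HasDerivAt (fun s : ℂ => (2 * s) • iteratedDeriv (k + 1) (genFun n) s
        + (2 * k + n : ℂ) • iteratedDeriv k (genFun n) s) _ s :=
      ((((hasDerivAt_id s).const_mul 2).smul (d (k + 1))).add ((d k).const_smul (2 * k + n : ℂ)))
    have := Landau.HasDerivAt.mem_of_isClosed ((d k).prodMk h2)
      (hamiltonianGraph n).isClosed_topologicalClosure Metric.isOpen_ball hs ih
    convert this using 2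
    simp only [id]
    push_cast
    module

/-- The radial function of the `k`-th Landau level. -/
def radial (n k : ℕ) : L2 n := (k.factorial : ℂ)⁻¹ • iteratedDeriv k (genFun n) 0

lemma radial_mem_level (k : ℕ) : radial n k ∈ level n k := by
  have h := iteratedDeriv_genFun_mem_closure_graph (n := n) k 0 (by simp)
  refine (level n k).smul_mem _ ?_
  rw [mul_zero, zero_smul, zero_add] at h
  exact h

lemma hasSum_genFun {s : ℂ} (hs : s ∈ Metric.ball (0 : ℂ) 1) :
    HasSum (fun k => s ^ k • radial n k) (genFun n s) := by
  have h := Complex.hasSum_taylorSeries_on_ball (differentiableOn_genFun (n := n)) hs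
  convert h using 2 with k
  rw [sub_zero, radial, smul_comm]

/-- `radial n k` is the product of two functions in `L²(ℂⁿ)`, hence integrable. -/
lemma integrable_radial (k : ℕ) : Integrable (radial n k) := by
  -- For |s| < 1/2, G_s is exp(-|z|²/16) times `ψ s`, which is still a holomorphic L²-valued family.
  -- Multiplication by the fixed factor commutes with derivatives in s, so the Taylor coefficients
  -- factor in the same way.
  let c : ℂ := 1 / 16
  have hc : 0 < c.re := by norm_num [c]
  let w : Cn n →ᵇ ℂ := BoundedContinuousFunction.ofNormedAddCommGroup (gauss n 0 c)
    (contDiff_gauss 0 c).continuous 1 fun z => by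
      rw [norm_gauss, pow_zero, one_mul]
      refine Real.exp_le_one_iff.2 ?_
      have : 0 ≤ c.re * ‖z‖ ^ 2 := by positivity
      linarith
  let ψ : ℂ → L2 n := fun s => ((1 - s) ^ n)⁻¹ • gaussLp n 0 (genParam s - c)
  have hsub : Metric.ball (0 : ℂ) (1 / 2) ⊆ Metric.ball 0 1 :=
    Metric.ball_subset_ball (by norm_num)
  have hpos : ∀ s ∈ Metric.ball (0 : ℂ) (1 / 2), 0 < (genParam s - c).re := fun s hs => by
    have := one_div_sixteen_lt_genParam_re hs
    rw [Complex.sub_re, show c.re = 1 / 16 by norm_num [c]]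
    linarith
  have hψ : DifferentiableOn ℂ ψ (Metric.ball 0 (1 / 2)) := fun s hs => by
    have h0 := one_sub_ne_zero_of_mem_ball (hsub hs)
    exact ((hasDerivAt_inv_one_sub_pow n h0).smul
      ((hasDerivAt_gaussLp (n := n) (hpos s hs)).scomp s
        ((hasDerivAt_genParam h0).sub_const c))).differentiableAt.differentiableWithinAt
  have hg : ∀ s ∈ Metric.ball (0 : ℂ) (1 / 2), genFun n s = mulOp w (ψ s) := fun s hs => by
    rw [genFun, map_smul]
    congr 1
    refine Lp.ext ?_
    filter_upwards [coeFn_mulOp w (gaussLp n 0 (genParam s - c)),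
      coeFn_gaussLp (n := n) 0 (hpos s hs), coeFn_gaussLp (n := n) 0 (genParam_re_pos (hsub hs))]
      with z h1 h2 h3
    rw [h1, h2, h3]
    change _ = gauss n 0 c z * _
    simp only [gauss, pow_zero, one_mul, ← Complex.exp_add]
    congr 1
    ring
  have h := iteratedDeriv_clm_comp Metric.isOpen_ball hψ (mulOp w) hg k 0 (by simp)
  have hr : radial n k = mulOp w ((k.factorial : ℂ)⁻¹ • iteratedDeriv k ψ 0) := by
    rw [radial, h, map_smul]
  rw [hr]
  refine Integrable.congr ?_ (coeFn_mulOp w _).symm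
  exact (memLp_gauss 0 hc).integrable_mul (Lp.memLp _)

lemma inner_gaussLp {b c : ℂ} (hb : 0 < b.re) (hc : 0 < c.re) :
    inner ℂ (gaussLp n 0 b) (gaussLp n 0 c) = (Real.pi / ((starRingEnd ℂ) b + c)) ^ n := by
  have hbc : 0 < ((starRingEnd ℂ) b + c).re := by simp; linarith
  have h := GaussianFourier.integral_cexp_neg_mul_sq_norm (V := Cn n) hbc
  rw [finrank_Cn] at h
  have h2 : (((2 * n : ℕ) : ℂ) / 2) = n := by push_cast; ring
  rw [h2, Complex.cpow_natCast] at h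
  rw [← h, L2.inner_def]
  refine integral_congr_ae ?_
  filter_upwards [coeFn_gaussLp (n := n) 0 hb, coeFn_gaussLp (n := n) 0 hc] with z h1 h2
  rw [h1, h2]
  simp only [gauss, RCLike.inner_apply, pow_zero, one_mul, ← Complex.exp_conj, ← Complex.exp_add]
  congr 1
  simp
  ring

/-- `⟨G_{1/2}, G_s⟩ = (2π / (1 - s/2))ⁿ`. -/
lemma inner_genFun_half {s : ℂ} (hs : s ∈ Metric.ball (0 : ℂ) 1) :
    inner ℂ (genFun n (1 / 2)) (genFun n s) = (2 * Real.pi) ^ n * (1 / (1 - s / 2) ^ n) := by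
  have h0 := one_sub_ne_zero_of_mem_ball hs
  have hh : (1 / 2 : ℂ) ∈ Metric.ball (0 : ℂ) 1 := by simp; norm_num
  have h1 : genParam (1 / 2) = ((3 / 4 : ℝ) : ℂ) := by rw [genParam]; push_cast; norm_num
  have h2 : (2 - s) ≠ 0 := by
    intro h
    rw [sub_eq_zero] at h
    rw [← h] at hs
    norm_num at hs
  rw [genFun, genFun, inner_smul_left, inner_smul_right,
    inner_gaussLp (genParam_re_pos hh) (genParam_re_pos hs), h1, Complex.conj_ofReal]
  have h3 : (starRingEnd ℂ) ((1 - 1 / 2 : ℂ) ^ n)⁻¹ = 2 ^ n := by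
    have : ((1 - 1 / 2 : ℂ) ^ n)⁻¹ = (2 ^ n : ℕ) := by
      push_cast; rw [← inv_pow]; norm_num
    rw [this, Complex.conj_natCast]; push_cast; rfl
  rw [h3, ← inv_pow, ← one_div_pow, ← mul_pow, ← mul_pow, ← mul_pow]
  congr 1
  have h4 : ((3 / 4 : ℝ) : ℂ) + genParam s = (2 - s) / (2 * (1 - s)) := by
    rw [genParam]; push_cast; field_simp; ring
  have h5 : (1 - s / 2) ≠ 0 := by
    intro h; apply h2; linear_combination 2 * h
  rw [h4]
  field_simp

/-- Pairing with G_{1/2} turns the expansion of G_s into the binomial series of (2π)ⁿ(1 - s/2)⁻ⁿ,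
all of whose coefficients are nonzero for n ≥ 1. For n = 0 this series is constant. -/
lemma radial_ne_zero (hn : 1 ≤ n) (k : ℕ) : radial n k ≠ 0 := by
  intro hk
  obtain ⟨a, rfl⟩ := Nat.exists_eq_add_of_le' hn
  have ha : ∀ s ∈ Metric.ball (0 : ℂ) 1, HasSum
      (fun k => s ^ k • (inner ℂ (genFun (a + 1) (1 / 2)) (radial (a + 1) k) : ℂ))
      (inner ℂ (genFun (a + 1) (1 / 2)) (genFun (a + 1) s)) := fun s hs => by
    have := (hasSum_genFun (n := a + 1) hs).mapL (innerSL ℂ (genFun (a + 1) (1 / 2)))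
    simpa only [innerSL_apply_apply, inner_smul_right, smul_eq_mul] using this
  have hb : ∀ s ∈ Metric.ball (0 : ℂ) 1, HasSum
      (fun k => s ^ k • ((2 * Real.pi) ^ (a + 1) * ((1 / 2) ^ k * (Nat.choose (a + k) a : ℂ)) : ℂ))
      (inner ℂ (genFun (a + 1) (1 / 2)) (genFun (a + 1) s)) := fun s hs => by
    rw [inner_genFun_half hs]
    have hs2 : s / 2 ∈ Metric.eball (0 : ℂ) 1 := by
      rw [Metric.mem_eball, edist_zero_right, ← ofReal_norm, ← ENNReal.ofReal_one]
      refine (ENNReal.ofReal_lt_ofReal_iff one_pos).2 ?_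
      have : ‖s‖ < 1 := by simpa using hs
      rw [norm_div]; norm_num; linarith
    have h := (Complex.one_div_one_sub_pow_hasFPowerSeriesOnBall_zero a).hasSum hs2
    rw [zero_add] at h
    have h' := h.mul_left ((2 * Real.pi : ℂ) ^ (a + 1))
    refine Eq.subst (motive := fun u => HasSum u _) (funext fun k => ?_) h'
    simp [FormalMultilinearSeries.ofScalars, div_pow]
    ring
  have h := congrFun (hasSum_pow_smul_unique one_pos ha hb) k
  simp only [hk, inner_zero_right] at h
  have hp : (Real.pi : ℂ) ≠ 0 := by exact_mod_cast Real.pi_ne_zero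
  have hch : (Nat.choose (a + k) a : ℂ) ≠ 0 := by
    exact_mod_cast (Nat.choose_pos (Nat.le_add_right a k)).ne'
  simp [hp, hch] at h

end GeneratingFunction

/-! ### Young's inequality for kernels given by magnetic translates -/

section Schur

variable {n : ℕ}

lemma eLpNorm_two_eq (f : Cn n → ℂ) :
    eLpNorm f 2 volume = (∫⁻ z, ‖f z‖ₑ ^ 2) ^ (1 / 2 : ℝ) := by
  rw [eLpNorm_eq_lintegral_rpow_enorm_toReal (by norm_num) (by norm_num)]
  simp

/-- Cauchy–Schwarz for the splitting ψf = ψ^{1/2} · (ψ^{1/2} f). -/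
lemma lintegral_mul_sq_le {ψ f : Cn n → ℝ≥0∞} (hψ : Measurable ψ) (hf : Measurable f) :
    (∫⁻ z, ψ z * f z) ^ 2 ≤ (∫⁻ z, ψ z) * ∫⁻ z, ψ z * f z ^ 2 := by
  have h := ENNReal.lintegral_mul_le_Lp_mul_Lq (volume : Measure (Cn n))
    Real.HolderConjugate.two_two
    (f := fun z => ψ z ^ (1 / 2 : ℝ)) (g := fun z => ψ z ^ (1 / 2 : ℝ) * f z)
    (hψ.pow_const _).aemeasurable ((hψ.pow_const _).mul hf).aemeasurable
  have e : ∀ x : ℝ≥0∞, x ^ (1 / 2 : ℝ) * x ^ (1 / 2 : ℝ) = x := fun x => by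
    rw [← ENNReal.rpow_add_of_nonneg _ _ (by norm_num) (by norm_num)]; norm_num
  have e1 : ∀ z, ((fun z => ψ z ^ (1 / 2 : ℝ)) * fun z => ψ z ^ (1 / 2 : ℝ) * f z) z = ψ z * f z :=
    fun z => by simp only [Pi.mul_apply]; rw [← mul_assoc, e]
  have e2 : ∀ z, (ψ z ^ (1 / 2 : ℝ)) ^ (2 : ℝ) = ψ z := fun z => by
    rw [← ENNReal.rpow_mul]; norm_num
  have e3 : ∀ z, (ψ z ^ (1 / 2 : ℝ) * f z) ^ (2 : ℝ) = ψ z * f z ^ 2 := fun z => by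
    rw [ENNReal.mul_rpow_of_nonneg _ _ (by norm_num), e2, ENNReal.rpow_two]
  simp_rw [e1, e2, e3] at h
  calc (∫⁻ z, ψ z * f z) ^ 2 ≤ ((∫⁻ z, ψ z) ^ (1 / 2 : ℝ) *
        (∫⁻ z, ψ z * f z ^ 2) ^ (1 / 2 : ℝ)) ^ 2 := by gcongr
    _ = _ := by rw [mul_pow, sq, sq, e, e]

/-- Young's inequality `L¹ * L² ⊆ L²`, in the form of a Schur test. -/
lemma eLpNorm_le_of_convolution_bound {ψ : Cn n → ℝ≥0∞} (hψ : Measurable ψ) (f : L2 n)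
    {g : Cn n → ℂ} (hg : ∀ᵐ w, ‖g w‖ₑ ≤ ∫⁻ z, ψ (z - w) * ‖f z‖ₑ) :
    eLpNorm g 2 volume ≤ (∫⁻ z, ψ z) * eLpNorm f 2 volume := by
  have hf : Measurable fun z => ‖f z‖ₑ := (Lp.stronglyMeasurable f).measurable.enorm
  have hm : Measurable (Function.uncurry fun w z : Cn n => ψ (z - w) * ‖f z‖ₑ ^ 2) :=
    (hψ.comp (measurable_snd.sub measurable_fst)).mul ((hf.comp measurable_snd).pow_const 2)
  have hψw : ∀ w, ∫⁻ z, ψ (z - w) = ∫⁻ z, ψ z := fun w => lintegral_sub_right_eq_self ψ w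
  have key : ∫⁻ w, ‖g w‖ₑ ^ 2 ≤ (∫⁻ z, ψ z) ^ 2 * ∫⁻ z, ‖f z‖ₑ ^ 2 := calc
    ∫⁻ w, ‖g w‖ₑ ^ 2 ≤ ∫⁻ w, (∫⁻ z, ψ z) * ∫⁻ z, ψ (z - w) * ‖f z‖ₑ ^ 2 := by
        refine lintegral_mono_ae ?_
        filter_upwards [hg] with w hw
        calc ‖g w‖ₑ ^ 2 ≤ (∫⁻ z, ψ (z - w) * ‖f z‖ₑ) ^ 2 := by gcongr
          _ ≤ _ := by
            rw [← hψw w]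
            exact lintegral_mul_sq_le (hψ.comp (measurable_id.sub_const w)) hf
    _ = (∫⁻ z, ψ z) * ∫⁻ z, ∫⁻ w, ψ (z - w) * ‖f z‖ₑ ^ 2 := by
        rw [lintegral_const_mul (∫⁻ z, ψ z) (f := fun w => ∫⁻ z, ψ (z - w) * ‖f z‖ₑ ^ 2)
          hm.lintegral_prod_right', lintegral_lintegral_swap hm.aemeasurable]
    _ = (∫⁻ z, ψ z) * ∫⁻ z, (∫⁻ w, ψ w) * ‖f z‖ₑ ^ 2 := by
        congr 1
        -- After Tonelli, the inner integral over w is computed by invariance under reflection and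
        -- translation.
        refine lintegral_congr fun z => ?_
        rw [lintegral_mul_const _ (f := fun w => ψ (z - w)) (hψ.comp (measurable_id.const_sub z)),
          lintegral_sub_left_eq_self ψ z]
    _ = (∫⁻ z, ψ z) ^ 2 * ∫⁻ z, ‖f z‖ₑ ^ 2 := by
        rw [lintegral_const_mul _ (hf.pow_const 2), ← mul_assoc, sq]
  rw [eLpNorm_two_eq, eLpNorm_two_eq]
  calc (∫⁻ w, ‖g w‖ₑ ^ 2) ^ (1 / 2 : ℝ)
      ≤ ((∫⁻ z, ψ z) ^ 2 * ∫⁻ z, ‖f z‖ₑ ^ 2) ^ (1 / 2 : ℝ) := by gcongr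
    _ = _ := by
      rw [ENNReal.mul_rpow_of_nonneg _ _ (by norm_num), ← ENNReal.rpow_natCast, ← ENNReal.rpow_mul]
      norm_num

lemma inner_magneticTranslation (K F : L2 n) (w : Cn n) :
    inner ℂ (magneticTranslation w K) F =
      ∫ z, F z * (starRingEnd ℂ) (phase w z * K (z - w)) := by
  rw [L2.inner_def]
  refine integral_congr_ae ?_
  filter_upwards [coeFn_magneticTranslation w K] with z hz
  rw [hz]; rfl

lemma stronglyMeasurable_inner_magneticTranslation (K F : L2 n) :
    StronglyMeasurable fun w => inner ℂ (magneticTranslation w K) F := by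
  simp_rw [inner_magneticTranslation]
  have hK := (Lp.stronglyMeasurable K).comp_measurable
    (measurable_snd.sub measurable_fst : Measurable fun p : Cn n × Cn n => p.2 - p.1)
  have hF := (Lp.stronglyMeasurable F).comp_measurable
    (measurable_snd : Measurable fun p : Cn n × Cn n => p.2)
  have hm : StronglyMeasurable (Function.uncurry fun w z : Cn n =>
      F z * (starRingEnd ℂ) (phase w z * K (z - w))) :=
    hF.mul (Complex.continuous_conj.comp_stronglyMeasurable
      (continuous_phase.stronglyMeasurable.mul hK))
  exact hm.integral_prod_right

lemma enorm_inner_magneticTranslation_le (K F : L2 n) (w : Cn n) :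
    ‖inner ℂ (magneticTranslation w K) F‖ₑ ≤ ∫⁻ z, ‖K (z - w)‖ₑ * ‖F z‖ₑ := by
  rw [inner_magneticTranslation]
  refine (enorm_integral_le_lintegral_enorm _).trans (lintegral_mono fun z => ?_)
  rw [enorm_mul, mul_comm]
  gcongr
  rw [RCLike.enorm_conj, enorm_mul, ← ofReal_norm, norm_phase, ENNReal.ofReal_one, one_mul]

lemma eLpNorm_inner_magneticTranslation_le (K F : L2 n) :
    eLpNorm (fun w => inner ℂ (magneticTranslation w K) F) 2 volume ≤
      (∫⁻ z, ‖K z‖ₑ) * eLpNorm F 2 volume :=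
  eLpNorm_le_of_convolution_bound (Lp.stronglyMeasurable K).measurable.enorm F
    (Eventually.of_forall fun w => enorm_inner_magneticTranslation_le K F w)

end Schur

/-! ### The reproducing kernel of a Landau level -/

section Reproducing

variable {n : ℕ}

/-- The parameter `s` for which the generating function is a Gaussian of width `1 / c`. -/
def concParam (c : ℝ) : ℝ := (4 * c ^ 2 - 1) / (4 * c ^ 2 + 1)

lemma concParam_mem_ball {c : ℝ} (hc : 1 ≤ c) : (concParam c : ℂ) ∈ Metric.ball (0 : ℂ) 1 := by
  rw [mem_ball_zero_iff, Complex.norm_real, concParam, Real.norm_of_nonneg]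
  · rw [div_lt_one (by positivity)]; linarith
  · exact div_nonneg (by nlinarith) (by positivity)

lemma one_sub_concParam (c : ℝ) : 1 - concParam c = 2 / (4 * c ^ 2 + 1) := by
  rw [concParam]
  have : 4 * c ^ 2 + 1 ≠ 0 := by positivity
  field_simp
  ring

lemma genParam_concParam (c : ℝ) : genParam (concParam c) = (c ^ 2 : ℝ) := by
  have h : genParam (concParam c) = ((1 + concParam c) / (4 * (1 - concParam c)) : ℝ) := by
    rw [genParam]; push_cast; rfl
  rw [h]
  congr 1
  rw [one_sub_concParam, concParam]
  have : 4 * c ^ 2 + 1 ≠ 0 := by positivity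
  field_simp
  ring

lemma tendsto_concParam : Tendsto concParam atTop (𝓝 1) := by
  have h : concParam = fun c => 1 - 2 / (4 * c ^ 2 + 1) := by
    funext c; rw [← one_sub_concParam]; ring
  rw [h]
  have h1 : Tendsto (fun c : ℝ => 4 * c ^ 2 + 1) atTop atTop :=
    tendsto_atTop_add_const_right _ _
      ((tendsto_pow_atTop (by norm_num)).const_mul_atTop (by norm_num))
  simpa using (h1.const_div_atTop 2).const_sub 1

/-- The normalised Gaussian on `ℂⁿ`. -/
def stdGauss (n : ℕ) (z : Cn n) : ℝ := (Real.pi ^ n)⁻¹ * Real.exp (-‖z‖ ^ 2)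

lemma integral_exp_neg_sq : ∫ z : Cn n, Real.exp (-‖z‖ ^ 2) = Real.pi ^ n := by
  have h := GaussianFourier.integral_rexp_neg_mul_sq_norm (V := Cn n) one_pos
  rw [finrank_Cn] at h
  simpa using h

lemma integral_stdGauss : ∫ z, stdGauss n z = 1 := by
  simp_rw [stdGauss]
  rw [integral_const_mul, integral_exp_neg_sq, inv_mul_cancel₀ (by positivity)]

lemma stdGauss_nonneg (z : Cn n) : 0 ≤ stdGauss n z := by
  unfold stdGauss; positivity

/-- This is the decay condition, of order the real dimension, in the approximate-identity theorem
used by `tendsto_inner_approxId`. -/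
lemma tendsto_pow_mul_stdGauss :
    Tendsto (fun z : Cn n => ‖z‖ ^ Module.finrank ℝ (Cn n) * stdGauss n z)
    (Bornology.cobounded (Cn n)) (𝓝 0) := by
  have h1 : Tendsto (fun z : Cn n => ‖z‖ ^ 2) (Bornology.cobounded (Cn n)) atTop :=
    (tendsto_pow_atTop (by norm_num)).comp tendsto_norm_cobounded_atTop
  have h2 := ((Real.tendsto_pow_mul_exp_neg_atTop_nhds_zero n).comp h1).const_mul ((Real.pi ^ n)⁻¹)
  rw [mul_zero] at h2
  refine h2.congr fun z => ?_
  rw [finrank_Cn, stdGauss, pow_mul]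
  simp only [Function.comp_apply]
  ring

/-- Here (2π(1 - s))⁻ⁿ equals (c²/π)ⁿ(1 + 1/(4c²))ⁿ: the normalisation of a Gaussian of width 1/c,
up to a factor that tends to 1. -/
lemma coeFn_genFun_concParam {c : ℝ} (hc : 1 ≤ c) :
    (((2 * Real.pi) ^ n : ℝ)⁻¹ : ℂ) • genFun n (concParam c) =ᵐ[volume]
      fun z => (((1 + 1 / (4 * c ^ 2)) ^ n * (c ^ (2 * n) * stdGauss n (c • z)) : ℝ) : ℂ) := by
  have hpos : 0 < (genParam (concParam c)).re := genParam_re_pos (concParam_mem_ball hc)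
  have hc0 : 0 < c := by linarith
  filter_upwards [Lp.coeFn_smul (((2 * Real.pi) ^ n : ℝ)⁻¹ : ℂ) (genFun n (concParam c)),
    Lp.coeFn_smul (((1 - (concParam c : ℂ)) ^ n)⁻¹) (gaussLp n 0 (genParam (concParam c))),
    coeFn_gaussLp (n := n) 0 hpos] with z h1 h2 h3
  rw [h1, Pi.smul_apply]
  change _ • (((1 - (concParam c : ℂ)) ^ n)⁻¹ • gaussLp n 0 (genParam (concParam c))) z = _
  rw [h2, Pi.smul_apply, h3, genParam_concParam]
  have e1 : (1 - (concParam c : ℂ)) = ((2 / (4 * c ^ 2 + 1) : ℝ) : ℂ) := by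
    rw [← one_sub_concParam]; push_cast; rfl
  have e2 : gauss n 0 ((c ^ 2 : ℝ) : ℂ) z = ((Real.exp (-‖c • z‖ ^ 2) : ℝ) : ℂ) := by
    rw [gauss, norm_smul, mul_pow, Real.norm_of_nonneg hc0.le]
    push_cast
    simp
  rw [e1, e2, stdGauss, smul_eq_mul, smul_eq_mul]
  norm_cast
  rw [← mul_assoc, ← mul_assoc, ← mul_assoc]
  congr 1
  rw [pow_mul, ← inv_pow, ← inv_pow, ← inv_pow, ← mul_pow, ← mul_pow, ← mul_pow]
  congr 1
  have := Real.pi_pos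
  field_simp
  ring

/-- The approximate identity given by the generating function. -/
def approxId (n : ℕ) (c : ℝ) : L2 n := (((2 * Real.pi) ^ n : ℝ)⁻¹ : ℂ) • genFun n (concParam c)

lemma one_add_pow_le {c : ℝ} (hc : 1 ≤ c) : (1 + 1 / (4 * c ^ 2)) ^ n ≤ (2 : ℝ) ^ n := by
  have : 1 / (4 * c ^ 2) ≤ 1 := by
    rw [div_le_one (by positivity)]; nlinarith
  gcongr
  linarith

/-- Uniformity in c is the point: through the Schur bound it makes pairing with `approxId` uniformly
bounded on L². -/
lemma lintegral_approxId_le {c : ℝ} (hc : 1 ≤ c) :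
    ∫⁻ z, ‖approxId n c z‖ₑ ≤ ENNReal.ofReal (2 ^ n) := by
  have hc0 : 0 < c := by linarith
  have hint : Integrable fun z : Cn n => c ^ (2 * n) * stdGauss n (c • z) := by
    have h : Integrable (stdGauss n) := by
      have := (integrable_exp_neg_mul_sq (n := n) one_pos).const_mul ((Real.pi ^ n)⁻¹)
      simp only [neg_mul, one_mul] at this
      exact this
    exact (h.comp_smul hc0.ne').const_mul _
  have hi : ∫ z : Cn n, c ^ (2 * n) * stdGauss n (c • z) = 1 := by
    rw [integral_const_mul, Measure.integral_comp_smul, integral_stdGauss, finrank_Cn, smul_eq_mul,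
      mul_one, abs_of_nonneg (by positivity), mul_inv_cancel₀ (by positivity)]
  calc ∫⁻ z, ‖approxId n c z‖ₑ
      = ∫⁻ z, ENNReal.ofReal ((1 + 1 / (4 * c ^ 2)) ^ n * (c ^ (2 * n) * stdGauss n (c • z))) := by
        refine lintegral_congr_ae ?_
        filter_upwards [coeFn_genFun_concParam (n := n) hc] with z hz
        rw [approxId, hz, ← ofReal_norm, Complex.norm_real, Real.norm_of_nonneg]
        have := stdGauss_nonneg (c • z)
        positivity
    _ = ENNReal.ofReal
        (∫ z : Cn n, (1 + 1 / (4 * c ^ 2)) ^ n * (c ^ (2 * n) * stdGauss n (c • z))) := by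
        refine (ofReal_integral_eq_lintegral_ofReal (hint.const_mul _)
          (Eventually.of_forall fun z => ?_)).symm
        have := stdGauss_nonneg (c • z)
        simp only [Pi.zero_apply]
        positivity
    _ ≤ _ := by
        rw [integral_const_mul, hi, mul_one]
        exact ENNReal.ofReal_le_ofReal (one_add_pow_le hc)

/-- Recentring at w turns the pairing into an integral against a concentrating Gaussian. The phase
is continuous and equals 1 at the centre, so it does not affect the limit. -/
lemma tendsto_inner_approxId {g : Cn n → ℂ} (hg : Continuous g) (hgc : HasCompactSupport g)
    {F : L2 n} (hF : F =ᵐ[volume] g) (w : Cn n) :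
    Tendsto (fun c => inner ℂ (magneticTranslation w (approxId n c)) F) atTop (𝓝 (g w)) := by
  let G : Cn n → ℂ := fun x => g (w + x) * (starRingEnd ℂ) (phase w (w + x))
  have hGc : Continuous G :=
    (hg.comp (continuous_const_add w)).mul (Complex.continuous_conj.comp
      ((continuous_phase_right w).comp (continuous_const_add w)))
  have hGs : HasCompactSupport G :=
    HasCompactSupport.mul_right (hgc.comp_homeomorph (Homeomorph.addLeft w))
  have hG : Integrable G := hGc.integrable_of_hasCompactSupport hGs
  have h1 := tendsto_integral_comp_smul_smul_of_integrable (μ := (volume : Measure (Cn n)))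
    (fun z => stdGauss_nonneg z) integral_stdGauss tendsto_pow_mul_stdGauss hG hGc.continuousAt
  have h2 : Tendsto (fun c : ℝ => (((1 + 1 / (4 * c ^ 2)) ^ n : ℝ) : ℂ)) atTop (𝓝 1) := by
    have h3 : Tendsto (fun c : ℝ => 4 * c ^ 2) atTop atTop :=
      (tendsto_pow_atTop (by norm_num)).const_mul_atTop (by norm_num)
    have h4 := (((h3.const_div_atTop 1).const_add 1).pow n)
    rw [add_zero, one_pow] at h4
    have := (Complex.continuous_ofReal.tendsto 1).comp h4
    simpa [Function.comp_def] using this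
  have h5 := h2.mul h1
  rw [one_mul] at h5
  have hG0 : G 0 = g w := by simp [G]
  rw [hG0] at h5
  refine h5.congr' ?_
  filter_upwards [eventually_ge_atTop 1] with c hc
  rw [inner_magneticTranslation, ← integral_const_mul,
    ← integral_add_left_eq_self (fun z => F z * _) w]
  refine integral_congr_ae ?_
  have hF' : ∀ᵐ x, F (w + x) = g (w + x) :=
    (measurePreserving_add_left (volume : Measure (Cn n)) w).quasiMeasurePreserving.ae hF
  filter_upwards [hF', coeFn_genFun_concParam (n := n) hc] with x h6 h7
  rw [h6, add_sub_cancel_left, approxId, h7, map_mul, Complex.conj_ofReal, finrank_Cn]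
  simp only [G, Complex.real_smul]
  push_cast
  ring

/-- Translates of `radial n k` stay in level k, so orthogonality leaves a single term of the
expansion of the generating function. -/
lemma inner_approxId_of_mem_level {ℓ : ℕ} {f : L2 n} (hf : f ∈ level n ℓ) {c : ℝ} (hc : 1 ≤ c)
    (w : Cn n) : inner ℂ (magneticTranslation w (approxId n c)) f =
      (concParam c : ℂ) ^ ℓ *
        inner ℂ (magneticTranslation w ((((2 * Real.pi) ^ n : ℝ)⁻¹ : ℂ) • radial n ℓ)) f := by
  have h := (hasSum_genFun (n := n) (concParam_mem_ball hc)).mapL (magneticTranslation w)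
  have h1 := h.mapL (innerSL ℂ f)
  have h2 : HasSum
      (fun k => innerSL ℂ f (magneticTranslation w ((concParam c : ℂ) ^ k • radial n k)))
      (innerSL ℂ f (magneticTranslation w ((concParam c : ℂ) ^ ℓ • radial n ℓ))) := by
    refine hasSum_single ℓ fun k hk => ?_
    rw [map_smul, map_smul, innerSL_apply_apply,
      inner_level_eq_zero (Ne.symm hk) hf (magneticTranslation_mem_level w (radial_mem_level k)),
      smul_zero]
  have h3 := h1.unique h2
  rw [innerSL_apply_apply, innerSL_apply_apply] at h3
  -- The series was summed in the linear second slot; conjugation moves it to the first, and the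
  -- powers of the real parameter are unaffected.
  have h4 := congrArg (starRingEnd ℂ) h3
  rw [inner_conj_symm, inner_conj_symm] at h4
  rw [approxId, map_smul, map_smul, inner_smul_left, inner_smul_left, h4, map_smul, inner_smul_left,
    map_pow, Complex.conj_ofReal]
  ring

/-- The reproducing kernel of the `ℓ`-th Landau level, based at the origin. -/
def kernel (n ℓ : ℕ) : L2 n := (((2 * Real.pi) ^ n : ℝ)⁻¹ : ℂ) • radial n ℓ

lemma kernel_mem_level (ℓ : ℕ) : kernel n ℓ ∈ level n ℓ :=
  (level n ℓ).smul_mem _ (radial_mem_level ℓ)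

lemma kernel_ne_zero (hn : 1 ≤ n) (ℓ : ℕ) : kernel n ℓ ≠ 0 := by
  have : ((((2 * Real.pi) ^ n : ℝ)⁻¹ : ℂ)) ≠ 0 := by
    simp
  exact smul_ne_zero this (radial_ne_zero hn ℓ)

lemma integrable_kernel (ℓ : ℕ) : Integrable (kernel n ℓ) :=
  ((integrable_radial ℓ).smul (((2 * Real.pi) ^ n : ℝ)⁻¹ : ℂ)).congr (Lp.coeFn_smul _ _).symm

/-- The reproducing property of the Landau levels. -/
theorem ae_eq_inner_kernel {ℓ : ℕ} {f : L2 n} (hf : f ∈ level n ℓ) :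
    f =ᵐ[volume] fun w => inner ℂ (magneticTranslation w (kernel n ℓ)) f := by
  let k : Cn n → ℂ := fun w => inner ℂ (magneticTranslation w (kernel n ℓ)) f
  have hk : AEStronglyMeasurable k volume :=
    (stronglyMeasurable_inner_magneticTranslation _ _).aestronglyMeasurable
  -- Pointwise convergence is known only for continuous compactly supported g. Such a g approximates
  -- f, and the error f - g is controlled by the uniform Schur bound.
  have hle : ∀ ε : ℝ≥0∞, ε ≠ 0 → eLpNorm (k - ⇑f) 2 volume ≤ (ENNReal.ofReal (2 ^ n) + 1) * ε := by
    intro ε hε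
    obtain ⟨g, hgc, hfg, hg, hgm⟩ := (Lp.memLp f).exists_hasCompactSupport_eLpNorm_sub_le
      (by norm_num) hε
    let G : L2 n := hgm.toLp g
    have hG : G =ᵐ[volume] g := hgm.coeFn_toLp
    have hfG : eLpNorm (f - G : L2 n) 2 volume ≤ ε := by
      refine le_trans (le_of_eq (eLpNorm_congr_ae ?_)) hfg
      filter_upwards [Lp.coeFn_sub f G, hG] with z h1 h2
      rw [h1, Pi.sub_apply, Pi.sub_apply, h2]
    let c : ℕ → ℝ := fun j => j + 1
    have hc : ∀ j, 1 ≤ c j := fun j => by simp [c]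
    have hct : Tendsto c atTop atTop :=
      tendsto_atTop_add_const_right _ _ tendsto_natCast_atTop_atTop
    have h1 : eLpNorm (k - g) 2 volume ≤ ENNReal.ofReal (2 ^ n) * ε := by
      -- Fatou: the pairings with f - g converge pointwise to k - g, by the single-term formula for
      -- f and the approximate identity for g.
      refine (Lp.eLpNorm_lim_le_liminf_eLpNorm (f := fun j w =>
        inner ℂ (magneticTranslation w (approxId n (c j))) (f - G))
        (fun j => (stronglyMeasurable_inner_magneticTranslation _ _).aestronglyMeasurable)
        (k - g) (Eventually.of_forall fun w => ?_)).trans ?_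
      · simp_rw [inner_sub_right]
        refine Tendsto.sub ?_ ((tendsto_inner_approxId hg hgc hG w).comp hct)
        simp_rw [inner_approxId_of_mem_level hf (hc _) w]
        have h2 := (Complex.continuous_ofReal.tendsto 1).comp (tendsto_concParam.comp hct)
        have h3 := (h2.pow ℓ).mul_const (k w)
        rw [Complex.ofReal_one, one_pow, one_mul] at h3
        exact h3
      · refine liminf_le_of_le (by isBoundedDefault) fun b hb => ?_
        obtain ⟨j, hj⟩ := hb.exists
        refine hj.trans ((eLpNorm_inner_magneticTranslation_le _ _).trans ?_)
        gcongr
        exact lintegral_approxId_le (hc j)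
    have h2 : eLpNorm (g - ⇑f) 2 volume ≤ ε := by
      rwa [eLpNorm_sub_comm]
    calc eLpNorm (k - ⇑f) 2 volume = eLpNorm ((k - g) + (g - ⇑f)) 2 volume := by
          rw [sub_add_sub_cancel]
      _ ≤ eLpNorm (k - g) 2 volume + eLpNorm (g - ⇑f) 2 volume :=
          eLpNorm_add_le (hk.sub hg.aestronglyMeasurable)
            (hg.aestronglyMeasurable.sub (Lp.memLp f).1) (by norm_num)
      _ ≤ ENNReal.ofReal (2 ^ n) * ε + ε := by gcongr
      _ = _ := by rw [add_mul, one_mul]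
  have h0 : eLpNorm (k - ⇑f) 2 volume = 0 := by
    by_contra hne
    have hC : ENNReal.ofReal (2 ^ n) + 1 ≠ ⊤ := by finiteness
    have hC0 : ENNReal.ofReal (2 ^ n) + 1 ≠ 0 := by simp
    by_cases htop : eLpNorm (k - ⇑f) 2 volume = ⊤
    · have := hle 1 one_ne_zero
      rw [htop, mul_one] at this
      exact hC (top_le_iff.1 this)
    -- This ε turns the bound into ‖k - f‖ ≤ ‖k - f‖/2, impossible for a finite nonzero norm.
    · have hε : eLpNorm (k - ⇑f) 2 volume / (2 * (ENNReal.ofReal (2 ^ n) + 1)) ≠ 0 :=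
        ENNReal.div_ne_zero.2 ⟨hne, by finiteness⟩
      have h1 := hle _ hε
      have h2 : (ENNReal.ofReal (2 ^ n) + 1) *
          (eLpNorm (k - ⇑f) 2 volume / (2 * (ENNReal.ofReal (2 ^ n) + 1))) =
          eLpNorm (k - ⇑f) 2 volume / 2 := by
        rw [mul_comm (2 : ℝ≥0∞), ← mul_div_assoc, ENNReal.mul_div_mul_left _ _ hC0 hC]
      rw [h2] at h1
      exact absurd h1 (not_le.2 (ENNReal.half_lt_self hne htop))
  rw [eLpNorm_eq_zero_iff (hk.sub (Lp.memLp f).1) (by norm_num)] at h0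
  filter_upwards [h0] with z hz
  exact (sub_eq_zero.1 hz).symm

/-- The orthogonal projection onto a Landau level as an integral operator. -/
theorem starProjection_ae_eq (ℓ : ℕ) (F : L2 n) :
    (level n ℓ).starProjection F =ᵐ[volume]
      fun w => inner ℂ (magneticTranslation w (kernel n ℓ)) F := by
  filter_upwards [ae_eq_inner_kernel ((level n ℓ).starProjection_apply_mem F)] with w hw
  -- Self-adjointness moves the projection onto the translated kernel, which already lies in the
  -- level.
  rw [hw, ← Submodule.inner_starProjection_left_eq_right,
    Submodule.starProjection_eq_self_iff.2 (magneticTranslation_mem_level w (kernel_mem_level ℓ))]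

end Reproducing

/-! ### Compactness from localisation of the kernel -/

section Localization

variable {n : ℕ}

/-- A bounded sequence of functions in `L²(ℂⁿ)` that converges pointwise to `0` and has uniformly
small tails converges to `0` in norm. -/
lemma tendsto_zero_of_tail {u : ℕ → L2 n} {C : ℝ} (hb : ∀ j, ∀ᵐ w, ‖u j w‖ ≤ C)
    (hl : ∀ᵐ w, Tendsto (fun j => u j w) atTop (𝓝 0))
    (ht : ∀ ε : ℝ, 0 < ε → ∃ R, ∀ j,
      eLpNorm ((Metric.ball 0 R)ᶜ.indicator (u j)) 2 volume ≤ ENNReal.ofReal ε) :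
    Tendsto u atTop (𝓝 0) := by
  rw [Metric.tendsto_atTop]
  intro ε hε
  obtain ⟨R, hR⟩ := ht (ε / 2) (half_pos hε)
  have hm : MeasurableSet (Metric.ball (0 : Cn n) R) := measurableSet_ball
  let v : ℕ → L2 n := fun j => ((Lp.memLp (u j)).indicator hm).toLp _
  let t : ℕ → L2 n := fun j => ((Lp.memLp (u j)).indicator hm.compl).toLp _
  have hv : ∀ j, v j =ᵐ[volume] (Metric.ball 0 R).indicator (u j) := fun j => MemLp.coeFn_toLp _
  have huvt : ∀ j, u j = v j + t j := fun j => by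
    refine Lp.ext ?_
    filter_upwards [Lp.coeFn_add (v j) (t j), hv j,
      ((Lp.memLp (u j)).indicator hm.compl).coeFn_toLp] with w h1 h2 h3
    rw [h1, Pi.add_apply, h2, h3]
    exact (Set.indicator_self_add_compl_apply _ _ w).symm
  have htn : ∀ j, ‖t j‖ ≤ ε / 2 := fun j => by
    rw [Lp.norm_toLp]
    exact ENNReal.toReal_le_of_le_ofReal (half_pos hε).le (hR j)
  have hv0 : Tendsto v atTop (𝓝 0) := by
    refine tendsto_zero_of_dominated (G := (Metric.ball 0 R).indicator fun _ => C)
      (memLp_indicator_const 2 hm C (Or.inr measure_ball_lt_top.ne)) (fun j => ?_) ?_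
    · filter_upwards [hv j, hb j] with w h1 h2
      rw [h1, norm_indicator_eq_indicator_norm]
      exact Set.indicator_le_indicator h2
    · filter_upwards [ae_all_iff.2 hv, hl] with w h1 h2
      simp_rw [h1]
      by_cases hw : w ∈ Metric.ball (0 : Cn n) R
      · simpa [Set.indicator_of_mem hw] using h2
      · simp [Set.indicator_of_notMem hw]
  obtain ⟨N, hN⟩ := Metric.tendsto_atTop.1 hv0 (ε / 2) (half_pos hε)
  refine ⟨N, fun j hj => ?_⟩
  have h1 := hN j hj
  rw [dist_zero_right] at h1 ⊢
  rw [huvt j]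
  calc ‖v j + t j‖ ≤ ‖v j‖ + ‖t j‖ := norm_add_le _ _
    _ < ε := by linarith [htn j]

lemma norm_inner_magneticTranslation_le (K F : L2 n) (w : Cn n) :
    ‖inner ℂ (magneticTranslation w K) F‖ ≤ ‖K‖ * ‖F‖ := by
  rw [← norm_magneticTranslation w K]
  exact norm_inner_le_norm _ _

lemma eLpNorm_coeFn_le {C : ℝ} {f : L2 n} (hf : ‖f‖ ≤ C) :
    eLpNorm f 2 volume ≤ ENNReal.ofReal C := by
  rw [← ENNReal.ofReal_toReal (Lp.eLpNorm_ne_top f), ← Lp.norm_def]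
  exact ENNReal.ofReal_le_ofReal hf

/-- Multiplication by a function that vanishes at infinity is compact on Landau levels. -/
lemma WeaklyNull.tendsto_mulOp {ℓ : ℕ} {f : ℕ → L2 n} (hf : WeaklyNull f)
    (hfl : ∀ j, f j ∈ level n ℓ) {a : Cn n →ᵇ ℂ} (ha : Tendsto a (cocompact (Cn n)) (𝓝 0)) :
    Tendsto (fun j => mulOp a (f j)) atTop (𝓝 0) := by
  obtain ⟨⟨C, hC⟩, hw⟩ := hf
  have hC0 : 0 ≤ C := (norm_nonneg _).trans (hC 0)
  have hker := fun j => ae_eq_inner_kernel (hfl j)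
  refine tendsto_zero_of_tail (C := ‖a‖ * (‖kernel n ℓ‖ * C)) (fun j => ?_) ?_ fun ε hε => ?_
  · filter_upwards [coeFn_mulOp a (f j), hker j] with w h1 h2
    rw [h1, norm_mul]
    gcongr
    · exact a.norm_coe_le_norm w
    · rw [h2]
      exact (norm_inner_magneticTranslation_le _ _ _).trans (by gcongr; exact hC j)
  · filter_upwards [ae_all_iff.2 hker, ae_all_iff.2 fun j => coeFn_mulOp a (f j)] with w h1 h2
    simp_rw [h2, h1]
    simpa using (hw (magneticTranslation w (kernel n ℓ))).const_mul (a w)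
  -- Far out, |a| is below ε/(C + 1), so the tail of the product has norm at most ε; the 1 guards
  -- against C = 0.
  · have hδ : 0 < ε / (C + 1) := by positivity
    have h1 := (Metric.tendsto_nhds.1 ha) (ε / (C + 1)) hδ
    rw [Metric.cobounded_eq_cocompact.symm] at h1
    obtain ⟨R, hR⟩ := (Metric.hasBasis_cobounded_compl_ball (0 : Cn n)).eventually_iff.1 h1
    refine ⟨R, fun j => ?_⟩
    have hle : eLpNorm ((Metric.ball 0 R)ᶜ.indicator (mulOp a (f j))) 2 volume ≤
        ENNReal.ofReal (ε / (C + 1)) * eLpNorm (f j) 2 volume := by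
      refine eLpNorm_le_mul_eLpNorm_of_ae_le_mul ?_ 2
      filter_upwards [coeFn_mulOp a (f j)] with w h2
      by_cases hw : w ∈ (Metric.ball (0 : Cn n) R)ᶜ
      · rw [Set.indicator_of_mem hw, h2, norm_mul]
        have := hR.2 hw
        rw [dist_zero_right] at this
        gcongr
      · rw [Set.indicator_of_notMem hw, norm_zero]
        positivity
    refine hle.trans ?_
    calc ENNReal.ofReal (ε / (C + 1)) * eLpNorm (f j) 2 volume
        ≤ ENNReal.ofReal (ε / (C + 1)) * ENNReal.ofReal C := by
          gcongr; exact eLpNorm_coeFn_le (hC j)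
      _ = ENNReal.ofReal (ε / (C + 1) * C) := (ENNReal.ofReal_mul hδ.le).symm
      _ ≤ ENNReal.ofReal ε := by
          refine ENNReal.ofReal_le_ofReal ?_
          rw [div_mul_eq_mul_div, div_le_iff₀ (by positivity)]
          nlinarith

/-- The oscillation of `b` over balls of fixed radius vanishes at infinity. -/
def SlowlyVarying (b : Cn n → ℂ) : Prop :=
  ∀ ε > 0, ∀ M : ℝ, ∃ R, ∀ w h : Cn n, R ≤ ‖w‖ → ‖h‖ ≤ M → ‖b (w + h) - b w‖ ≤ ε

lemma exists_lintegral_tail_le {K : Cn n → ℂ} (hK : Integrable K) {ε : ℝ} (hε : 0 < ε) :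
    ∃ M : ℝ, ∫⁻ z in (Metric.closedBall 0 M)ᶜ, ‖K z‖ₑ ≤ ENNReal.ofReal ε := by
  have hmono : Antitone fun k : ℕ => (Metric.closedBall (0 : Cn n) k)ᶜ := fun i j hij =>
    Set.compl_subset_compl.2 (Metric.closedBall_subset_closedBall (by exact_mod_cast hij))
  have h := tendsto_setIntegral_of_antitone
    (fun k : ℕ => (measurableSet_closedBall (x := (0 : Cn n)) (ε := (k : ℝ))).compl) hmono
    ⟨0, hK.norm.integrableOn⟩
  have hempty : ⋂ k : ℕ, (Metric.closedBall (0 : Cn n) k)ᶜ = ∅ := by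
    rw [← Set.compl_iUnion, Metric.iUnion_closedBall_nat, Set.compl_univ]
  rw [hempty, setIntegral_empty] at h
  obtain ⟨k, hk⟩ := (h.eventually_lt_const hε).exists
  refine ⟨k, ?_⟩
  rw [← ofReal_integral_norm_eq_lintegral_enorm hK.integrableOn]
  exact ENNReal.ofReal_le_ofReal hk.le

lemma integrable_inner_magneticTranslation (w : Cn n) (K F : L2 n) :
    Integrable fun z => F z * (starRingEnd ℂ) (phase w z * K (z - w)) := by
  refine (L2.integrable_inner (𝕜 := ℂ) (magneticTranslation w K) F).congr ?_
  filter_upwards [coeFn_magneticTranslation w K] with z hz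
  rw [hz, RCLike.inner_apply]

/-- The Hankel operator of a slowly varying symbol is compact. -/
lemma WeaklyNull.tendsto_hankel {ℓ : ℕ} {f : ℕ → L2 n} (hf : WeaklyNull f)
    (hfl : ∀ j, f j ∈ level n ℓ) {b : Cn n →ᵇ ℂ} (hb : SlowlyVarying b) :
    Tendsto (fun j => mulOp b (f j) - (level n ℓ).starProjection (mulOp b (f j))) atTop (𝓝 0) := by
  have hbf := hf.map (mulOp b)
  obtain ⟨⟨C, hC⟩, hw⟩ := hf
  have hC0 : 0 ≤ C := (norm_nonneg _).trans (hC 0)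
  set κ := kernel n ℓ with hκ
  set D : ℕ → L2 n := fun j => mulOp b (f j) - (level n ℓ).starProjection (mulOp b (f j)) with hD
  -- Both terms are integrals against the same kernel, so their difference has the kernel multiplied
  -- by b(w) - b(z).
  have hDw : ∀ j, ∀ᵐ w, D j w = b w * inner ℂ (magneticTranslation w κ) (f j) -
      inner ℂ (magneticTranslation w κ) (mulOp b (f j)) := fun j => by
    filter_upwards [Lp.coeFn_sub (mulOp b (f j)) ((level n ℓ).starProjection (mulOp b (f j))),
      coeFn_mulOp b (f j), ae_eq_inner_kernel (hfl j), starProjection_ae_eq ℓ (mulOp b (f j))]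
      with w h1 h2 h3 h4
    rw [h1, Pi.sub_apply, h2, h4, ← h3]
  have hmul : ∀ j, ‖mulOp b (f j)‖ ≤ ‖mulOp b‖ * C := fun j => (mulOp b).le_opNorm_of_le (hC j)
  refine tendsto_zero_of_tail (C := ‖b‖ * (‖κ‖ * C) + ‖κ‖ * (‖mulOp b‖ * C)) (fun j => ?_) ?_
    fun ε hε => ?_
  · filter_upwards [hDw j] with w h1
    rw [h1]
    refine (norm_sub_le _ _).trans (add_le_add ?_ ?_)
    · rw [norm_mul]
      gcongr
      · exact b.norm_coe_le_norm w
      · exact (norm_inner_magneticTranslation_le _ _ _).trans (by gcongr; exact hC j)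
    · exact (norm_inner_magneticTranslation_le _ _ _).trans (by gcongr; exact hmul j)
  · filter_upwards [ae_all_iff.2 hDw] with w h1
    simp_rw [h1]
    simpa using ((hw (magneticTranslation w κ)).const_mul (b w)).sub
      (hbf.2 (magneticTranslation w κ))
  · let I : ℝ := ∫ z, ‖κ z‖
    have hI : 0 ≤ I := integral_nonneg fun _ => norm_nonneg _
    have hIl : ∫⁻ z, ‖κ z‖ₑ = ENNReal.ofReal I :=
      (ofReal_integral_norm_eq_lintegral_enorm (integrable_kernel ℓ)).symm
    -- Chosen so that the Schur bound δ(I + 2‖b‖)C is at most ε.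
    let δ : ℝ := ε / ((C + 1) * (I + 2 * ‖b‖ + 1))
    have hδ : 0 < δ := by positivity
    obtain ⟨M, hM⟩ := exists_lintegral_tail_le (integrable_kernel (n := n) ℓ) hδ
    obtain ⟨R, hR⟩ := hb δ hδ M
    -- A convolution majorant valid for |w| ≥ R: within distance M the oscillation of b is at most
    -- δ; beyond it, b contributes at most 2‖b‖ and the L¹ tail of the kernel is at most δ.
    let ψ : Cn n → ℝ≥0∞ := fun h => ENNReal.ofReal δ * ‖κ h‖ₑ +
      (Metric.closedBall 0 M)ᶜ.indicator (fun h => ENNReal.ofReal (2 * ‖b‖) * ‖κ h‖ₑ) h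
    have hκm : Measurable fun h => ‖κ h‖ₑ := (Lp.stronglyMeasurable κ).measurable.enorm
    have hcm : MeasurableSet (Metric.closedBall (0 : Cn n) M)ᶜ := measurableSet_closedBall.compl
    have hψ : Measurable ψ :=
      (hκm.const_mul _).add ((hκm.const_mul _).indicator hcm)
    have hψi : ∫⁻ z, ψ z ≤ ENNReal.ofReal (δ * (I + 2 * ‖b‖)) := by
      rw [lintegral_add_left (hκm.const_mul _), lintegral_const_mul _ hκm, lintegral_indicator hcm,
        lintegral_const_mul _ hκm, hIl, mul_add, ENNReal.ofReal_add (by positivity) (by positivity),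
        ENNReal.ofReal_mul hδ.le]
      refine add_le_add_right ?_ _
      refine (mul_le_mul_right hM _).trans (le_of_eq ?_)
      rw [← ENNReal.ofReal_mul (by positivity), mul_comm]
    refine ⟨R, fun j => ?_⟩
    have hle : eLpNorm ((Metric.ball 0 R)ᶜ.indicator (D j)) 2 volume ≤
        (∫⁻ z, ψ z) * eLpNorm (f j) 2 volume := by
      refine eLpNorm_le_of_convolution_bound hψ (f j) ?_
      filter_upwards [hDw j] with w h1
      by_cases hwR : w ∈ (Metric.ball (0 : Cn n) R)ᶜ
      swap
      · rw [Set.indicator_of_notMem hwR, enorm_zero]; exact zero_le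
      rw [Set.indicator_of_mem hwR, h1, inner_magneticTranslation, inner_magneticTranslation,
        ← integral_const_mul, ← integral_sub]
      rotate_left
      · exact (integrable_inner_magneticTranslation w κ (f j)).const_mul (b w)
      · exact integrable_inner_magneticTranslation w κ (mulOp b (f j))
      refine (enorm_integral_le_lintegral_enorm _).trans (lintegral_mono_ae ?_)
      filter_upwards [coeFn_mulOp b (f j)] with z hz
      have e1 : b w * (f j z * (starRingEnd ℂ) (phase w z * κ (z - w))) -
          mulOp b (f j) z * (starRingEnd ℂ) (phase w z * κ (z - w)) =
          -((b (w + (z - w)) - b w) * (starRingEnd ℂ) (phase w z * κ (z - w)) * f j z) := by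
        rw [hz, add_sub_cancel]; ring
      rw [e1, enorm_neg, enorm_mul, enorm_mul, RCLike.enorm_conj, enorm_mul,
        ← ofReal_norm (phase w z), norm_phase, ENNReal.ofReal_one, one_mul]
      gcongr
      have hRw : R ≤ ‖w‖ := by simpa using hwR
      by_cases hzM : z - w ∈ (Metric.closedBall (0 : Cn n) M)ᶜ
      · simp only [ψ]
        rw [Set.indicator_of_mem hzM]
        refine le_add_left ?_
        gcongr
        rw [← ofReal_norm]
        refine ENNReal.ofReal_le_ofReal ((norm_sub_le _ _).trans ?_)
        have := b.norm_coe_le_norm (w + (z - w))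
        have := b.norm_coe_le_norm w
        linarith
      · refine le_add_right ?_
        gcongr
        rw [← ofReal_norm]
        exact ENNReal.ofReal_le_ofReal (hR w (z - w) hRw (by simpa using hzM))
    refine hle.trans ?_
    calc (∫⁻ z, ψ z) * eLpNorm (f j) 2 volume
        ≤ ENNReal.ofReal (δ * (I + 2 * ‖b‖)) * ENNReal.ofReal C := by
          gcongr; exact eLpNorm_coeFn_le (hC j)
      _ = ENNReal.ofReal (δ * (I + 2 * ‖b‖) * C) := (ENNReal.ofReal_mul (by positivity)).symm
      _ ≤ ENNReal.ofReal ε := by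
          refine ENNReal.ofReal_le_ofReal ?_
          have hpos : 0 < (C + 1) * (I + 2 * ‖b‖ + 1) := by positivity
          have hb0 : 0 ≤ ‖b‖ := norm_nonneg b
          simp only [δ]
          rw [div_mul_eq_mul_div, div_mul_eq_mul_div, div_le_iff₀ hpos, mul_assoc]
          refine mul_le_mul_of_nonneg_left ?_ hε.le
          nlinarith

end Localization

/-! ### Magnetic translates moving to infinity -/

section CoherentStates

variable {n : ℕ}

lemma norm_sq_mulOp_magneticTranslation (m : Cn n →ᵇ ℂ) (K : L2 n) (w : Cn n) :
    ‖mulOp m (magneticTranslation w K)‖ ^ 2 = ∫ x, ‖m (w + x)‖ ^ 2 * ‖K x‖ ^ 2 := by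
  rw [norm_sq_eq_integral, ← integral_add_left_eq_self (fun z => ‖mulOp m _ z‖ ^ 2) w]
  refine integral_congr_ae ?_
  have h := (coeFn_mulOp m (magneticTranslation w K)).and (coeFn_magneticTranslation w K)
  filter_upwards [(measurePreserving_add_left (volume : Measure (Cn n)) w).quasiMeasurePreserving.ae
    h] with x hx
  rw [hx.1, hx.2, add_sub_cancel_left, norm_mul, norm_mul, norm_phase, one_mul, mul_pow]

/-- Recentring removes the phase and leaves the fixed integrable weight |K|², so dominated
convergence applies. -/
lemma tendsto_mulOp_magneticTranslation {m : Cn n →ᵇ ℂ} {w : ℕ → Cn n}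
    (h : ∀ x, Tendsto (fun j => m (w j + x)) atTop (𝓝 0)) (K : L2 n) :
    Tendsto (fun j => mulOp m (magneticTranslation (w j) K)) atTop (𝓝 0) := by
  have hK : Integrable fun x => ‖K x‖ ^ 2 := (Lp.memLp K).norm.integrable_sq
  have h1 : Tendsto (fun j => ∫ x, ‖m (w j + x)‖ ^ 2 * ‖K x‖ ^ 2) atTop
      (𝓝 (∫ _ : Cn n, (0 : ℝ))) := by
    refine tendsto_integral_of_dominated_convergence (fun x => ‖m‖ ^ 2 * ‖K x‖ ^ 2)
      (fun j => ?_) (hK.const_mul _) (fun j => Eventually.of_forall fun x => ?_)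
      (Eventually.of_forall fun x => ?_)
    · exact ((m.continuous.comp (continuous_const_add (w j))).norm.pow 2).aestronglyMeasurable.mul
        hK.1
    · rw [Real.norm_of_nonneg (by positivity)]
      gcongr
      exact m.norm_coe_le_norm _
    · simpa using ((h x).norm.pow 2).mul_const (‖K x‖ ^ 2)
  rw [integral_zero] at h1
  simp_rw [← norm_sq_mulOp_magneticTranslation] at h1
  rw [tendsto_zero_iff_norm_tendsto_zero]
  simpa [Real.sqrt_sq (norm_nonneg _)] using h1.sqrt

lemma inner_mulOp_left (m : Cn n →ᵇ ℂ) (f g : L2 n) :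
    inner ℂ (mulOp m f) g = inner ℂ f (mulOp (star m) g) := by
  rw [L2.inner_def, L2.inner_def]
  refine integral_congr_ae ?_
  filter_upwards [coeFn_mulOp m f, coeFn_mulOp (star m) g] with z h1 h2
  rw [h1, h2]
  simp [RCLike.inner_apply]
  ring

/-- The Gaussian `exp (-|z|²)` as a bounded continuous function. -/
def gaussBCF (n : ℕ) : Cn n →ᵇ ℂ :=
  BoundedContinuousFunction.ofNormedAddCommGroup (gauss n 0 1)
    (contDiff_gauss 0 1).continuous 1 fun z => by
      rw [norm_gauss]
      simp

lemma tendsto_norm_cobounded_of_add {w : ℕ → Cn n} (hw : Tendsto (fun j => ‖w j‖) atTop atTop)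
    (x : Cn n) : Tendsto (fun j => ‖w j + x‖) atTop atTop := by
  refine tendsto_atTop_mono (fun j => ?_) (tendsto_atTop_add_const_right _ (-‖x‖) hw)
  have := norm_sub_le (w j + x) x
  rw [add_sub_cancel_right] at this
  linarith

/-- Magnetic translates converge weakly to `0` at infinity. -/
lemma weaklyNull_magneticTranslation {w : ℕ → Cn n} (hw : Tendsto (fun j => ‖w j‖) atTop atTop)
    (K : L2 n) : WeaklyNull fun j => magneticTranslation (w j) K := by
  refine ⟨⟨‖K‖, fun j => (norm_magneticTranslation _ _).le⟩, fun y => ?_⟩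
  have h0 : Tendsto (fun j => mulOp (gaussBCF n) (magneticTranslation (w j) K)) atTop (𝓝 0) := by
    refine tendsto_mulOp_magneticTranslation (fun x => ?_) K
    have h1 := tendsto_norm_cobounded_of_add hw x
    rw [tendsto_zero_iff_norm_tendsto_zero]
    have h2 : Tendsto (fun r : ℝ => Real.exp (-r ^ 2)) atTop (𝓝 0) :=
      Real.tendsto_exp_atBot.comp (tendsto_neg_atTop_atBot.comp (tendsto_pow_atTop (by norm_num)))
    refine (h2.comp h1).congr fun j => ?_
    change _ = ‖gauss n 0 1 _‖
    rw [norm_gauss]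
    simp
  rw [Metric.tendsto_atTop]
  intro ε hε
  have hη : ENNReal.ofReal (ε / (2 * (‖K‖ + 1))) ≠ 0 := by
    rw [Ne, ENNReal.ofReal_eq_zero, not_le]; positivity
  -- Multiplication by a Gaussian sends the translates to 0 in norm. The Gaussian never vanishes, so
  -- a compactly supported g is its conjugate times some q in L²; vectors of this form approximate
  -- y.
  obtain ⟨g, hgc, hyg, hg, hgm⟩ := (Lp.memLp y).exists_hasCompactSupport_eLpNorm_sub_le
    (by norm_num) hη
  have hgq : MemLp (fun z => g z / (starRingEnd ℂ) (gauss n 0 1 z)) 2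
      (volume : Measure (Cn n)) := by
    have hne : ∀ z : Cn n, (starRingEnd ℂ) (gauss n 0 1 z) ≠ 0 := fun z => by
      rw [map_ne_zero]; simp [gauss]
    refine Continuous.memLp_of_hasCompactSupport (hg.div (Complex.continuous_conj.comp
      (contDiff_gauss 0 1).continuous) hne) ?_
    simp_rw [div_eq_mul_inv]
    exact hgc.mul_right
  let q : L2 n := hgq.toLp _
  have hyq : ‖y - mulOp (star (gaussBCF n)) q‖ ≤ ε / (2 * (‖K‖ + 1)) := by
    rw [Lp.norm_def]
    refine ENNReal.toReal_le_of_le_ofReal (by positivity) (le_trans (le_of_eq ?_) hyg)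
    refine eLpNorm_congr_ae ?_
    filter_upwards [Lp.coeFn_sub y (mulOp (star (gaussBCF n)) q), coeFn_mulOp (star (gaussBCF n)) q,
      hgq.coeFn_toLp] with z h1 h2 h3
    rw [h1, Pi.sub_apply, Pi.sub_apply, h2, h3]
    congr 1
    change (starRingEnd ℂ) (gauss n 0 1 z) * _ = _
    rw [mul_div_cancel₀]
    rw [map_ne_zero]; simp [gauss]
  have h3 : Tendsto (fun j => inner ℂ q (mulOp (gaussBCF n) (magneticTranslation (w j) K))) atTop
      (𝓝 0) := by
    simpa using (tendsto_const_nhds (x := q)).inner h0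
  obtain ⟨N, hN⟩ := Metric.tendsto_atTop.1 h3 (ε / 2) (half_pos hε)
  refine ⟨N, fun j hj => ?_⟩
  have h4 := hN j hj
  rw [dist_zero_right] at h4 ⊢
  have h5 : inner ℂ y (magneticTranslation (w j) K) =
      inner ℂ (y - mulOp (star (gaussBCF n)) q) (magneticTranslation (w j) K) +
        inner ℂ q (mulOp (gaussBCF n) (magneticTranslation (w j) K)) := by
    rw [inner_sub_left, inner_mulOp_left, star_star, sub_add_cancel]
  rw [h5]
  calc _ ≤ ‖y - mulOp (star (gaussBCF n)) q‖ * ‖magneticTranslation (w j) K‖ +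
        ‖inner ℂ q (mulOp (gaussBCF n) (magneticTranslation (w j) K))‖ :=
        (norm_add_le _ _).trans (by gcongr; exact norm_inner_le_norm _ _)
    _ < ε / (2 * (‖K‖ + 1)) * ‖K‖ + ε / 2 := by
        rw [norm_magneticTranslation]
        exact add_lt_add_of_le_of_lt (mul_le_mul_of_nonneg_right hyq (norm_nonneg _)) h4
    _ ≤ ε := by
        have : ε / (2 * (‖K‖ + 1)) * ‖K‖ ≤ ε / 2 := by
          rw [div_mul_eq_mul_div, div_le_div_iff₀ (by positivity) (by norm_num)]
          nlinarith [norm_nonneg K]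
        linarith

end CoherentStates

/-! ### Symbols with boundary values -/

section BoundaryValues

variable {n : ℕ}

/-- The radial projection of a nonzero vector to the unit sphere. -/
def direction (z : Cn n) (hz : z ≠ 0) : Sphere n :=
  ⟨‖z‖⁻¹ • z, by simp [norm_smul, hz]⟩

lemma norm_smul_direction {z : Cn n} (hz : z ≠ 0) : ‖z‖ • (direction z hz : Cn n) = z :=
  smul_inv_smul₀ (norm_ne_zero_iff.2 hz) z

lemma HasBoundaryValue.exists_norm_sub_le {a : Cn n →ᵇ ℂ} {g : C(Sphere n, ℂ)}
    (h : HasBoundaryValue a g) {ε : ℝ} (hε : 0 < ε) :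
    ∃ R : ℝ, ∀ (z : Cn n) (hz : z ≠ 0), R ≤ ‖z‖ → ‖a z - g (direction z hz)‖ ≤ ε := by
  obtain ⟨R, hR⟩ := eventually_atTop.1 (Metric.tendstoUniformly_iff.1 h ε hε)
  refine ⟨R, fun z hz hRz => ?_⟩
  have h1 := hR ‖z‖ hRz (direction z hz)
  rw [norm_smul_direction, dist_comm, dist_eq_norm] at h1
  exact h1.le

lemma HasBoundaryValue.tendsto_zero {a : Cn n →ᵇ ℂ} (h : HasBoundaryValue a 0) :
    Tendsto a (cocompact (Cn n)) (𝓝 0) := by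
  rw [← Metric.cobounded_eq_cocompact,
    (Metric.hasBasis_cobounded_compl_ball (0 : Cn n)).tendsto_iff Metric.nhds_basis_closedBall]
  intro ε hε
  obtain ⟨R, hR⟩ := h.exists_norm_sub_le hε
  refine ⟨max R 1, trivial, fun z hz => ?_⟩
  have hz' : max R 1 ≤ ‖z‖ := by simpa using hz
  have h0 : z ≠ 0 := norm_pos_iff.1 (one_pos.trans_le ((le_max_right _ _).trans hz'))
  simpa using hR z h0 ((le_max_left _ _).trans hz')

/-- With u the direction of w + h, one has ‖w‖(u - w/‖w‖) = (‖w‖ - ‖w + h‖)u + h, and the reverse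
triangle inequality bounds the scalar. -/
lemma norm_direction_sub_le {w h : Cn n} (hw : w ≠ 0) (hwh : w + h ≠ 0) :
    ‖(direction (w + h) hwh : Cn n) - direction w hw‖ ≤ 2 * ‖h‖ / ‖w‖ := by
  have hw0 : 0 < ‖w‖ := norm_pos_iff.2 hw
  have h1 : ‖w‖ • ((direction (w + h) hwh : Cn n) - direction w hw) =
      (‖w‖ - ‖w + h‖) • (direction (w + h) hwh : Cn n) + h := by
    rw [smul_sub, sub_smul, norm_smul_direction, norm_smul_direction]
    abel
  rw [le_div_iff₀ hw0, mul_comm, ← norm_smul_of_nonneg hw0.le, h1]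
  have h2 : |‖w‖ - ‖w + h‖| ≤ ‖h‖ := by
    simpa using abs_norm_sub_norm_le w (w + h)
  calc _ ≤ ‖(‖w‖ - ‖w + h‖) • (direction (w + h) hwh : Cn n)‖ + ‖h‖ := norm_add_le _ _
    _ = |‖w‖ - ‖w + h‖| + ‖h‖ := by
      rw [norm_smul, norm_eq_of_mem_sphere, mul_one, Real.norm_eq_abs]
    _ ≤ 2 * ‖h‖ := by linarith

/-- Far out, a(z) is close to g at the direction of z. A bounded displacement changes that direction
by O(1/|z|), and g is uniformly continuous on the compact sphere. -/
lemma HasBoundaryValue.slowlyVarying {a : Cn n →ᵇ ℂ} {g : C(Sphere n, ℂ)}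
    (h : HasBoundaryValue a g) : SlowlyVarying a := by
  intro ε hε M
  obtain ⟨R, hR⟩ := h.exists_norm_sub_le (ε := ε / 3) (by positivity)
  obtain ⟨δ, hδ, hg⟩ := Metric.uniformContinuous_iff.1
    (CompactSpace.uniformContinuous_of_continuous g.continuous) (ε / 3) (by positivity)
  -- The terms ensure in turn that w and w + x lie beyond R, that both are nonzero, and that their
  -- directions are δ-close.
  refine ⟨max R 0 + |M| + 1 + 2 * |M| / δ, fun w x hw hx => ?_⟩
  have hxM : ‖x‖ ≤ |M| := hx.trans (le_abs_self M)
  have hM : 0 ≤ 2 * |M| / δ := by positivity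
  have hR0 := le_max_right R 0
  have hRR := le_max_left R 0
  have hwx : ‖w‖ - ‖x‖ ≤ ‖w + x‖ := by
    have := norm_sub_le (w + x) x
    rw [add_sub_cancel_right] at this
    linarith
  have hM0 := abs_nonneg M
  have hw0 : w ≠ 0 := norm_pos_iff.1 (by linarith)
  have hwx0 : w + x ≠ 0 := norm_pos_iff.1 (by linarith)
  have h1 := hR w hw0 (by linarith)
  have h2 := hR (w + x) hwx0 (by linarith)
  have h3 : dist (direction (w + x) hwx0) (direction w hw0) < δ := by
    rw [Subtype.dist_eq, dist_eq_norm]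
    refine (norm_direction_sub_le hw0 hwx0).trans_lt ?_
    rw [div_lt_iff₀ (norm_pos_iff.2 hw0)]
    have : 2 * |M| / δ < ‖w‖ := by linarith
    rw [div_lt_iff₀ hδ] at this
    linarith
  have h4 := hg h3
  rw [dist_eq_norm] at h4
  have e : a (w + x) - a w = (a (w + x) - g (direction (w + x) hwx0)) +
      (g (direction (w + x) hwx0) - g (direction w hw0)) - (a w - g (direction w hw0)) := by ring
  rw [e]
  refine (norm_sub_le _ _).trans ?_
  have := norm_add_le (a (w + x) - g (direction (w + x) hwx0))
    (g (direction (w + x) hwx0) - g (direction w hw0))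
  linarith

lemma HasBoundaryValue.tendsto_ray {a : Cn n →ᵇ ℂ} {g : C(Sphere n, ℂ)}
    (h : HasBoundaryValue a g) (v : Sphere n) (x : Cn n) :
    Tendsto (fun j : ℕ => a ((j : ℝ) • (v : Cn n) + x)) atTop (𝓝 (g v)) := by
  have h1 : Tendsto (fun j : ℕ => a ((j : ℝ) • (v : Cn n))) atTop (𝓝 (g v)) :=
    (TendstoUniformly.tendsto_at h v).comp tendsto_natCast_atTop_atTop
  have h2 : Tendsto (fun j : ℕ => a ((j : ℝ) • (v : Cn n) + x) - a ((j : ℝ) • (v : Cn n))) atTop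
      (𝓝 0) := by
    rw [Metric.nhds_basis_closedBall.tendsto_right_iff]
    intro ε hε
    obtain ⟨R, hR⟩ := h.slowlyVarying ε hε ‖x‖
    filter_upwards [tendsto_natCast_atTop_atTop.eventually_ge_atTop R] with j hj
    rw [mem_closedBall_zero_iff]
    refine hR _ _ ?_ le_rfl
    rwa [norm_smul, norm_eq_of_mem_sphere, mul_one, Real.norm_natCast]
  simpa using h2.add h1

/-- Every continuous function on the sphere is a boundary value. -/
lemma boundaryMap_surjective : Function.Surjective (boundaryMap n) := by
  intro g
  -- Tietze extends g to all of ℂⁿ. Composing with the retraction z ↦ z/max(|z|, 1) onto the unit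
  -- ball makes the extension bounded and equal to g along rays from radius 1 on.
  obtain ⟨G, hG⟩ := g.exists_restrict_eq Metric.isClosed_sphere
  have hG' : ∀ v : Sphere n, G v = g v := fun v => congrArg (fun k : C(Sphere n, ℂ) => k v) hG
  obtain ⟨C, hC⟩ := (isCompact_closedBall (0 : Cn n) 1).exists_bound_of_continuousOn
    G.continuous.continuousOn
  have hpos : ∀ z : Cn n, 0 < max ‖z‖ 1 := fun z => one_pos.trans_le (le_max_right _ _)
  let a : Cn n →ᵇ ℂ := BoundedContinuousFunction.ofNormedAddCommGroup
    (fun z => G ((max ‖z‖ 1)⁻¹ • z))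
    (G.continuous.comp (((continuous_norm.max continuous_const).inv₀
      fun z => (hpos z).ne').smul continuous_id)) C fun z => hC _ <| by
        rw [mem_closedBall_zero_iff, norm_smul, norm_inv, Real.norm_of_nonneg (hpos z).le,
          inv_mul_le_iff₀ (hpos z), mul_one]
        exact le_max_left _ _
  have ha : HasBoundaryValue a g := by
    refine Metric.tendstoUniformly_iff.2 fun ε hε => ?_
    filter_upwards [eventually_ge_atTop 1] with r hr v
    have hr0 : 0 < r := one_pos.trans_le hr
    have hav : a (r • (v : Cn n)) = g v := by
      change G ((max ‖r • (v : Cn n)‖ 1)⁻¹ • r • (v : Cn n)) = g v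
      rw [norm_smul, norm_eq_of_mem_sphere, mul_one, Real.norm_of_nonneg hr0.le, max_eq_left hr,
        inv_smul_smul₀ hr0.ne', hG']
    rwa [hav, dist_self]
  exact ⟨⟨a, g, ha⟩, (hasBoundaryValue_boundaryMap _).unique ha⟩

end BoundaryValues

/-! ### Compactness and Fredholmness on finite Hilbert sums -/

section HilbertSum

variable {E : Type*} [NormedAddCommGroup E] [InnerProductSpace ℂ E] [CompleteSpace E] {N : ℕ}

/-- Compactness on a Hilbert sum can be tested on entrywise weakly null sequences. -/
lemma isCompactOperator_piLp [TopologicalSpace.SeparableSpace E]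
    {T : PiLp 2 (fun _ : Fin N => E) →L[ℂ] PiLp 2 (fun _ : Fin N => E)}
    (hT : ∀ X : ℕ → PiLp 2 (fun _ : Fin N => E), (∀ k, WeaklyNull fun j => X j k) →
      ∀ i, Tendsto (fun j => T (X j) i) atTop (𝓝 0)) : IsCompactOperator T := by
  refine isCompactOperator_of_weaklyNull fun X hX => ?_
  refine ((PiLp.continuous_toLp 2 fun _ : Fin N => E).tendsto 0).comp (tendsto_pi_nhds.2 ?_)
  exact hT X fun k => hX.map (PiLp.proj 2 (fun _ : Fin N => E) k :
    PiLp 2 (fun _ : Fin N => E) →L[ℂ] E)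

/-- A weakly null sequence of nonzero vectors `c ⊗ xⱼ` of constant norm with `T (c ⊗ xⱼ) → 0`
prevents `T` from being Fredholm. -/
lemma not_isFredholm_piLp {T : PiLp 2 (fun _ : Fin N => E) →L[ℂ] PiLp 2 (fun _ : Fin N => E)}
    {x : ℕ → E} {r : ℝ} (hr : 0 < r) (hx : WeaklyNull x) (hxr : ∀ j, ‖x j‖ = r) {c : Fin N → ℂ}
    (hc : c ≠ 0) (hT : ∀ i, Tendsto (fun j => T (WithLp.toLp 2 fun i => c i • x j) i) atTop (𝓝 0)) :
    ¬ T.IsFredholm := by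
  intro hF
  obtain ⟨i₀, hi₀⟩ := Function.ne_iff.1 hc
  let L : E →L[ℂ] PiLp 2 (fun _ : Fin N => E) :=
    (PiLp.continuousLinearEquiv 2 ℂ (fun _ : Fin N => E)).symm.toContinuousLinearMap ∘L
      ContinuousLinearMap.pi fun i => c i • ContinuousLinearMap.id ℂ E
  have hlim : Tendsto (fun j => T (L (x j))) atTop (𝓝 0) :=
    ((PiLp.continuous_toLp 2 fun _ : Fin N => E).tendsto 0).comp (tendsto_pi_nhds.2 hT)
  have h3 := (hx.map L).tendsto_of_isFredholm hF hlim
  have h4 := (((PiLp.proj 2 (fun _ : Fin N => E) i₀ :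
    PiLp 2 (fun _ : Fin N => E) →L[ℂ] E).continuous.tendsto 0).comp h3).norm
  have h5 : ∀ j, ‖(PiLp.proj 2 (fun _ : Fin N => E) i₀ :
      PiLp 2 (fun _ : Fin N => E) →L[ℂ] E) (L (x j))‖ = ‖c i₀‖ * r := fun j => by
    rw [← hxr j, ← norm_smul]
    rfl
  simp only [Function.comp_apply, h5, map_zero, norm_zero] at h4
  have h6 := tendsto_nhds_unique h4 tendsto_const_nhds
  exact (mul_pos (norm_pos_iff.2 hi₀) hr).ne h6

lemma isFredholm_piLp {T S : PiLp 2 (fun _ : Fin N => E) →L[ℂ] PiLp 2 (fun _ : Fin N => E)}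
    (h₁ : IsCompactOperator
      (S ∘L T - 1 : PiLp 2 (fun _ : Fin N => E) →L[ℂ] PiLp 2 (fun _ : Fin N => E)))
    (h₂ : IsCompactOperator
      (T ∘L S - 1 : PiLp 2 (fun _ : Fin N => E) →L[ℂ] PiLp 2 (fun _ : Fin N => E))) :
    T.IsFredholm :=
  isFredholm_of_isCompactOperator h₁ h₂

end HilbertSum

/-! ### Toeplitz operators, parametrices and coherent sequences -/

section Toeplitz

variable {n ℓ N : ℕ}

/-- Supplies the separability required by the weak-sequence criterion for compactness. -/
instance : SecondCountableTopology (L2 n) :=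
  have : Fact ((2 : ℝ≥0∞) ≠ ⊤) := ⟨by norm_num⟩
  inferInstance

lemma mulOp_add (a b : Cn n →ᵇ ℂ) : mulOp (a + b) = mulOp a + mulOp b := by
  refine ContinuousLinearMap.ext fun f => Lp.ext ?_
  rw [add_apply]
  filter_upwards [coeFn_mulOp (a + b) f, coeFn_mulOp a f, coeFn_mulOp b f,
    Lp.coeFn_add (mulOp a f) (mulOp b f)] with z h1 h2 h3 h4
  rw [h1, h4, Pi.add_apply, h2, h3, BoundedContinuousFunction.add_apply, add_mul]

lemma mulOp_mul (a b : Cn n →ᵇ ℂ) (f : L2 n) : mulOp (a * b) f = mulOp a (mulOp b f) := by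
  refine Lp.ext ?_
  filter_upwards [coeFn_mulOp (a * b) f, coeFn_mulOp a (mulOp b f), coeFn_mulOp b f]
    with z h1 h2 h3
  rw [h1, h2, h3, BoundedContinuousFunction.mul_apply, mul_assoc]

lemma mulOp_algebraMap (c : ℂ) (f : L2 n) : mulOp (algebraMap ℂ (Cn n →ᵇ ℂ) c) f = c • f := by
  refine Lp.ext ?_
  filter_upwards [coeFn_mulOp (algebraMap ℂ (Cn n →ᵇ ℂ) c) f, Lp.coeFn_smul c f] with z h1 h2
  rw [h1, h2]
  simp [BoundedContinuousFunction.algebraMap_apply]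

lemma toeplitz_apply (a : Cn n →ᵇ ℂ) (f : level n ℓ) :
    toeplitz ℓ a f = (level n ℓ).orthogonalProjectionOnto (mulOp a f) := rfl

lemma toeplitz_algebraMap (c : ℂ) (f : level n ℓ) :
    toeplitz ℓ (algebraMap ℂ (Cn n →ᵇ ℂ) c) f = c • f := by
  rw [toeplitz_apply, mulOp_algebraMap, map_smul,
    Submodule.orthogonalProjectionOnto_mem_subspace_eq_self]

/-- The Toeplitz operator depends additively on its symbol. -/
def toeplitzHom (n ℓ : ℕ) : (Cn n →ᵇ ℂ) →+ level n ℓ →L[ℂ] level n ℓ :=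
  AddMonoidHom.mk' (toeplitz ℓ) fun a b => by
    simp only [toeplitz, mulOp_add, ContinuousLinearMap.add_comp, ContinuousLinearMap.comp_add]

lemma toeplitz_sub (a b : Cn n →ᵇ ℂ) : toeplitz ℓ (a - b) = toeplitz ℓ a - toeplitz ℓ b :=
  map_sub (toeplitzHom n ℓ) a b

lemma toeplitz_sum {ι : Type*} (s : Finset ι) (a : ι → Cn n →ᵇ ℂ) :
    toeplitz ℓ (∑ i ∈ s, a i) = ∑ i ∈ s, toeplitz ℓ (a i) :=
  map_sum (toeplitzHom n ℓ) a s

lemma WeaklyNull.coe_level {x : ℕ → level n ℓ} (hx : WeaklyNull x) :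
    WeaklyNull fun j => (x j : L2 n) :=
  hx.map (level n ℓ).subtypeL

lemma WeaklyNull.tendsto_toeplitz {x : ℕ → level n ℓ} (hx : WeaklyNull x) {a : Cn n →ᵇ ℂ}
    (ha : Tendsto a (cocompact (Cn n)) (𝓝 0)) :
    Tendsto (fun j => toeplitz ℓ a (x j)) atTop (𝓝 0) := by
  have h := ((level n ℓ).orthogonalProjectionOnto.continuous.tendsto 0).comp
    (hx.coe_level.tendsto_mulOp (fun j => (x j).2) ha)
  rwa [map_zero] at h

/-- Toeplitz operators with slowly varying symbols are multiplicative up to compact operators. -/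
lemma WeaklyNull.tendsto_toeplitz_mul_sub {x : ℕ → level n ℓ} (hx : WeaklyNull x)
    (a : Cn n →ᵇ ℂ) {b : Cn n →ᵇ ℂ} (hb : SlowlyVarying b) :
    Tendsto (fun j => toeplitz ℓ a (toeplitz ℓ b (x j)) - toeplitz ℓ (a * b) (x j)) atTop
      (𝓝 0) := by
  -- On the level, T(a)T(b) - T(ab) = -Pa(1 - P)b, so the Hankel estimate for b suffices and a may
  -- be any bounded symbol.
  let T : L2 n →L[ℂ] level n ℓ := -((level n ℓ).orthogonalProjectionOnto ∘L mulOp a)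
  have h := (T.continuous.tendsto 0).comp (hx.coe_level.tendsto_hankel (fun j => (x j).2) hb)
  rw [map_zero] at h
  refine h.congr fun j => ?_
  simp only [toeplitz_apply, mulOp_mul]
  change -(level n ℓ).orthogonalProjectionOnto (mulOp a _) = _
  rw [map_sub, map_sub, neg_sub]
  rfl

lemma weaklyNull_coherent {w : ℕ → Cn n} (hw : Tendsto (fun j => ‖w j‖) atTop atTop)
    {K : L2 n} (hK : K ∈ level n ℓ) :
    WeaklyNull fun j => (⟨magneticTranslation (w j) K, magneticTranslation_mem_level _ hK⟩ :
      level n ℓ) := by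
  obtain ⟨hb, hy⟩ := weaklyNull_magneticTranslation hw K
  exact ⟨hb, fun y => hy y⟩

/-- Coherent states moving to infinity in the direction `v` are approximate eigenvectors. -/
lemma HasBoundaryValue.tendsto_toeplitz_sub {a : Cn n →ᵇ ℂ} {g : C(Sphere n, ℂ)}
    (h : HasBoundaryValue a g) (v : Sphere n) {K : L2 n} {x : ℕ → level n ℓ}
    (hx : ∀ j : ℕ, (x j : L2 n) = magneticTranslation ((j : ℝ) • (v : Cn n)) K) :
    Tendsto (fun j => toeplitz ℓ a (x j) - g v • x j) atTop (𝓝 0) := by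
  have h1 := tendsto_mulOp_magneticTranslation (m := a - algebraMap ℂ (Cn n →ᵇ ℂ) (g v))
    (w := fun j : ℕ => (j : ℝ) • (v : Cn n)) (fun y => by
      simpa [BoundedContinuousFunction.algebraMap_apply] using
        (h.tendsto_ray v y).sub_const (g v)) K
  have h2 := ((level n ℓ).orthogonalProjectionOnto.continuous.tendsto 0).comp h1
  rw [map_zero] at h2
  refine h2.congr fun j => ?_
  rw [Function.comp_apply, ← hx j, ← toeplitz_apply, toeplitz_sub, sub_apply, toeplitz_algebraMap]

lemma tendsto_norm_ray (v : Sphere n) :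
    Tendsto (fun j : ℕ => ‖(j : ℝ) • (v : Cn n)‖) atTop atTop := by
  refine tendsto_natCast_atTop_atTop.congr fun j => ?_
  rw [norm_smul, norm_eq_of_mem_sphere, mul_one, Real.norm_natCast]

/-- In every direction, a Landau level contains a weakly null sequence of vectors of constant
nonzero norm on which every Toeplitz operator acts asymptotically by its boundary value. -/
lemma exists_coherent_sequence (hn : 1 ≤ n) (ℓ : ℕ) (v : Sphere n) :
    ∃ (x : ℕ → level n ℓ) (r : ℝ), WeaklyNull x ∧ 0 < r ∧ (∀ j, ‖x j‖ = r) ∧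
      ∀ (a : Cn n →ᵇ ℂ) (g : C(Sphere n, ℂ)), HasBoundaryValue a g →
        Tendsto (fun j => toeplitz ℓ a (x j) - g v • x j) atTop (𝓝 0) :=
  ⟨_, ‖kernel n ℓ‖, weaklyNull_coherent (tendsto_norm_ray v) (kernel_mem_level ℓ),
    norm_pos_iff.2 (kernel_ne_zero hn ℓ), fun _ => norm_magneticTranslation _ _,
    fun _ _ h => h.tendsto_toeplitz_sub v fun _ => rfl⟩

lemma isCompactOperator_toeplitz {a : Cn n →ᵇ ℂ} (ha : Tendsto a (cocompact (Cn n)) (𝓝 0)) :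
    IsCompactOperator (toeplitz ℓ a) :=
  isCompactOperator_of_weaklyNull fun _ hx => hx.tendsto_toeplitz ha

/-- A compact operator sends the coherent sequence in direction v to 0, yet asymptotically acts on
it as g(v); the norms being constant and positive, g(v) = 0. -/
lemma tendsto_cocompact_of_isCompactOperator (hn : 1 ≤ n) {a : Cn n →ᵇ ℂ} {g : C(Sphere n, ℂ)}
    (h : HasBoundaryValue a g) (hT : IsCompactOperator (toeplitz ℓ a)) :
    Tendsto a (cocompact (Cn n)) (𝓝 0) := by
  have hg : g = 0 := ContinuousMap.ext fun v => by
    obtain ⟨x, r, hx, hr, hxr, hxa⟩ := exists_coherent_sequence hn ℓ v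
    have h1 := ((hx.tendsto_of_isCompactOperator hT).sub (hxa a g h)).norm
    simp only [sub_sub_cancel, norm_smul, hxr, sub_zero, norm_zero] at h1
    have h2 := tendsto_nhds_unique h1 tendsto_const_nhds
    simpa [hr.ne'] using h2.symm
  exact (hg ▸ h).tendsto_zero

lemma toeplitz_mul_sub_one_apply (u b : Matrix (Fin N) (Fin N) (Cn n →ᵇ ℂ)) (i k : Fin N)
    (f : level n ℓ) : toeplitz ℓ ((u * b - 1) i k) f =
      (∑ m, toeplitz ℓ (u i m * b m k) f) - if i = k then f else 0 := by
  have h : (u * b - 1) i k =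
      (∑ m, u i m * b m k) - algebraMap ℂ (Cn n →ᵇ ℂ) (if i = k then 1 else 0) := by
    rw [Matrix.sub_apply, Matrix.mul_apply, Matrix.one_apply]
    split_ifs <;> simp
  rw [h, toeplitz_sub, sub_apply, toeplitz_sum, sum_apply, toeplitz_algebraMap]
  split_ifs <;> simp

/-- Inserting T(u_im b_mk) separates the failure of multiplicativity from the symbol ub - 1; each
part tends to 0 on weakly null sequences for its own reason. -/
lemma matrixToeplitz_comp_sub_one_apply (u b : Matrix (Fin N) (Fin N) (Cn n →ᵇ ℂ))
    (f : levelTensor n ℓ N) (i : Fin N) :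
    (matrixToeplitz ℓ u ∘L matrixToeplitz ℓ b - 1 : levelTensor n ℓ N →L[ℂ] levelTensor n ℓ N) f i =
      (∑ m, ∑ k, (toeplitz ℓ (u i m) (toeplitz ℓ (b m k) (f k)) -
        toeplitz ℓ (u i m * b m k) (f k))) + ∑ k, toeplitz ℓ ((u * b - 1) i k) (f k) := by
  have h : (matrixToeplitz ℓ u ∘L matrixToeplitz ℓ b - 1 :
      levelTensor n ℓ N →L[ℂ] levelTensor n ℓ N) f i =
      matrixToeplitz ℓ u (matrixToeplitz ℓ b f) i - f i := rfl
  rw [h, matrixToeplitz_apply]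
  simp only [matrixToeplitz_apply, map_sum, toeplitz_mul_sub_one_apply, Finset.sum_sub_distrib,
    Finset.sum_ite_eq, Finset.mem_univ, if_true]
  rw [Finset.sum_comm (f := fun k m => toeplitz ℓ (u i m * b m k) (f k))]
  abel

lemma isCompactOperator_matrixToeplitz_comp_sub_one {u b : Matrix (Fin N) (Fin N) (Cn n →ᵇ ℂ)}
    (hb : ∀ m k, SlowlyVarying (b m k))
    (hub : ∀ i k, Tendsto ((u * b - 1) i k) (cocompact (Cn n)) (𝓝 0)) :
    IsCompactOperator (matrixToeplitz ℓ u ∘L matrixToeplitz ℓ b - 1 :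
      levelTensor n ℓ N →L[ℂ] levelTensor n ℓ N) := by
  refine isCompactOperator_piLp fun X hX i => ?_
  simp only [matrixToeplitz_comp_sub_one_apply]
  have h := (tendsto_finsetSum Finset.univ fun m _ => tendsto_finsetSum Finset.univ fun k _ =>
      (hX k).tendsto_toeplitz_mul_sub (u i m) (hb m k)).add
    (tendsto_finsetSum Finset.univ fun k _ => (hX k).tendsto_toeplitz (hub i k))
  simpa only [Finset.sum_const_zero, add_zero] using h

lemma tendsto_mul_sub_one {u b : Matrix (Fin N) (Fin N) (symbolAlgebra n)}
    (h : u.map (boundaryMap n) * b.map (boundaryMap n) = 1) (i k : Fin N) :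
    Tendsto ((u.map (fun a => (a : Cn n →ᵇ ℂ)) * b.map (fun a => (a : Cn n →ᵇ ℂ)) - 1) i k)
      (cocompact (Cn n)) (𝓝 0) := by
  have h0 : boundaryMap n ((u * b - 1) i k) = 0 := by
    have h1 := congrFun (congrFun h i) k
    rw [← Matrix.map_mul, Matrix.map_apply] at h1
    rw [Matrix.sub_apply, map_sub, h1, Matrix.one_apply, Matrix.one_apply]
    split_ifs <;> simp
  have h2 := hasBoundaryValue_boundaryMap ((u * b - 1) i k)
  rw [h0] at h2
  have h3 : (((u * b - 1) i k : symbolAlgebra n) : Cn n →ᵇ ℂ) =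
      (u.map (fun a => (a : Cn n →ᵇ ℂ)) * b.map (fun a => (a : Cn n →ᵇ ℂ)) - 1) i k := by
    simp only [Matrix.sub_apply, Matrix.mul_apply, Matrix.one_apply, Matrix.map_apply]
    split_ifs <;> simp
  exact h3 ▸ h2.tendsto_zero

/-- The Toeplitz operator of any lift of the inverse boundary matrix is a parametrix: both products
of the symbols differ from 1 by entries vanishing at infinity. -/
lemma isFredholm_matrixToeplitz {u : Matrix (Fin N) (Fin N) (symbolAlgebra n)}
    (hu : IsUnit (u.map (boundaryMap n))) :
    (matrixToeplitz ℓ (u.map fun a => (a : Cn n →ᵇ ℂ))).IsFredholm := by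
  obtain ⟨U, hU⟩ := hu
  -- A set-theoretic section suffices, since it is only applied entrywise.
  choose s hs using boundaryMap_surjective (n := n)
  have hb : ((↑U⁻¹ : Matrix (Fin N) (Fin N) C(Sphere n, ℂ)).map s).map (boundaryMap n) = ↑U⁻¹ := by
    refine Matrix.ext fun i k => ?_
    exact hs _
  have hsv : ∀ (w : Matrix (Fin N) (Fin N) (symbolAlgebra n)) (i k : Fin N),
      SlowlyVarying (w.map (fun a => (a : Cn n →ᵇ ℂ)) i k) :=
    fun w i k => (hasBoundaryValue_boundaryMap (w i k)).slowlyVarying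
  exact isFredholm_piLp
    (isCompactOperator_matrixToeplitz_comp_sub_one (hsv u)
      (tendsto_mul_sub_one (by rw [hb, ← hU, Units.inv_mul])))
    (isCompactOperator_matrixToeplitz_comp_sub_one (hsv _)
      (tendsto_mul_sub_one (by rw [hb, ← hU, Units.mul_inv])))

/-- If the determinant vanishes at v, a null vector c of the matrix at v makes c ⊗ xⱼ, with xⱼ
coherent in direction v, a singular sequence. -/
lemma isUnit_of_isFredholm (hn : 1 ≤ n) {u : Matrix (Fin N) (Fin N) (symbolAlgebra n)}
    (hT : (matrixToeplitz ℓ (u.map fun a => (a : Cn n →ᵇ ℂ))).IsFredholm) :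
    IsUnit (u.map (boundaryMap n)) := by
  rw [Matrix.isUnit_iff_isUnit_det, ContinuousMap.isUnit_iff_forall_ne_zero]
  intro v hv
  let ev : C(Sphere n, ℂ) →+* ℂ := (Pi.evalRingHom (fun _ => ℂ) v).comp ContinuousMap.coeFnRingHom
  have hdet : (ev.mapMatrix (u.map (boundaryMap n))).det = 0 := by
    rw [← RingHom.map_det]
    exact hv
  obtain ⟨c, hc0, hc⟩ := Matrix.exists_mulVec_eq_zero_iff.2 hdet
  obtain ⟨x, r, hx, hr, hxr, hxa⟩ := exists_coherent_sequence hn ℓ v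
  refine not_isFredholm_piLp hr hx hxr hc0 (fun i => ?_) hT
  have h1 : Tendsto (fun j => ∑ k, c k • (toeplitz ℓ (u i k : Cn n →ᵇ ℂ) (x j) -
      boundaryMap n (u i k) v • x j)) atTop (𝓝 (∑ k, c k • 0)) :=
    tendsto_finsetSum _ fun k _ =>
      (hxa _ _ (hasBoundaryValue_boundaryMap (u i k))).const_smul (c k)
  simp only [smul_zero, Finset.sum_const_zero] at h1
  refine h1.congr fun j => ?_
  have h2 : ∑ k, boundaryMap n (u i k) v * c k = 0 := congrFun hc i
  rw [matrixToeplitz_apply]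
  simp only [map_smul, smul_sub, Finset.sum_sub_distrib, smul_smul, Matrix.map_apply]
  rw [← Finset.sum_smul]
  simp_rw [mul_comm (c _)]
  rw [h2, zero_smul, sub_zero]

end Toeplitz

end

end Landau

theorem mainTheorem6 (n : ℕ) (hn : 1 ≤ n) (ℓ : ℕ) :
    (∀ (N : ℕ) (u : Matrix (Fin N) (Fin N) (Landau.symbolAlgebra n)),
      (Landau.matrixToeplitz ℓ (u.map fun a => (a : Landau.Cn n →ᵇ ℂ))).IsFredholm ↔
        IsUnit (u.map (Landau.boundaryMap n))) ∧
    (∀ a : Landau.symbolAlgebra n,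
      IsCompactOperator (Landau.toeplitz ℓ (a : Landau.Cn n →ᵇ ℂ)) ↔
        Tendsto a.1 (cocompact (Landau.Cn n)) (𝓝 0)) :=
  ⟨fun _ _ => ⟨Landau.isUnit_of_isFredholm hn, Landau.isFredholm_matrixToeplitz⟩,
    fun a => ⟨Landau.tendsto_cocompact_of_isCompactOperator hn
      (Landau.hasBoundaryValue_boundaryMap a), Landau.isCompactOperator_toeplitz⟩⟩
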